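/- Let $k$ be a commutative ring and let $\mathcal{A}=(A=\bigoplus_{i\in\mathbb{Z}}A^i,d)$ be a differential graded (dg) $k$-algebra such that $A^i=0$ for $i<0$, the ring $A^0$ is semisimple, and $d(A^0)=0$. Let $(L_x)_{x\in W}$ be a system of representatives of the isomorphism classes of simple right $A^0$-modules, and let $\hat L_x = L_x\otimes_{A^0}A$ be the dg right $\mathcal{A}$-module with $L_x$ in degree $0$ and differential $l\otimes a\mapsto l\otimes d(a)$. Let $\mathrm{dgMod}$ be the category of dg right $\mathcal{A}$-modules (morphisms are the $A$-linear maps of degree $0$ that commute with the differentials) and $\mathrm{dgHot}$ its homotopy category, with the triangulated structure given by the shift $\{1\}$ and mapping cones. Let $\mathrm{dgPer}\subset\mathrm{dgHot}$ be the smallest strict full triangulated subcategory that contains $\mathcal{A}$ and is closed under direct summands. For a dg module $M$ put $\overline{M}=M/MA^+$, where $A^+=\bigoplus_{i>0}A^i$. Let $\mathrm{dgPer}^{\le 0}$ (respectively $\mathrm{dgPer}^{\ge 0}$) be the full subcategory of those $M\in\mathrm{dgPer}$ with $H^i(\overline{M})=0$ for all $i>0$ (respectively for all $i<0$), and let $\heartsuit=\mathrm{dgPer}^{\le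 0}\cap\mathrm{dgPer}^{\ge 0}$ be the heart of the t-structure $(\mathrm{dgPer}^{\le 0},\mathrm{dgPer}^{\ge 0})$ on $\mathrm{dgPer}$. Let $\mathrm{dgFlag}$ be the full subcategory of $\mathrm{dgMod}$ consisting of the dg modules $M$ that admit a finite filtration $0=F_0\subset F_1\subset\dots\subset F_n=M$ by dg submodules such that each $F_i/F_{i-1}$ is isomorphic in $\mathrm{dgMod}$ to some $\hat L_{x_i}$, $x_i\in W$. Then: 1. Every object of $\mathrm{dgFlag}$ lies in $\heartsuit$, and the functor $\mathrm{dgFlag}\to\heartsuit$ obtained by restricting the canonical functor $\mathrm{dgMod}\to\mathrm{dgHot}$ is an equivalence of categories. 2. Every object of $\heartsuit$ has finite length (it has a finite composition series in $\heartsuit$). 3. Each $\hat L_x$, $x\in W$, is a simple object of $\heartsuit$; every simple object of $\heartsuit$ is isomorphic to some $\hat L_x$; and for $x\ne y$ the objects $\hat L_x$ and $\hat L_y$ of $\heartsuit$ are not isomorphic. -/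

import Mathlib

open CategoryTheory CategoryTheory.Limits
open scoped TensorProduct RightActions

universe u v w

noncomputable section

namespace DGPerf

/-! ### Helper facts on internal gradings and quotients -/

section Helpers

variable {M : Type*} [AddCommGroup M]

/-- A family of subgroups spanning `M` is a grading as soon as it admits a family of projections. -/
theorem isInternal_of_proj (G : ℤ → AddSubgroup M) (p : ℤ → M →+ M)
    (h1 : ∀ i, ∀ x ∈ G i, p i x = x) (h2 : ∀ i j, i ≠ j → ∀ x ∈ G j, p i x = 0)
    (h3 : ⨆ i, G i = ⊤) : DirectSum.IsInternal G := by
  have key : ∀ (x : DirectSum ℤ fun i => G i) (i : ℤ),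
      p i (DirectSum.coeAddMonoidHom G x) = (x i : M) := by
    intro x i
    induction x using DirectSum.induction_on with
    | zero => simp
    | of j y =>
      rw [DirectSum.coeAddMonoidHom_of]
      by_cases hij : i = j
      · subst hij
        rw [h1 i _ y.2, DirectSum.of_eq_same]
      · rw [h2 i j hij _ y.2, DirectSum.of_eq_of_ne _ _ _ hij]
        rfl
    | add x y hx hy => simp [hx, hy]
  constructor
  · intro x y hxy
    refine DFinsupp.ext fun i => Subtype.ext ?_
    rw [← key x i, ← key y i, hxy]
  · intro m
    have hm : m ∈ ⨆ i, G i := by rw [h3]; trivial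
    induction hm using AddSubgroup.iSup_induction' with
    | hp i x hx => exact ⟨DirectSum.of (fun i => G i) i ⟨x, hx⟩, by simp⟩
    | h1 => exact ⟨0, map_zero _⟩
    | hadd x y _ _ hx hy =>
      obtain ⟨a, rfl⟩ := hx
      obtain ⟨b, rfl⟩ := hy
      exact ⟨a + b, map_add _ _ _⟩

/-- The additive projection onto the `i`-th component of an internal grading. -/
def gradeProj (G : ℤ → AddSubgroup M) (h : DirectSum.IsInternal G) (i : ℤ) : M →+ M :=
  (G i).subtype.comp ((DFinsupp.evalAddMonoidHom i).comp
    (AddEquiv.ofBijective (DirectSum.coeAddMonoidHom G) h).symm.toAddMonoidHom)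

variable {G : ℤ → AddSubgroup M} (h : DirectSum.IsInternal G)

theorem gradeProj_mem (i : ℤ) (x : M) : gradeProj G h i x ∈ G i :=
  Subtype.property _

theorem gradeProj_coe (x : DirectSum ℤ fun i => G i) (i : ℤ) :
    gradeProj G h i (DirectSum.coeAddMonoidHom G x) = (x i : M) := by
  have : (AddEquiv.ofBijective (DirectSum.coeAddMonoidHom G) h).symm
      (DirectSum.coeAddMonoidHom G x) = x :=
    (AddEquiv.ofBijective (DirectSum.coeAddMonoidHom G) h).symm_apply_apply x
  change (((AddEquiv.ofBijective (DirectSum.coeAddMonoidHom G) h).symm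
      (DirectSum.coeAddMonoidHom G x)) i : M) = _
  rw [this]

theorem gradeProj_same {i : ℤ} {x : M} (hx : x ∈ G i) : gradeProj G h i x = x := by
  have := gradeProj_coe h (DirectSum.of (fun i => G i) i ⟨x, hx⟩) i
  simpa [DirectSum.of_eq_same] using this

theorem gradeProj_ne {i j : ℤ} (hij : i ≠ j) {x : M} (hx : x ∈ G j) : gradeProj G h i x = 0 := by
  have := gradeProj_coe h (DirectSum.of (fun i => G i) j ⟨x, hx⟩) i
  rw [DirectSum.of_eq_of_ne _ _ _ hij] at this
  simpa using this

theorem iSup_eq_top_of_isInternal (h : DirectSum.IsInternal G) : ⨆ i, G i = ⊤ := by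
  rw [eq_top_iff]
  intro m _
  obtain ⟨x, rfl⟩ := h.2 m
  induction x using DirectSum.induction_on with
  | zero => simp
  | of j y =>
    rw [DirectSum.coeAddMonoidHom_of]
    exact AddSubgroup.mem_iSup_of_mem j y.2
  | add x y hx hy =>
    rw [map_add]
    exact add_mem (hx trivial) (hy trivial)

/-- Every element is a finite sum of its homogeneous components. -/
theorem mem_of_gradeProj_mem (S : AddSubgroup M) (m : M)
    (hm : ∀ i, gradeProj G h i m ∈ S) : m ∈ S := by
  obtain ⟨x, rfl⟩ := h.2 m
  classical
  rw [DirectSum.coeAddMonoidHom_eq_dfinsuppSum]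
  refine sum_mem fun i _ => ?_
  change ((x i : G i) : M) ∈ S
  rw [← gradeProj_coe h x i]
  exact hm i

/-- Two additive maps agreeing on homogeneous elements are equal. -/
theorem addHom_ext_of_isInternal {N : Type*} [AddCommGroup N] (h : DirectSum.IsInternal G)
    (f g : M →+ N) (hfg : ∀ i, ∀ x ∈ G i, f x = g x) (m : M) : f m = g m := by
  have : m ∈ (f - g).ker := mem_of_gradeProj_mem h _ _ fun i => by
    simp [AddMonoidHom.mem_ker, hfg i _ (gradeProj_mem h i m)]
  exact sub_eq_zero.1 this

/-- Additive maps respecting the gradings commute with the projections. -/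
theorem map_gradeProj {N : Type*} [AddCommGroup N] {G' : ℤ → AddSubgroup N}
    (h' : DirectSum.IsInternal G') (f : M →+ N) (hf : ∀ i, ∀ x ∈ G i, f x ∈ G' i) (i : ℤ) (m : M) :
    f (gradeProj G h i m) = gradeProj G' h' i (f m) := by
  refine addHom_ext_of_isInternal h (f.comp (gradeProj G h i)) ((gradeProj G' h' i).comp f)
    (fun j x hx => ?_) m
  by_cases hij : i = j
  · subst hij
    simp [gradeProj_same h hx, gradeProj_same h' (hf i x hx)]
  · simp [gradeProj_ne h hij hx, gradeProj_ne h' hij (hf j x hx)]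

/-- An additive map killing the submodule `S` factors through `M ⧸ S`. -/
def quotLift {R : Type*} [Ring R] [Module R M] (S : Submodule R M) {N : Type*} [AddCommGroup N]
    (f : M →+ N) (hf : ∀ x ∈ S, f x = 0) : M ⧸ S →+ N :=
  QuotientAddGroup.lift S.toAddSubgroup f hf

@[simp] theorem quotLift_mk {R : Type*} [Ring R] [Module R M] (S : Submodule R M) {N : Type*}
    [AddCommGroup N] (f : M →+ N) (hf : ∀ x ∈ S, f x = 0) (x : M) :
    quotLift S f hf (Submodule.Quotient.mk x) = f x := rfl

end Helpers

/-! ### Differential graded algebras -/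

/-- A differential (`ℤ`-)graded `k`-algebra. -/
structure DGAlgebra (k : Type v) [CommRing k] where
  /-- the underlying `k`-algebra `A` -/
  carrier : Type u
  [ring : Ring carrier]
  [algebra : Algebra k carrier]
  /-- the homogeneous component `A^i` -/
  gr : ℤ → Submodule k carrier
  [graded : GradedAlgebra gr]
  /-- the differential -/
  d : carrier →ₗ[k] carrier
  d_mem : ∀ {i : ℤ} {a : carrier}, a ∈ gr i → d a ∈ gr (i + 1)
  d_d : ∀ a : carrier, d (d a) = 0
  leibniz : ∀ {i : ℤ} {a : carrier} (b : carrier), a ∈ gr i →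
    d (a * b) = d a * b + i.negOnePow • (a * d b)

attribute [instance] DGAlgebra.ring DGAlgebra.algebra DGAlgebra.graded

variable {k : Type v} [CommRing k]

/-- The ring `A^0`. -/
abbrev DGAlgebra.zeroPart (𝒜 : DGAlgebra.{u} k) : Type u := 𝒜.gr 0

/-- The grading of `A` by the additive subgroups `A^i`. -/
abbrev DGAlgebra.addGr (𝒜 : DGAlgebra.{u} k) (i : ℤ) : AddSubgroup 𝒜.carrier :=
  (𝒜.gr i).toAddSubgroup

theorem DGAlgebra.isInternal (𝒜 : DGAlgebra.{u} k) : DirectSum.IsInternal 𝒜.addGr :=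
  DirectSum.Decomposition.isInternal 𝒜.gr

/-! ### Differential graded right modules -/

/-- A differential graded right module over `𝒜`. Right `A`-modules are modules over the opposite
ring, and `m <• a` is the right action. (The compatibility with the action of `k` through
`k → A^0` is automatic, as `d` vanishes on the image of `k` in `A`.) -/
structure DGMod (𝒜 : DGAlgebra.{u} k) where
  /-- the underlying right `A`-module `M` -/
  carrier : Type u
  [addCommGroup : AddCommGroup carrier]
  [module : Module 𝒜.carrierᵐᵒᵖ carrier]
  /-- the homogeneous component `M^i` -/
  gr : ℤ → AddSubgroup carrier
  isInternal : DirectSum.IsInternal gr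
  smul_mem : ∀ {i j : ℤ} {m : carrier} {a : 𝒜.carrier}, m ∈ gr i → a ∈ 𝒜.gr j →
    m <• a ∈ gr (i + j)
  /-- the differential -/
  d : carrier →+ carrier
  d_mem : ∀ {i : ℤ} {m : carrier}, m ∈ gr i → d m ∈ gr (i + 1)
  d_d : ∀ m : carrier, d (d m) = 0
  leibniz : ∀ {i : ℤ} {m : carrier} (a : 𝒜.carrier), m ∈ gr i →
    d (m <• a) = d m <• a + i.negOnePow • (m <• 𝒜.d a)

attribute [instance] DGMod.addCommGroup DGMod.module

namespace DGMod

variable {𝒜 : DGAlgebra.{u} k}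

/-- Morphisms of dg modules: `A`-linear maps of degree `0` commuting with the differentials. -/
structure Hom (M N : DGMod 𝒜) where
  /-- the underlying `A`-linear map -/
  toLin : M.carrier →ₗ[𝒜.carrierᵐᵒᵖ] N.carrier
  map_mem : ∀ {i : ℤ} {m : M.carrier}, m ∈ M.gr i → toLin m ∈ N.gr i
  comm : ∀ m : M.carrier, toLin (M.d m) = N.d (toLin m)

theorem Hom.toLin_injective {M N : DGMod 𝒜} : Function.Injective (Hom.toLin (M := M) (N := N)) := by
  rintro ⟨f, _, _⟩ ⟨g, _, _⟩ h
  cases h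
  rfl

/-- The category `dgMod(𝒜)`. -/
instance : Category (DGMod 𝒜) where
  Hom M N := Hom M N
  id M := ⟨LinearMap.id, fun h => h, fun _ => rfl⟩
  comp f g := ⟨g.toLin.comp f.toLin, fun h => g.map_mem (f.map_mem h), fun m => by
    simp [f.comm, g.comm]⟩

@[ext] theorem hom_ext {M N : DGMod 𝒜} {f g : M ⟶ N} (h : Hom.toLin f = Hom.toLin g) : f = g :=
  Hom.toLin_injective h

@[simp] theorem toLin_id (M : DGMod 𝒜) : Hom.toLin (𝟙 M) = LinearMap.id := rfl

@[simp] theorem toLin_comp {M N P : DGMod 𝒜} (f : M ⟶ N) (g : N ⟶ P) :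
    Hom.toLin (f ≫ g) = (Hom.toLin g).comp (Hom.toLin f) := rfl

section HomGroup

variable (M N : DGMod 𝒜)

instance : Zero (M ⟶ N) := ⟨⟨0, fun _ => zero_mem _, fun m => by simp⟩⟩

instance : Add (M ⟶ N) := ⟨fun f g => ⟨Hom.toLin f + Hom.toLin g,
  fun h => add_mem (Hom.map_mem f h) (Hom.map_mem g h),
  fun m => by simp [Hom.comm f, Hom.comm g]⟩⟩

instance : Neg (M ⟶ N) := ⟨fun f => ⟨-Hom.toLin f,
  fun h => neg_mem (Hom.map_mem f h), fun m => by simp [Hom.comm f]⟩⟩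

instance : Sub (M ⟶ N) := ⟨fun f g => ⟨Hom.toLin f - Hom.toLin g,
  fun h => sub_mem (Hom.map_mem f h) (Hom.map_mem g h),
  fun m => by simp [Hom.comm f, Hom.comm g]⟩⟩

instance : SMul ℕ (M ⟶ N) := ⟨fun n f => ⟨n • Hom.toLin f,
  fun h => nsmul_mem (Hom.map_mem f h) n, fun m => by simp [Hom.comm f]⟩⟩

instance : SMul ℤ (M ⟶ N) := ⟨fun n f => ⟨n • Hom.toLin f,
  fun h => zsmul_mem (Hom.map_mem f h) n, fun m => by simp [Hom.comm f]⟩⟩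

instance : AddCommGroup (M ⟶ N) :=
  Hom.toLin_injective.addCommGroup (fun f : M ⟶ N => Hom.toLin f)
    rfl (fun _ _ => rfl) (fun _ => rfl) (fun _ _ => rfl) (fun _ _ => rfl) (fun _ _ => rfl)

end HomGroup

@[simp] theorem toLin_zero (M N : DGMod 𝒜) : Hom.toLin (0 : M ⟶ N) = 0 := rfl

@[simp] theorem toLin_add {M N : DGMod 𝒜} (f g : M ⟶ N) :
    Hom.toLin (f + g) = Hom.toLin f + Hom.toLin g := rfl

instance : Preadditive (DGMod 𝒜) where
  add_comp _ _ _ f f' g := by ext1; simp [LinearMap.comp_add]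
  comp_add _ _ _ f g g' := by ext1; simp [LinearMap.add_comp]

/-! ### The homotopy category -/

/-- `f - g = d h + h d` for some `A`-linear map `h` of degree `-1`. -/
def Homotopic : HomRel (DGMod 𝒜) := fun M N f g =>
  ∃ h : M.carrier →ₗ[𝒜.carrierᵐᵒᵖ] N.carrier,
    (∀ (i : ℤ) (m : M.carrier), m ∈ M.gr i → h m ∈ N.gr (i - 1)) ∧
    ∀ m : M.carrier, Hom.toLin f m - Hom.toLin g m = N.d (h m) + h (M.d m)

instance : Congruence (Homotopic (𝒜 := 𝒜)) where
  equivalence := {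
    refl := fun f => ⟨0, fun _ _ _ => zero_mem _, fun m => by simp⟩
    symm := by
      rintro f g ⟨h, h1, h2⟩
      refine ⟨-h, fun i m hm => neg_mem (h1 i m hm), fun m => ?_⟩
      rw [← neg_sub, h2]
      simp only [LinearMap.neg_apply, map_neg]
      abel
    trans := by
      rintro f g e ⟨h, h1, h2⟩ ⟨h', h1', h2'⟩
      refine ⟨h + h', fun i m hm => add_mem (h1 i m hm) (h1' i m hm), fun m => ?_⟩
      rw [← sub_add_sub_cancel _ (Hom.toLin g m), h2, h2']
      simp only [LinearMap.add_apply, map_add]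
      abel }
  comp_left := by
    rintro X Y Z f g g' ⟨h, h1, h2⟩
    refine ⟨h.comp (Hom.toLin f), fun i m hm => h1 i _ (Hom.map_mem f hm), fun m => ?_⟩
    simp [h2, Hom.comm f]
  comp_right := by
    rintro X Y Z f f' g ⟨h, h1, h2⟩
    refine ⟨(Hom.toLin g).comp h, fun i m hm => Hom.map_mem g (h1 i m hm), fun m => ?_⟩
    simp [← map_sub, h2, Hom.comm g]

end DGMod

/-- The homotopy category `dgHot(𝒜)`. -/
abbrev DGHot (𝒜 : DGAlgebra.{u} k) := Quotient (DGMod.Homotopic (𝒜 := 𝒜))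

instance (𝒜 : DGAlgebra.{u} k) : Preadditive (DGHot 𝒜) :=
  Quotient.preadditive _ (by
    rintro X Y f₁ f₂ g₁ g₂ ⟨h, h1, h2⟩ ⟨h', h1', h2'⟩
    refine ⟨h + h', fun i m hm => add_mem (h1 i m hm) (h1' i m hm), fun m => ?_⟩
    simp only [DGMod.toLin_add, LinearMap.add_apply, map_add]
    rw [add_sub_add_comm, h2, h2']
    abel)

/-- The canonical functor `dgMod(𝒜) ⥤ dgHot(𝒜)`. -/
abbrev toHot (𝒜 : DGAlgebra.{u} k) : DGMod 𝒜 ⥤ DGHot 𝒜 := Quotient.functor _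

namespace DGMod

variable {𝒜 : DGAlgebra.{u} k}

/-! ### Shifts, mapping cones, and the free module of rank one -/

/-- The shift `{n}M`, with `({n}M)^i = M^{i+n}`, the same `A`-action and
differential `(-1)^n d_M`. -/
def shift (n : ℤ) (M : DGMod 𝒜) : DGMod 𝒜 where
  carrier := M.carrier
  gr i := M.gr (i + n)
  isInternal := by
    refine isInternal_of_proj _ (fun i => gradeProj M.gr M.isInternal (i + n))
      (fun i x hx => gradeProj_same _ hx)
      (fun i j hij x hx => gradeProj_ne _ (by omega) hx) ?_
    rw [← iSup_eq_top_of_isInternal M.isInternal]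
    exact (Equiv.addRight n).iSup_comp (g := M.gr)
  smul_mem {i j m a} hm ha := by
    have := M.smul_mem hm ha
    rwa [add_right_comm] at this
  d := n.negOnePow • M.d
  d_mem {i m} hm := by
    have := M.d_mem hm
    rw [add_right_comm] at this
    exact zsmul_mem this _
  d_d m := by
    change n.negOnePow • M.d (n.negOnePow • M.d m) = 0
    rw [Units.smul_def, Units.smul_def, map_zsmul, M.d_d, smul_zero, smul_zero]
  leibniz {i m} a hm := by
    change n.negOnePow • M.d (m <• a) = (n.negOnePow • M.d m) <• a + _
    rw [M.leibniz a hm, smul_add, Int.negOnePow_add, smul_smul, mul_left_comm, Int.units_mul_self,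
      mul_one, Units.smul_def, Units.smul_def n.negOnePow, smul_comm]

/-- The mapping cone `N ⊕ {1}M` of `f : M ⟶ N`, with differential
`(y, x) ↦ (d y + f x, - d x)`. -/
def cone {M N : DGMod 𝒜} (f : M ⟶ N) : DGMod 𝒜 where
  carrier := N.carrier × M.carrier
  gr i := (N.gr i).prod (M.gr (i + 1))
  isInternal := by
    refine isInternal_of_proj _ (fun i => (gradeProj N.gr N.isInternal i).prodMap
      (gradeProj M.gr M.isInternal (i + 1))) ?_ ?_ ?_
    · rintro i ⟨x, y⟩ ⟨hx, hy⟩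
      exact Prod.ext (gradeProj_same _ hx) (gradeProj_same _ hy)
    · rintro i j hij ⟨x, y⟩ ⟨hx, hy⟩
      exact Prod.ext (gradeProj_ne _ hij hx) (gradeProj_ne _ (by omega) hy)
    · rw [eq_top_iff]
      rintro ⟨x, y⟩ -
      set S : AddSubgroup (N.carrier × M.carrier) :=
        ⨆ i, (N.gr i).prod (M.gr (i + 1))
      have h1 : x ∈ S.comap (AddMonoidHom.inl _ _) :=
        mem_of_gradeProj_mem N.isInternal _ _ fun i =>
          AddSubgroup.mem_iSup_of_mem i ⟨gradeProj_mem _ i x, zero_mem _⟩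
      have h2 : y ∈ S.comap (AddMonoidHom.inr _ _) :=
        mem_of_gradeProj_mem M.isInternal _ _ fun i =>
          AddSubgroup.mem_iSup_of_mem (i - 1) ⟨zero_mem _, by
            simpa using gradeProj_mem M.isInternal i y⟩
      have h : (x, (0 : M.carrier)) + ((0 : N.carrier), y) ∈ S := add_mem h1 h2
      simpa using h
  smul_mem {i j m a} hm ha := by
    refine ⟨N.smul_mem hm.1 ha, ?_⟩
    have := M.smul_mem hm.2 ha
    rwa [add_right_comm] at this
  d := ((N.d.comp (AddMonoidHom.fst _ _)) +
      (Hom.toLin f).toAddMonoidHom.comp (AddMonoidHom.snd _ _)).prod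
    (-(M.d.comp (AddMonoidHom.snd _ _)))
  d_mem {i m} hm := ⟨add_mem (N.d_mem hm.1) (Hom.map_mem f hm.2), neg_mem (M.d_mem hm.2)⟩
  d_d m := by
    ext
    · simp [N.d_d, Hom.comm f]
    · simp [M.d_d]
  leibniz {i m} a hm := by
    refine Prod.ext ?_ ?_
    · have := N.leibniz a hm.1
      simp [this]
      abel
    · have := M.leibniz a hm.2
      simp [this, Int.negOnePow_succ]
      abel

/-- `𝒜` as a dg module over itself. -/
def self (𝒜 : DGAlgebra.{u} k) : DGMod 𝒜 where
  carrier := 𝒜.carrier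
  gr := 𝒜.addGr
  isInternal := 𝒜.isInternal
  smul_mem hm ha := SetLike.mul_mem_graded (A := 𝒜.gr) hm ha
  d := 𝒜.d.toAddMonoidHom
  d_mem hm := 𝒜.d_mem hm
  d_d := 𝒜.d_d
  leibniz a hm := 𝒜.leibniz a hm

/-! ### Dg submodules and subquotients -/

/-- A dg submodule: a graded `A`-submodule which is stable under the differential. -/
structure Sub (M : DGMod 𝒜) where
  /-- the underlying `A`-submodule -/
  toSubmodule : Submodule 𝒜.carrierᵐᵒᵖ M.carrier
  homogeneous : ∀ m ∈ toSubmodule, ∀ i, gradeProj M.gr M.isInternal i m ∈ toSubmodule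
  d_mem : ∀ m ∈ toSubmodule, M.d m ∈ toSubmodule

namespace Sub

variable {M : DGMod 𝒜}

/-- A dg submodule, as a dg module. -/
def toDGMod (V : Sub M) : DGMod 𝒜 where
  carrier := V.toSubmodule
  gr i := (M.gr i).comap V.toSubmodule.subtype.toAddMonoidHom
  isInternal := by
    refine isInternal_of_proj _ (fun i =>
      ((gradeProj M.gr M.isInternal i).comp V.toSubmodule.subtype.toAddMonoidHom).codRestrict
        V.toSubmodule fun x => V.homogeneous x x.2 i) ?_ ?_ ?_
    · intro i x hx
      exact Subtype.ext (gradeProj_same M.isInternal hx)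
    · intro i j hij x hx
      exact Subtype.ext (gradeProj_ne M.isInternal hij hx)
    · rw [eq_top_iff]
      rintro ⟨x, hx⟩ -
      set S : AddSubgroup V.toSubmodule :=
        ⨆ i, (M.gr i).comap V.toSubmodule.subtype.toAddMonoidHom
      have : x ∈ S.map V.toSubmodule.subtype.toAddMonoidHom :=
        mem_of_gradeProj_mem M.isInternal _ _ fun i =>
          ⟨⟨_, V.homogeneous x hx i⟩, AddSubgroup.mem_iSup_of_mem i (gradeProj_mem _ i x), rfl⟩
      obtain ⟨y, hy, rfl⟩ := this
      exact hy
  smul_mem hm ha := M.smul_mem hm ha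
  d := (M.d.comp V.toSubmodule.subtype.toAddMonoidHom).codRestrict V.toSubmodule
    fun x => V.d_mem x x.2
  d_mem hm := M.d_mem hm
  d_d m := Subtype.ext (M.d_d m)
  leibniz a hm := Subtype.ext <| by
    rw [Units.smul_def]
    exact M.leibniz a hm

/-- The inclusion of a dg submodule. -/
def incl (V : Sub M) : V.toDGMod ⟶ M where
  toLin := V.toSubmodule.subtype
  map_mem h := h
  comm _ := rfl

/-- The quotient of a dg module by a dg submodule. -/
def quotient (V : Sub M) : DGMod 𝒜 where
  carrier := M.carrier ⧸ V.toSubmodule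
  gr i := (M.gr i).map V.toSubmodule.mkQ.toAddMonoidHom
  isInternal := by
    refine isInternal_of_proj _ (fun i => quotLift V.toSubmodule
      (V.toSubmodule.mkQ.toAddMonoidHom.comp (gradeProj M.gr M.isInternal i)) fun x hx =>
        (Submodule.Quotient.mk_eq_zero _).2 (V.homogeneous x hx i)) ?_ ?_ ?_
    · rintro i _ ⟨x, hx, rfl⟩
      exact congrArg V.toSubmodule.mkQ (gradeProj_same M.isInternal hx)
    · rintro i j hij _ ⟨x, hx, rfl⟩
      exact (congrArg V.toSubmodule.mkQ (gradeProj_ne M.isInternal hij hx)).trans (map_zero _)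
    · rw [← AddSubgroup.map_iSup, iSup_eq_top_of_isInternal M.isInternal,
        AddSubgroup.map_top_of_surjective _ V.toSubmodule.mkQ_surjective]
  smul_mem := by
    rintro i j _ a ⟨m, hm, rfl⟩ ha
    exact ⟨m <• a, M.smul_mem hm ha, rfl⟩
  d := quotLift V.toSubmodule (V.toSubmodule.mkQ.toAddMonoidHom.comp M.d) fun x hx =>
    (Submodule.Quotient.mk_eq_zero _).2 (V.d_mem x hx)
  d_mem := by
    rintro i _ ⟨m, hm, rfl⟩
    exact ⟨M.d m, M.d_mem hm, rfl⟩
  d_d m := by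
    obtain ⟨m, rfl⟩ := V.toSubmodule.mkQ_surjective m
    exact (congrArg V.toSubmodule.mkQ (M.d_d m)).trans (map_zero _)
  leibniz := by
    rintro i _ a ⟨m, hm, rfl⟩
    refine (congrArg V.toSubmodule.mkQ (M.leibniz a hm)).trans ?_
    rw [map_add, Units.smul_def, map_zsmul]
    rfl

/-- For dg submodules `U`, `V` of `M`, the submodule `U ∩ V` of `V`. -/
def restrict (U V : Sub M) : Sub V.toDGMod where
  toSubmodule := U.toSubmodule.comap (Hom.toLin V.incl)
  homogeneous m hm i := by
    have h := map_gradeProj V.toDGMod.isInternal M.isInternal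
      (Hom.toLin V.incl).toAddMonoidHom (fun _ _ hx => hx) i m
    have h2 := U.homogeneous _ hm i
    change (Hom.toLin V.incl).toAddMonoidHom _ ∈ U.toSubmodule
    rw [h]
    exact h2
  d_mem m hm := U.d_mem _ hm

/-- The subquotient `V / (U ∩ V)`; it is `V / U` for `U ⊆ V`. -/
def subquotient (U V : Sub M) : DGMod 𝒜 := (U.restrict V).quotient

end Sub

/-! ### Reduction modulo `A⁺` -/

/-- The generators `m a` of `M A⁺`, with `m` homogeneous and `a` homogeneous of positive degree. -/
def plusGen (M : DGMod 𝒜) : Set M.carrier :=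
  {x | ∃ (i j : ℤ) (m : M.carrier) (a : 𝒜.carrier),
    m ∈ M.gr i ∧ a ∈ 𝒜.gr j ∧ 0 < j ∧ x = m <• a}

/-- The dg submodule `M A⁺`, where `A⁺` is the sum of all `A^i` with `i > 0`. -/
def plus (M : DGMod 𝒜) : Sub M where
  toSubmodule := Submodule.span _ M.plusGen
  homogeneous m hm i := by
    induction hm using Submodule.closure_induction with
    | zero => rw [map_zero]; exact zero_mem _
    | add x y _ _ hx hy => rw [map_add]; exact add_mem hx hy
    | smul_mem r x hx =>
      obtain ⟨n, hn⟩ : ∃ n, x ∈ M.gr n := by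
        obtain ⟨i, j, m, a, hm, ha, _, rfl⟩ := hx
        exact ⟨i + j, M.smul_mem hm ha⟩
      let φ : 𝒜.carrier →+ M.carrier :=
        { toFun := fun a => gradeProj M.gr M.isInternal i (x <• a)
          map_zero' := by simp
          map_add' := fun a b => by simp [add_smul] }
      have key : r.unop ∈ (Submodule.span 𝒜.carrierᵐᵒᵖ M.plusGen).toAddSubgroup.comap φ := by
        refine mem_of_gradeProj_mem 𝒜.isInternal _ r.unop fun j => ?_
        obtain ⟨a, ha, h1⟩ : ∃ a : 𝒜.carrier,
            gradeProj 𝒜.addGr 𝒜.isInternal j r.unop = a ∧ a ∈ 𝒜.gr j :=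
          ⟨_, rfl, gradeProj_mem 𝒜.isInternal j r.unop⟩
        rw [ha]
        have h2 : x <• a ∈ M.gr (n + j) := M.smul_mem hn h1
        change gradeProj M.gr M.isInternal i (x <• a) ∈ Submodule.span 𝒜.carrierᵐᵒᵖ M.plusGen
        by_cases hij : i = n + j
        · subst hij
          rw [gradeProj_same _ h2]
          exact Submodule.smul_mem _ _ (Submodule.subset_span hx)
        · rw [gradeProj_ne _ hij h2]
          exact zero_mem _
      exact key
  d_mem m hm := by
    induction hm using Submodule.closure_induction with
    | zero => rw [map_zero]; exact zero_mem _
    | add x y _ _ hx hy => rw [map_add]; exact add_mem hx hy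
    | smul_mem r x hx =>
      have hx' := hx
      obtain ⟨i, j, m, a, hm, ha, hj, rfl⟩ := hx
      have h1 := M.leibniz r.unop (M.smul_mem hm ha)
      rw [MulOpposite.op_unop] at h1
      rw [h1, M.leibniz a hm]
      refine add_mem (Submodule.smul_mem _ _ (add_mem ?_ ?_)) ?_
      · exact Submodule.subset_span ⟨i + 1, j, _, a, M.d_mem hm, ha, hj, rfl⟩
      · rw [Units.smul_def]
        have : m <• 𝒜.d a ∈ M.plusGen := ⟨i, j + 1, m, _, hm, 𝒜.d_mem ha, by omega, rfl⟩
        exact zsmul_mem (Submodule.subset_span this) _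
      · rw [Units.smul_def]
        exact zsmul_mem (Submodule.smul_mem _ _ (Submodule.subset_span hx')) _

/-- The reduction `M̄ = M / M A⁺`. -/
def bar (M : DGMod 𝒜) : DGMod 𝒜 := M.plus.quotient

/-- The cohomology `H^i(M)`: cocycles in `M^i` modulo coboundaries. -/
def cohomology (M : DGMod 𝒜) (i : ℤ) : Type u :=
  ↥(M.gr i ⊓ M.d.ker) ⧸ ((M.gr (i - 1)).map M.d).addSubgroupOf (M.gr i ⊓ M.d.ker)

/-- The support `{i | H^i(M) ≠ 0}` of the cohomology of `M`. -/
def cohomologySupport (M : DGMod 𝒜) : Set ℤ := {i | Nontrivial (M.cohomology i)}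

end DGMod

/-! ### Extension of scalars from `A^0` to `A` -/

section Hat

variable (𝒜 : DGAlgebra.{u} k) (L : Type u) [AddCommGroup L] [Module 𝒜.zeroPartᵐᵒᵖ L]

/-- The relations `l ⊗ b a = l b ⊗ a`, for `b ∈ A^0`. The simple tensor `l ⊗ a` of `L ⊗ A` is
written `a ⊗ₜ l`, so that Mathlib's action on the left factor is the right action of `A`. -/
def hatRel : Submodule 𝒜.carrierᵐᵒᵖ (𝒜.carrier ⊗[ℤ] L) :=
  Submodule.span _ {x | ∃ (b : 𝒜.zeroPart) (a : 𝒜.carrier) (l : L),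
    x = ((b : 𝒜.carrier) * a) ⊗ₜ[ℤ] l - a ⊗ₜ[ℤ] (l <• b)}

/-- The right `A`-module `L ⊗_{A^0} A`. -/
abbrev HatCarrier : Type u := (𝒜.carrier ⊗[ℤ] L) ⧸ hatRel 𝒜 L

variable {𝒜} {L}

/-- The simple tensor `l ⊗ a` in `L ⊗_{A^0} A`. -/
def hatMk (l : L) (a : 𝒜.carrier) : HatCarrier 𝒜 L := Submodule.Quotient.mk (a ⊗ₜ[ℤ] l)

theorem hatMk_smul (l : L) (a r : 𝒜.carrier) : hatMk l a <• r = hatMk l (a * r) := rfl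

@[elab_as_elim]
theorem hat_induction {P : HatCarrier 𝒜 L → Prop} (h0 : P 0) (hmk : ∀ l a, P (hatMk l a))
    (hadd : ∀ x y, P x → P y → P (x + y)) (x : HatCarrier 𝒜 L) : P x := by
  obtain ⟨x, rfl⟩ := (hatRel 𝒜 L).mkQ_surjective x
  induction x using TensorProduct.induction_on with
  | zero => rw [map_zero]; exact h0
  | tmul a l => exact hmk l a
  | add x y hx hy => rw [map_add]; exact hadd _ _ hx hy

/-- A left `A^0`-linear additive map `g : A → A` induces `id ⊗ g` on `L ⊗_{A^0} A`. -/
def hatMap (g : 𝒜.carrier →+ 𝒜.carrier)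
    (hg : ∀ b ∈ 𝒜.gr 0, ∀ a, g (b * a) = b * g a) : HatCarrier 𝒜 L →+ HatCarrier 𝒜 L :=
  quotLift (hatRel 𝒜 L) ((hatRel 𝒜 L).mkQ.toAddMonoidHom.comp
    (TensorProduct.map g.toIntLinearMap LinearMap.id).toAddMonoidHom) <| by
      intro x hx
      refine (Submodule.Quotient.mk_eq_zero _).2 ?_
      induction hx using Submodule.closure_induction with
      | zero => rw [map_zero]; exact zero_mem _
      | add x y _ _ hx hy => rw [map_add]; exact add_mem hx hy
      | smul_mem r x hx =>
        obtain ⟨b, a, l, rfl⟩ := hx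
        refine Submodule.subset_span ⟨b, g (a * r.unop), l, ?_⟩
        have h1 : r • (((b : 𝒜.carrier) * a) ⊗ₜ[ℤ] l - a ⊗ₜ[ℤ] (l <• b)) =
            ((b : 𝒜.carrier) * (a * r.unop)) ⊗ₜ[ℤ] l - (a * r.unop) ⊗ₜ[ℤ] (l <• b) := by
          rw [smul_sub, TensorProduct.smul_tmul', TensorProduct.smul_tmul', ← mul_assoc]
          rfl
        rw [h1, map_sub]
        change g _ ⊗ₜ[ℤ] l - g _ ⊗ₜ[ℤ] _ = _
        rw [hg b b.2]
        rfl

@[simp] theorem hatMap_mk (g : 𝒜.carrier →+ 𝒜.carrier)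
    (hg : ∀ b ∈ 𝒜.gr 0, ∀ a, g (b * a) = b * g a) (l : L) (a : 𝒜.carrier) :
    hatMap g hg (hatMk l a) = hatMk l (g a) := rfl

theorem hatMk_add (l : L) (a b : 𝒜.carrier) :
    hatMk l (a + b) = hatMk l a + hatMk l b :=
  congrArg (hatRel 𝒜 L).mkQ (TensorProduct.add_tmul a b l)

/-- The additive map `a ↦ l ⊗ a`. -/
def hatMkHom (l : L) : 𝒜.carrier →+ HatCarrier 𝒜 L := AddMonoidHom.mk' (hatMk l) (hatMk_add l)

theorem selfProj_mul (i : ℤ) (b : 𝒜.carrier) (hb : b ∈ 𝒜.gr 0) (a : 𝒜.carrier) :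
    gradeProj 𝒜.addGr 𝒜.isInternal i (b * a) =
      b * gradeProj 𝒜.addGr 𝒜.isInternal i a :=
  (map_gradeProj 𝒜.isInternal 𝒜.isInternal (AddMonoidHom.mulLeft b)
    (fun j x hx => by
      have : b * x ∈ 𝒜.gr (0 + j) := SetLike.mul_mem_graded hb hx
      rwa [zero_add] at this) i a).symm

variable (L)

/-- The dg module `L̂ = L ⊗_{A^0} A`, where `L` is concentrated in degree `0`; its component of
degree `i` is generated by the `l ⊗ a` with `a ∈ A^i`, and `d(l ⊗ a) = l ⊗ d a`. -/
def hat (h : ∀ a ∈ 𝒜.gr 0, 𝒜.d a = 0) : DGMod 𝒜 where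
  carrier := HatCarrier 𝒜 L
  gr i := AddSubgroup.closure {x | ∃ (l : L) (a : 𝒜.carrier), a ∈ 𝒜.gr i ∧ x = hatMk l a}
  isInternal := by
    refine isInternal_of_proj _ (fun i => hatMap (gradeProj 𝒜.addGr 𝒜.isInternal i)
      (selfProj_mul i)) ?_ ?_ ?_
    · intro i x hx
      induction hx using AddSubgroup.closure_induction with
      | mem x hx =>
        obtain ⟨l, a, ha, rfl⟩ := hx
        rw [hatMap_mk, gradeProj_same 𝒜.isInternal ha]
      | zero => rw [map_zero]
      | add x y _ _ hx hy => rw [map_add, hx, hy]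
      | neg x _ hx => rw [map_neg, hx]
    · intro i j hij x hx
      induction hx using AddSubgroup.closure_induction with
      | mem x hx =>
        obtain ⟨l, a, ha, rfl⟩ := hx
        rw [hatMap_mk, gradeProj_ne 𝒜.isInternal hij ha]
        exact map_zero (hatMkHom l)
      | zero => rw [map_zero]
      | add x y _ _ hx hy => rw [map_add, hx, hy, add_zero]
      | neg x _ hx => rw [map_neg, hx, neg_zero]
    · rw [eq_top_iff]
      rintro x -
      induction x using hat_induction with
      | h0 => exact zero_mem _
      | hadd x y hx hy => exact add_mem hx hy
      | hmk l a =>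
        set S : AddSubgroup (HatCarrier 𝒜 L) := ⨆ i, AddSubgroup.closure
          {x | ∃ (l : L) (a : 𝒜.carrier), a ∈ 𝒜.gr i ∧ x = hatMk l a}
        have key : a ∈ S.comap (hatMkHom l) :=
          mem_of_gradeProj_mem 𝒜.isInternal _ a fun i => ?_
        · exact key
        exact AddSubgroup.mem_iSup_of_mem i (AddSubgroup.subset_closure
          ⟨l, _, gradeProj_mem 𝒜.isInternal i a, rfl⟩)
  smul_mem {i j m a} hm ha := by
    induction hm using AddSubgroup.closure_induction with
    | mem x hx =>
      obtain ⟨l, b, hb, rfl⟩ := hx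
      exact AddSubgroup.subset_closure
        ⟨l, b * a, SetLike.mul_mem_graded hb ha, hatMk_smul l b a⟩
    | zero => rw [smul_zero]; exact zero_mem _
    | add x y _ _ hx hy => rw [smul_add]; exact add_mem hx hy
    | neg x _ hx => rw [smul_neg]; exact neg_mem hx
  d := hatMap 𝒜.d.toAddMonoidHom fun b hb a => by
    have := 𝒜.leibniz a hb
    rw [h b hb, zero_mul, zero_add, Int.negOnePow_zero, one_smul] at this
    exact this
  d_mem {i m} hm := by
    induction hm using AddSubgroup.closure_induction with
    | mem x hx =>
      obtain ⟨l, a, ha, rfl⟩ := hx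
      exact AddSubgroup.subset_closure ⟨l, 𝒜.d a, 𝒜.d_mem ha, rfl⟩
    | zero => rw [map_zero]; exact zero_mem _
    | add x y _ _ hx hy => rw [map_add]; exact add_mem hx hy
    | neg x _ hx => rw [map_neg]; exact neg_mem hx
  d_d m := by
    induction m using hat_induction with
    | h0 => simp
    | hadd x y hx hy => rw [map_add, map_add, hx, hy, add_zero]
    | hmk l a =>
      change hatMk l (𝒜.d (𝒜.d a)) = 0
      rw [𝒜.d_d]
      exact map_zero (hatMkHom l)
  leibniz {i m} b hm := by
    induction hm using AddSubgroup.closure_induction with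
    | mem x hx =>
      obtain ⟨l, a, ha, rfl⟩ := hx
      change hatMkHom l (𝒜.d (a * b)) = hatMkHom l (𝒜.d a * b) +
        i.negOnePow • hatMkHom l (a * 𝒜.d b)
      rw [𝒜.leibniz b ha, map_add, Units.smul_def, map_zsmul]
      rfl
    | zero => simp
    | add x y _ _ hx hy => rw [smul_add, map_add, hx, hy, map_add, smul_add, smul_add, smul_add]; abel
    | neg x _ hx => rw [smul_neg, map_neg, hx, map_neg, smul_neg, smul_neg, smul_neg]; abel

end Hat

/-! ### The perfect derived category, its t-structure and heart -/

section Perfect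

variable (𝒜 : DGAlgebra.{u} k)

/-- `P` defines a strict full triangulated subcategory of `dgHot(𝒜)` containing `𝒜` and closed
under direct summands. As the distinguished triangles of `dgHot(𝒜)` are those isomorphic to the
mapping cone triangles of morphisms of dg modules, being a triangulated subcategory means being
closed under all shifts and under mapping cones. -/
structure IsThickContainingSelf (P : ObjectProperty (DGHot 𝒜)) : Prop where
  iso : P.IsClosedUnderIsomorphisms
  shift : ∀ (n : ℤ) (M : DGMod 𝒜), P ((toHot 𝒜).obj M) → P ((toHot 𝒜).obj (M.shift n))
  cone : ∀ {M N : DGMod 𝒜} (f : M ⟶ N), P ((toHot 𝒜).obj M) → P ((toHot 𝒜).obj N) →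
    P ((toHot 𝒜).obj (DGMod.cone f))
  summand : P.IsStableUnderRetracts
  self : P ((toHot 𝒜).obj (DGMod.self 𝒜))

/-- The category `dgPer(𝒜)` of perfect dg modules: the smallest full triangulated subcategory of
`dgHot(𝒜)` that contains `𝒜` and is closed under direct summands. -/
def dgPer : ObjectProperty (DGHot 𝒜) := fun X =>
  ∀ P : ObjectProperty (DGHot 𝒜), IsThickContainingSelf 𝒜 P → P X

/-- `dgPer^I`, the perfect dg modules `M` such that the support of `H(M̄)` is contained in `I`. -/
def dgPerOn (I : Set ℤ) : ObjectProperty (DGHot 𝒜) := fun X =>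
  dgPer 𝒜 X ∧ X.as.bar.cohomologySupport ⊆ I

/-- The aisle `dgPer^{≤ n}` (for `n = 0`: the first half of the t-structure). -/
def dgPerLE (n : ℤ) : ObjectProperty (DGHot 𝒜) := dgPerOn 𝒜 (Set.Iic n)

/-- The coaisle `dgPer^{≥ n}` (for `n = 0`: the second half of the t-structure). -/
def dgPerGE (n : ℤ) : ObjectProperty (DGHot 𝒜) := dgPerOn 𝒜 (Set.Ici n)

/-- The heart `dgPer^{≤ 0} ∩ dgPer^{≥ 0} = dgPer^{0}` of the t-structure. -/
def heart : ObjectProperty (DGHot 𝒜) := dgPerLE 𝒜 0 ⊓ dgPerGE 𝒜 0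

/-- The heart as a category. -/
abbrev Heart := (heart 𝒜).FullSubcategory

end Perfect

/-! ### Modules with an `L̂`-flag -/

section Flag

variable (𝒜 : DGAlgebra.{u} k) (hd : ∀ a ∈ 𝒜.gr 0, 𝒜.d a = 0)
  {W : Type w} (L : W → ModuleCat.{u} 𝒜.zeroPartᵐᵒᵖ)

/-- The dg modules `M` admitting a finite filtration `0 = F_0 ⊆ F_1 ⊆ ⋯ ⊆ F_n = M` by dg submodules
whose subquotients are isomorphic, in `dgMod(𝒜)`, to some of the `L̂_x`. -/
def dgFlag : ObjectProperty (DGMod 𝒜) := fun M =>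
  ∃ (n : ℕ) (F : Fin (n + 1) → M.Sub),
    (F 0).toSubmodule = ⊥ ∧ (F (Fin.last n)).toSubmodule = ⊤ ∧
    ∀ i : Fin n, (F i.castSucc).toSubmodule ≤ (F i.succ).toSubmodule ∧
      ∃ x : W, Nonempty (DGMod.Sub.subquotient (F i.castSucc) (F i.succ) ≅ hat (L x) hd)

/-- `(L_x)_{x ∈ W}` is a system of representatives of the isomorphism classes of simple right
`A^0`-modules. -/
structure IsSimpleSystem : Prop where
  simple : ∀ x, IsSimpleModule 𝒜.zeroPartᵐᵒᵖ (L x)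
  eq_of_iso : ∀ x y, Nonempty (L x ≅ L y) → x = y
  exists_iso : ∀ S : ModuleCat.{u} 𝒜.zeroPartᵐᵒᵖ, IsSimpleModule 𝒜.zeroPartᵐᵒᵖ S →
    ∃ x, Nonempty (S ≅ L x)

end Flag

/-- Objects of finite length: those obtained from zero objects by finitely many successive
extensions by simple objects, i.e. the objects having a finite composition series. -/
inductive HasFiniteLength {C : Type*} [Category* C] [Preadditive C] : C → Prop
  | of_isZero (X : C) (hX : IsZero X) : HasFiniteLength X
  | of_shortExact (S : ShortComplex C) (hS : S.ShortExact) (h₁ : HasFiniteLength S.X₁)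
      (h₃ : Simple S.X₃) : HasFiniteLength S.X₂

end DGPerf

end

noncomputable section

namespace DGPerf

variable {k : Type v} [CommRing k] {𝒜 : DGAlgebra.{u} k}

/-! ### Graded pieces as modules over `A^0` -/

/-! The proof runs on minimal models. Since `A^0` is semisimple and killed by `d`, a module `L̂`
with `L` simple is free over `A` on `L`, its generators are cocycles, and Schur's lemma makes every
morphism between two such modules generated in the same degree zero or an isomorphism. A dg module
is called sorted if it has a finite filtration by shifts of such modules whose generating degrees do
not decrease from the bottom to the top. Since `A` lives in nonnegative degrees, a sorted module is
minimal: `d` maps it into `M A⁺` (`Sorted.d_mem_plus`), so its reduction has zero differential and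
`H(M̄) = M̄` displays the generating degrees.

Every perfect module is homotopy equivalent to a sorted one, because the modules with this property
form a thick subcategory containing `𝒜` (`isThickContainingSelf_hotSorted`). For cones, an extension
of sorted modules is sorted by exchanging adjacent layers that are in the wrong order; by degree and
Schur's lemma the connecting map between them is zero, and they can be exchanged, or an isomorphism,
and they cancel (`Sorted.exists_hotEquiv_of_isHat`). For summands, an endomorphism `e` of a sorted
module `M` that is idempotent up to homotopy has `e - e²` valued in `M A⁺` by minimality. Hence `e -
e²` is locally nilpotent, and Fitting's lemma gives an honest direct summand representing the
retract (`Sorted.exists_hotEquiv_of_retract`). That summand is again sorted by an exchange argument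
(`Sorted.retract`).

Homotopy equivalences preserve `H(M̄)`, so an object of the heart has a sorted model with all
generators in degree zero, and conversely (`heart_iff`). Such models are exactly the objects of
`dgFlag` (`dgFlag_iff`). Between them a homotopy sends generators to degree `-1`, where the target
vanishes, so homotopic morphisms are equal and `dgFlag` embeds fully faithfully in `dgHot`.

Simplicity and finite length are then checked in `dgFlag`. Every nonzero object contains some `L̂`,
so Schur's lemma identifies the simple objects, and the flags provide the composition series. -/

theorem gradeProj_smul (M : DGMod 𝒜) {n : ℤ} {m : M.carrier} (hm : m ∈ M.gr n) (j : ℤ)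
    (a : 𝒜.carrier) : gradeProj M.gr M.isInternal (n + j) (m <• a) =
      m <• gradeProj 𝒜.addGr 𝒜.isInternal j a := by
  let φ : 𝒜.carrier →+ M.carrier :=
    { toFun := fun a => m <• a
      map_zero' := by simp
      map_add' := fun a b => by simp [add_smul] }
  refine addHom_ext_of_isInternal 𝒜.isInternal
    ((gradeProj M.gr M.isInternal (n + j)).comp φ)
    (φ.comp (gradeProj 𝒜.addGr 𝒜.isInternal j)) (fun i x hx => ?_) a
  have h1 : φ x ∈ M.gr (n + i) := M.smul_mem hm hx
  by_cases hij : j = i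
  · subst hij
    simp [gradeProj_same _ hx, gradeProj_same _ h1]
  · simp [gradeProj_ne 𝒜.isInternal hij hx, gradeProj_ne M.isInternal (by omega : n + j ≠ n + i) h1]

theorem smul_mem_gr (M : DGMod 𝒜) {n : ℤ} {m : M.carrier} (hm : m ∈ M.gr n) (r : 𝒜.zeroPart) :
    m <• (r : 𝒜.carrier) ∈ M.gr n := by
  have := M.smul_mem hm r.2
  rwa [add_zero] at this

instance (M : DGMod 𝒜) (n : ℤ) : Module 𝒜.zeroPartᵐᵒᵖ (M.gr n) where
  smul r m := ⟨(m : M.carrier) <• (r.unop : 𝒜.carrier), smul_mem_gr M m.2 r.unop⟩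
  one_smul m := Subtype.ext (one_smul _ (m : M.carrier))
  mul_smul r s m := Subtype.ext (mul_smul (MulOpposite.op (r.unop : 𝒜.carrier))
    (MulOpposite.op (s.unop : 𝒜.carrier)) (m : M.carrier))
  smul_zero _ := Subtype.ext (smul_zero _)
  smul_add _ _ _ := Subtype.ext (smul_add _ _ _)
  add_smul r s m := Subtype.ext (add_smul (MulOpposite.op (r.unop : 𝒜.carrier))
    (MulOpposite.op (s.unop : 𝒜.carrier)) (m : M.carrier))
  zero_smul m := Subtype.ext (zero_smul _ (m : M.carrier))

@[simp] theorem coe_gr_smul (M : DGMod 𝒜) (n : ℤ) (r : 𝒜.zeroPartᵐᵒᵖ) (m : M.gr n) :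
    ((r • m : M.gr n) : M.carrier) = (m : M.carrier) <• (r.unop : 𝒜.carrier) := rfl

/-- The `A^0`-linear map between graded pieces induced by an `A`-linear map. -/
def grMap {M N : DGMod 𝒜} {n n' : ℤ} (f : M.carrier →ₗ[𝒜.carrierᵐᵒᵖ] N.carrier)
    (hf : ∀ m ∈ M.gr n, f m ∈ N.gr n') : M.gr n →ₗ[𝒜.zeroPartᵐᵒᵖ] N.gr n' where
  toFun m := ⟨f m, hf m m.2⟩
  map_add' _ _ := Subtype.ext (map_add f _ _)
  map_smul' _ _ := Subtype.ext (map_smul f _ _)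

@[simp] theorem coe_grMap {M N : DGMod 𝒜} {n n' : ℤ} (f : M.carrier →ₗ[𝒜.carrierᵐᵒᵖ] N.carrier)
    (hf : ∀ m ∈ M.gr n, f m ∈ N.gr n') (m : M.gr n) : (grMap f hf m : N.carrier) = f m := rfl

namespace DGMod

/-- The map induced by a morphism on graded pieces. -/
abbrev Hom.deg {M N : DGMod 𝒜} (f : M ⟶ N) (n : ℤ) : M.gr n →ₗ[𝒜.zeroPartᵐᵒᵖ] N.gr n :=
  grMap (Hom.toLin f) fun _ h => Hom.map_mem f h

theorem Hom.map_gradeProj {M N : DGMod 𝒜} (f : M ⟶ N) (i : ℤ) (m : M.carrier) :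
    Hom.toLin f (gradeProj M.gr M.isInternal i m) =
      gradeProj N.gr N.isInternal i (Hom.toLin f m) :=
  DGPerf.map_gradeProj M.isInternal N.isInternal (Hom.toLin f).toAddMonoidHom
    (fun _ _ h => Hom.map_mem f h) i m

theorem toLin_comp_apply {M N P : DGMod 𝒜} (f : M ⟶ N) (g : N ⟶ P) (m : M.carrier) :
    Hom.toLin (f ≫ g) m = Hom.toLin g (Hom.toLin f m) := rfl

theorem hom_ext' {M N : DGMod 𝒜} {f g : M ⟶ N} (h : ∀ m, Hom.toLin f m = Hom.toLin g m) :
    f = g := hom_ext (LinearMap.ext h)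

@[simp] theorem toLin_neg {M N : DGMod 𝒜} (f : M ⟶ N) : Hom.toLin (-f) = -Hom.toLin f := rfl

@[simp] theorem toLin_sub {M N : DGMod 𝒜} (f g : M ⟶ N) :
    Hom.toLin (f - g) = Hom.toLin f - Hom.toLin g := rfl

/-- A bijective morphism of dg modules is an isomorphism. -/
def isoOfBijective {M N : DGMod 𝒜} (f : M ⟶ N) (hf : Function.Bijective (Hom.toLin f)) :
    M ≅ N where
  hom := f
  inv :=
    { toLin := (LinearEquiv.ofBijective (Hom.toLin f) hf).symm.toLinearMap
      map_mem := by
        intro i y hy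
        set x := (LinearEquiv.ofBijective (Hom.toLin f) hf).symm.toLinearMap y with hx
        have hxy : Hom.toLin f x = y :=
          (LinearEquiv.ofBijective (Hom.toLin f) hf).apply_symm_apply y
        have : gradeProj M.gr M.isInternal i x = x := by
          apply hf.1
          rw [Hom.map_gradeProj, hxy, gradeProj_same _ hy]
        rw [← this]
        exact gradeProj_mem _ _ _
      comm := by
        intro y
        apply hf.1
        have h := (LinearEquiv.ofBijective (Hom.toLin f) hf).apply_symm_apply
        rw [Hom.comm]
        exact (h _).trans (congrArg N.d (h y).symm) }
  hom_inv_id := hom_ext' (LinearEquiv.ofBijective (Hom.toLin f) hf).symm_apply_apply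
  inv_hom_id := hom_ext' (LinearEquiv.ofBijective (Hom.toLin f) hf).apply_symm_apply

theorem bijective_of_iso {M N : DGMod 𝒜} (e : M ≅ N) : Function.Bijective (Hom.toLin e.hom) := by
  refine Function.bijective_iff_has_inverse.2 ⟨Hom.toLin e.inv, fun m => ?_, fun m => ?_⟩
  · rw [← toLin_comp_apply, e.hom_inv_id]; rfl
  · rw [← toLin_comp_apply, e.inv_hom_id]; rfl

/-! ### Free dg modules on a graded piece -/

/-- `K` is freely generated over `A` by the `A^0`-module `K^n`, on which the differential
vanishes. -/
structure FreeOn (n : ℤ) (K : DGMod 𝒜) : Prop where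
  gen : Submodule.span 𝒜.carrierᵐᵒᵖ (K.gr n : Set K.carrier) = ⊤
  d_zero : ∀ m ∈ K.gr n, K.d m = 0
  lift : ∀ (X : Type u) [AddCommGroup X] [Module 𝒜.carrierᵐᵒᵖ X] (φ : K.gr n →+ X),
    (∀ (r : 𝒜.zeroPart) (m : K.gr n), φ (MulOpposite.op r • m) = φ m <• (r : 𝒜.carrier)) →
    ∃ f : K.carrier →ₗ[𝒜.carrierᵐᵒᵖ] X, ∀ m : K.gr n, f m = φ m

/-- The elements of a dg module generated in degree `n` are sums of `m a`, with `m` of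
degree `n`. -/
theorem gr_le_of_gen {M : DGMod 𝒜} {n : ℤ}
    (h : Submodule.span 𝒜.carrierᵐᵒᵖ (M.gr n : Set M.carrier) = ⊤) (i : ℤ) :
    M.gr i ≤ AddSubgroup.closure
      {x | ∃ m ∈ M.gr n, ∃ a ∈ 𝒜.gr (i - n), x = m <• a} := by
  intro x hx
  set S := AddSubgroup.closure {x | ∃ m ∈ M.gr n, ∃ a ∈ 𝒜.gr (i - n), x = m <• a}
  have key : ∀ y ∈ Submodule.span 𝒜.carrierᵐᵒᵖ (M.gr n : Set M.carrier),
      gradeProj M.gr M.isInternal i y ∈ S := by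
    intro y hy
    induction hy using Submodule.closure_induction with
    | zero => rw [map_zero]; exact zero_mem _
    | add x y _ _ hx hy => rw [map_add]; exact add_mem hx hy
    | smul_mem r x hx =>
      have := gradeProj_smul M hx (i - n) r.unop
      rw [add_sub_cancel] at this
      have h2 : gradeProj M.gr M.isInternal i (r • x) =
        x <• gradeProj 𝒜.addGr 𝒜.isInternal (i - n) r.unop := this
      rw [h2]
      exact AddSubgroup.subset_closure ⟨x, hx, _, gradeProj_mem 𝒜.isInternal _ _, rfl⟩
  rw [← gradeProj_same M.isInternal hx]
  exact key x (h ▸ trivial)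

theorem gr_eq_bot_of_gen (hpos : ∀ i : ℤ, i < 0 → 𝒜.gr i = ⊥) {M : DGMod 𝒜} {n : ℤ}
    (h : Submodule.span 𝒜.carrierᵐᵒᵖ (M.gr n : Set M.carrier) = ⊤) {i : ℤ} (hi : i < n) :
    M.gr i = ⊥ := by
  rw [eq_bot_iff]
  refine (gr_le_of_gen h i).trans ((AddSubgroup.closure_le _).2 ?_)
  rintro _ ⟨m, _, a, ha, rfl⟩
  rw [hpos _ (by omega), Submodule.mem_bot] at ha
  simp [ha]

theorem map_mem_of_gen {M N : DGMod 𝒜} {n j : ℤ}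
    (h : Submodule.span 𝒜.carrierᵐᵒᵖ (M.gr n : Set M.carrier) = ⊤)
    (f : M.carrier →ₗ[𝒜.carrierᵐᵒᵖ] N.carrier) (hf : ∀ m ∈ M.gr n, f m ∈ N.gr (n + j))
    {i : ℤ} {m : M.carrier} (hm : m ∈ M.gr i) : f m ∈ N.gr (i + j) := by
  have : M.gr i ≤ (N.gr (i + j)).comap f.toAddMonoidHom := by
    refine (gr_le_of_gen h i).trans ((AddSubgroup.closure_le _).2 ?_)
    rintro _ ⟨m, hm, a, ha, rfl⟩
    have h1 := N.smul_mem (hf m hm) ha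
    rw [show n + j + (i - n) = i + j by ring] at h1
    change f (m <• a) ∈ N.gr (i + j)
    rwa [map_smul]
  exact this hm

theorem linearMap_ext_of_gen {M : DGMod 𝒜} {X : Type*} [AddCommGroup X]
    [Module 𝒜.carrierᵐᵒᵖ X] {n : ℤ}
    (h : Submodule.span 𝒜.carrierᵐᵒᵖ (M.gr n : Set M.carrier) = ⊤)
    {f g : M.carrier →ₗ[𝒜.carrierᵐᵒᵖ] X} (hfg : ∀ m ∈ M.gr n, f m = g m) : f = g :=
  LinearMap.ext_on h hfg

/-- Graded linear maps commuting with the differentials on generators annihilated by `d`. -/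
def homOfGen {M N : DGMod 𝒜} {n : ℤ}
    (h : Submodule.span 𝒜.carrierᵐᵒᵖ (M.gr n : Set M.carrier) = ⊤)
    (hd : ∀ m ∈ M.gr n, M.d m = 0)
    (f : M.carrier →ₗ[𝒜.carrierᵐᵒᵖ] N.carrier) (hf : ∀ m ∈ M.gr n, f m ∈ N.gr n)
    (hf' : ∀ m ∈ M.gr n, N.d (f m) = 0) : M ⟶ N where
  toLin := f
  map_mem {i m} hm := by
    have := map_mem_of_gen (j := 0) h f (by simpa using hf) hm
    rwa [add_zero] at this
  comm m := by
    have hm : m ∈ Submodule.span 𝒜.carrierᵐᵒᵖ (M.gr n : Set M.carrier) := h ▸ trivial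
    induction hm using Submodule.closure_induction with
    | zero => simp
    | add x y _ _ hx hy => simp [hx, hy]
    | smul_mem r x hx =>
      have h1 := M.leibniz r.unop hx
      have h2 := N.leibniz r.unop (hf x hx)
      rw [MulOpposite.op_unop] at h1 h2
      rw [map_smul f, h1, h2, hd x hx, hf' x hx, map_add, Units.smul_def, map_zsmul, map_smul,
        map_smul]
      simp [Units.smul_def]

theorem FreeOn.exists_linear {n n' : ℤ} {K N : DGMod 𝒜} (hK : FreeOn n K)
    (φ : K.gr n →ₗ[𝒜.zeroPartᵐᵒᵖ] N.gr n') :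
    ∃ f : K.carrier →ₗ[𝒜.carrierᵐᵒᵖ] N.carrier, ∀ m : K.gr n, f m = φ m :=
  hK.lift N.carrier ((N.gr n').subtype.comp φ.toAddMonoidHom) fun r m =>
    congrArg Subtype.val (φ.map_smul (MulOpposite.op r) m)

theorem FreeOn.exists_hom {n : ℤ} {K N : DGMod 𝒜} (hK : FreeOn n K)
    (φ : K.gr n →ₗ[𝒜.zeroPartᵐᵒᵖ] N.gr n) (hφ : ∀ m, N.d (φ m) = 0) :
    ∃ f : K ⟶ N, ∀ m : K.gr n, Hom.toLin f m = φ m := by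
  obtain ⟨f, hf⟩ := hK.exists_linear φ
  refine ⟨homOfGen hK.gen hK.d_zero f (fun m hm => ?_) (fun m hm => ?_), hf⟩
  · rw [hf ⟨m, hm⟩]; exact (φ _).2
  · rw [hf ⟨m, hm⟩]; exact hφ _

theorem FreeOn.hom_ext {n : ℤ} {K N : DGMod 𝒜} (hK : FreeOn n K) {f g : K ⟶ N}
    (h : ∀ m ∈ K.gr n, Hom.toLin f m = Hom.toLin g m) : f = g :=
  DGMod.hom_ext (linearMap_ext_of_gen hK.gen h)

/-- A morphism between free dg modules that is bijective on generators is an isomorphism. -/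
theorem FreeOn.isIso {n : ℤ} {K N : DGMod 𝒜} (hK : FreeOn n K) (hN : FreeOn n N) (f : K ⟶ N)
    (hf : Function.Bijective (Hom.deg f n)) : IsIso f := by
  let e := LinearEquiv.ofBijective (Hom.deg f n) hf
  obtain ⟨g, hg⟩ := hN.exists_hom e.symm.toLinearMap fun m => hK.d_zero _ (e.symm m).2
  refine ⟨g, hK.hom_ext fun m hm => ?_, hN.hom_ext fun m hm => ?_⟩
  · exact (hg (Hom.deg f n ⟨m, hm⟩)).trans (congrArg Subtype.val (e.symm_apply_apply ⟨m, hm⟩))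
  · exact (congrArg (Hom.toLin f) (hg ⟨m, hm⟩)).trans
      (congrArg Subtype.val (e.apply_symm_apply ⟨m, hm⟩))

/-- `K` is freely generated by the simple `A^0`-module `K^n`: up to isomorphism,
`K` is a shift of some `L̂` with `L` simple. -/
structure IsHat (n : ℤ) (K : DGMod 𝒜) : Prop extends FreeOn n K where
  simple : IsSimpleModule 𝒜.zeroPartᵐᵒᵖ (K.gr n)

/-- Schur's lemma on the generating piece. Injectivity is asserted in degree `n` only: it need not
propagate to higher degrees, since the target is arbitrary. -/
theorem IsHat.injective_or_eq_zero {n : ℤ} {K M : DGMod 𝒜} (hK : IsHat n K) (f : K ⟶ M) :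
    Function.Injective (Hom.deg f n) ∨ f = 0 := by
  have := hK.simple
  refine (LinearMap.injective_or_eq_zero (Hom.deg f n)).imp id fun h => hK.hom_ext fun m hm => ?_
  exact congrArg Subtype.val (LinearMap.congr_fun h ⟨m, hm⟩)

/-- Here both sides are free, so bijectivity on the generators, which Schur's lemma provides, is
enough. -/
theorem IsHat.isIso_or_eq_zero {n : ℤ} {K M : DGMod 𝒜} (hK : IsHat n K) (hM : IsHat n M)
    (f : K ⟶ M) : IsIso f ∨ f = 0 := by
  have := hK.simple
  have := hM.simple
  refine (LinearMap.bijective_or_eq_zero (Hom.deg f n)).imp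
    (fun h => hK.toFreeOn.isIso hM.toFreeOn f h) fun h => hK.hom_ext fun m hm => ?_
  exact congrArg Subtype.val (LinearMap.congr_fun h ⟨m, hm⟩)

theorem IsHat.exists_ne_zero {n : ℤ} {K : DGMod 𝒜} (hK : IsHat n K) : ∃ m ∈ K.gr n, m ≠ 0 := by
  have := hK.simple
  have := IsSimpleModule.nontrivial 𝒜.zeroPartᵐᵒᵖ (K.gr n)
  obtain ⟨m, hm⟩ := exists_ne (0 : K.gr n)
  exact ⟨m, m.2, fun h => hm (Subtype.ext h)⟩

theorem FreeOn.shift {n : ℤ} {K : DGMod 𝒜} (j s : ℤ) (hj : j + s = n) (hK : FreeOn n K) :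
    FreeOn j (K.shift s) := by
  subst hj
  refine ⟨hK.gen, fun m hm => ?_, hK.lift⟩
  change s.negOnePow • K.d m = 0
  rw [hK.d_zero m hm, smul_zero]

theorem IsHat.shift {n : ℤ} {K : DGMod 𝒜} (j s : ℤ) (hj : j + s = n) (hK : IsHat n K) :
    IsHat j (K.shift s) := by
  refine ⟨hK.toFreeOn.shift j s hj, ?_⟩
  subst hj
  exact hK.simple

theorem IsHat.of_iso {n : ℤ} {K K' : DGMod 𝒜} (e : K ≅ K') (hK : IsHat n K) : IsHat n K' := by
  have h1 : ∀ m, Hom.toLin e.inv (Hom.toLin e.hom m) = m := fun m => by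
    rw [← toLin_comp_apply, e.hom_inv_id]; rfl
  have h2 : ∀ m, Hom.toLin e.hom (Hom.toLin e.inv m) = m := fun m => by
    rw [← toLin_comp_apply, e.inv_hom_id]; rfl
  let E : K.gr n ≃ₗ[𝒜.zeroPartᵐᵒᵖ] K'.gr n :=
    LinearEquiv.ofLinearMap (Hom.deg e.hom n) (Hom.deg e.inv n)
      (LinearMap.ext fun m => Subtype.ext (h2 m)) (LinearMap.ext fun m => Subtype.ext (h1 m))
  refine ⟨⟨?_, fun m hm => ?_, fun X _ _ φ hφ => ?_⟩, ?_⟩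
  · rw [eq_top_iff]
    intro x _
    rw [← h2 x]
    have : Hom.toLin e.inv x ∈ Submodule.span 𝒜.carrierᵐᵒᵖ (K.gr n : Set K.carrier) :=
      hK.gen ▸ trivial
    have h3 := Submodule.mem_map_of_mem (f := Hom.toLin e.hom) this
    rw [Submodule.map_span] at h3
    refine Submodule.span_mono ?_ h3
    rintro _ ⟨y, hy, rfl⟩
    exact Hom.map_mem e.hom hy
  · rw [← h2 m, ← Hom.comm, hK.d_zero _ (Hom.map_mem e.inv hm), map_zero]
  · obtain ⟨f, hf⟩ := hK.lift X (φ.comp E.toLinearMap.toAddMonoidHom) fun r m => by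
      change φ (E (MulOpposite.op r • m)) = _
      rw [map_smul, hφ]
      rfl
    refine ⟨f.comp (Hom.toLin e.inv), fun m => (hf (E.symm m)).trans ?_⟩
    exact congrArg φ (E.apply_symm_apply m)
  · have := hK.simple
    exact IsSimpleModule.congr E.symm

/-! ### Cokernels and split extensions -/

/-- The projection onto the quotient by a dg submodule. -/
def Sub.proj {M : DGMod 𝒜} (V : Sub M) : M ⟶ V.quotient where
  toLin := V.toSubmodule.mkQ
  map_mem h := ⟨_, h, rfl⟩
  comm _ := rfl

theorem Sub.proj_surjective {M : DGMod 𝒜} (V : Sub M) :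
    Function.Surjective (Hom.toLin V.proj) := V.toSubmodule.mkQ_surjective

theorem Sub.proj_eq_zero {M : DGMod 𝒜} (V : Sub M) {x : M.carrier} :
    Hom.toLin V.proj x = 0 ↔ x ∈ V.toSubmodule := Submodule.Quotient.mk_eq_zero _

/-- A morphism vanishing on a dg submodule factors through the quotient. -/
def Sub.desc {M N : DGMod 𝒜} (V : Sub M) (f : M ⟶ N)
    (hf : ∀ x ∈ V.toSubmodule, Hom.toLin f x = 0) : V.quotient ⟶ N where
  toLin := V.toSubmodule.liftQ (Hom.toLin f) hf
  map_mem := by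
    rintro i _ ⟨m, hm, rfl⟩
    exact Hom.map_mem f hm
  comm x := by
    obtain ⟨m, rfl⟩ := V.proj_surjective x
    exact Hom.comm f m

/-- The image of a morphism. -/
def Sub.range {M N : DGMod 𝒜} (f : M ⟶ N) : Sub N where
  toSubmodule := LinearMap.range (Hom.toLin f)
  homogeneous := by
    rintro _ ⟨m, rfl⟩ i
    exact ⟨_, Hom.map_gradeProj f i m⟩
  d_mem := by
    rintro _ ⟨m, rfl⟩
    exact ⟨_, Hom.comm f m⟩

/-- A short exact sequence `K ⟶ E ⟶ Q` of dg modules with a splitting as graded modules. -/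
structure SplitExt (K E Q : DGMod 𝒜) where
  /-- the inclusion -/
  i : K ⟶ E
  /-- the projection -/
  q : E ⟶ Q
  /-- the graded retraction -/
  ρ : E.carrier →ₗ[𝒜.carrierᵐᵒᵖ] K.carrier
  /-- the graded section -/
  σ : Q.carrier →ₗ[𝒜.carrierᵐᵒᵖ] E.carrier
  ρ_mem : ∀ {n : ℤ} {x : E.carrier}, x ∈ E.gr n → ρ x ∈ K.gr n
  σ_mem : ∀ {n : ℤ} {x : Q.carrier}, x ∈ Q.gr n → σ x ∈ E.gr n
  ρ_i : ∀ x, ρ (Hom.toLin i x) = x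
  q_σ : ∀ x, Hom.toLin q (σ x) = x
  sum : ∀ x, Hom.toLin i (ρ x) + σ (Hom.toLin q x) = x

namespace SplitExt

variable {K E Q : DGMod 𝒜} (s : SplitExt K E Q)

theorem i_inj : Function.Injective (Hom.toLin s.i) := fun x y h => by
  rw [← s.ρ_i x, h, s.ρ_i]

theorem q_surj : Function.Surjective (Hom.toLin s.q) := fun x => ⟨_, s.q_σ x⟩

theorem q_i (x : K.carrier) : Hom.toLin s.q (Hom.toLin s.i x) = 0 := by
  have := congrArg (Hom.toLin s.q) (s.sum (Hom.toLin s.i x))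
  rwa [map_add, s.q_σ, s.ρ_i, add_eq_right] at this

theorem i_comp_q : s.i ≫ s.q = 0 := hom_ext' s.q_i

theorem ρ_σ (x : Q.carrier) : s.ρ (s.σ x) = 0 := by
  have := congrArg s.ρ (s.sum (s.σ x))
  rwa [map_add, s.ρ_i, s.q_σ, add_eq_right] at this

theorem i_ρ_of_q_eq_zero {x : E.carrier} (hx : Hom.toLin s.q x = 0) :
    Hom.toLin s.i (s.ρ x) = x := by
  have := s.sum x
  rwa [hx, map_zero, add_zero] at this

/-- A morphism vanishing on the sub factors through the quotient. -/
def desc {N : DGMod 𝒜} (f : E ⟶ N) (hf : s.i ≫ f = 0) : Q ⟶ N where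
  toLin := (Hom.toLin f).comp s.σ
  map_mem h := Hom.map_mem f (s.σ_mem h)
  comm x := by
    have key : ∀ e, Hom.toLin f (s.σ (Hom.toLin s.q e)) = Hom.toLin f e := fun e => by
      conv_rhs => rw [← s.sum e, map_add, ← toLin_comp_apply, hf]
      simp
    obtain ⟨e, rfl⟩ := s.q_surj x
    change Hom.toLin f (s.σ (Q.d (Hom.toLin s.q e))) =
      N.d (Hom.toLin f (s.σ (Hom.toLin s.q e)))
    rw [← Hom.comm s.q, key, key, Hom.comm]

@[simp] theorem q_desc {N : DGMod 𝒜} (f : E ⟶ N) (hf : s.i ≫ f = 0) : s.q ≫ s.desc f hf = f :=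
  hom_ext' fun e => by
    conv_rhs => rw [← s.sum e, map_add, ← toLin_comp_apply, hf]
    simp [desc]

/-- A morphism with vanishing projection to the quotient factors through the sub. -/
def lift {N : DGMod 𝒜} (f : N ⟶ E) (hf : f ≫ s.q = 0) : N ⟶ K where
  toLin := s.ρ.comp (Hom.toLin f)
  map_mem h := s.ρ_mem (Hom.map_mem f h)
  comm x := by
    have key : ∀ e, Hom.toLin s.i (s.ρ (Hom.toLin f e)) = Hom.toLin f e := fun e =>
      s.i_ρ_of_q_eq_zero (by rw [← toLin_comp_apply, hf]; rfl)
    apply s.i_inj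
    change Hom.toLin s.i (s.ρ (Hom.toLin f (N.d x))) =
      Hom.toLin s.i (K.d (s.ρ (Hom.toLin f x)))
    rw [Hom.comm s.i, key, key, Hom.comm]

@[simp] theorem lift_i {N : DGMod 𝒜} (f : N ⟶ E) (hf : f ≫ s.q = 0) : s.lift f hf ≫ s.i = f :=
  hom_ext' fun e => s.i_ρ_of_q_eq_zero (by rw [← toLin_comp_apply, hf]; rfl)

/-- A short exact sequence with a graded retraction is a split extension. -/
def ofExact {K E Q : DGMod 𝒜} (i : K ⟶ E) (q : E ⟶ Q)
    (ρ : E.carrier →ₗ[𝒜.carrierᵐᵒᵖ] K.carrier)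
    (ρ_mem : ∀ {n : ℤ} {x : E.carrier}, x ∈ E.gr n → ρ x ∈ K.gr n)
    (ρ_i : ∀ x, ρ (Hom.toLin i x) = x) (q_i : ∀ x, Hom.toLin q (Hom.toLin i x) = 0)
    (hq : Function.Surjective (Hom.toLin q))
    (hex : ∀ x, Hom.toLin q x = 0 → ∃ y, Hom.toLin i y = x) : SplitExt K E Q :=
  have hs : ∀ x, Hom.toLin q (Function.surjInv hq x) = x := Function.surjInv_eq hq
  -- The section sends a class to `x - i (ρ x)` for any lift `x`. Independence of the lift makes it
  -- linear and graded, although the chosen lifts are merely set-theoretic.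
  have wd : ∀ x y, Hom.toLin q x = Hom.toLin q y →
      x - Hom.toLin i (ρ x) = y - Hom.toLin i (ρ y) := fun x y h => by
    obtain ⟨z, hz⟩ := hex (x - y) (by rw [map_sub, h, sub_self])
    rw [sub_eq_sub_iff_sub_eq_sub, ← map_sub, ← map_sub, ← hz, ρ_i]
  { i := i
    q := q
    ρ := ρ
    σ :=
      { toFun := fun x => Function.surjInv hq x - Hom.toLin i (ρ (Function.surjInv hq x))
        map_add' := fun x y => by
          rw [wd (Function.surjInv hq (x + y)) (Function.surjInv hq x + Function.surjInv hq y)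
            (by simp only [map_add, hs])]
          simp only [map_add]
          abel
        map_smul' := fun r x => by
          rw [wd (Function.surjInv hq (r • x)) (r • Function.surjInv hq x)
            (by simp only [map_smul, hs])]
          simp only [map_smul, smul_sub, RingHom.id_apply] }
    ρ_mem := ρ_mem
    σ_mem := by
      intro n x hx
      have h : gradeProj E.gr E.isInternal n (Function.surjInv hq x) ∈ E.gr n :=
        gradeProj_mem _ _ _
      change Function.surjInv hq x - Hom.toLin i (ρ (Function.surjInv hq x)) ∈ E.gr n
      rw [wd _ (gradeProj E.gr E.isInternal n (Function.surjInv hq x))]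
      · exact sub_mem h (Hom.map_mem i (ρ_mem h))
      · rw [Hom.map_gradeProj, hs, gradeProj_same _ hx]
    ρ_i := ρ_i
    q_σ := fun x => by
      change Hom.toLin q (_ - _) = x
      rw [map_sub, q_i, sub_zero, hs]
    sum := fun x => by
      change Hom.toLin i (ρ x) + (Function.surjInv hq _ - Hom.toLin i (ρ (Function.surjInv hq _))) = x
      rw [wd _ x (Function.surjInv_eq hq _), add_sub_cancel] }

/-- A morphism with a graded retraction, as the inclusion of a split extension. -/
def ofRetraction {K E : DGMod 𝒜} (i : K ⟶ E) (ρ : E.carrier →ₗ[𝒜.carrierᵐᵒᵖ] K.carrier)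
    (ρ_mem : ∀ {n : ℤ} {x : E.carrier}, x ∈ E.gr n → ρ x ∈ K.gr n)
    (ρ_i : ∀ x, ρ (Hom.toLin i x) = x) : SplitExt K E (Sub.range i).quotient :=
  ofExact i (Sub.range i).proj ρ ρ_mem ρ_i (fun x => (Sub.proj_eq_zero _).2 ⟨x, rfl⟩)
    (Sub.range i).proj_surjective fun _ hx => (Sub.proj_eq_zero _).1 hx

end SplitExt

/-! ### Sorted modules -/

/-- `M` has a filtration of length `l` whose subquotients are free on simple `A^0`-modules in
degrees which belong to `I`, are at least `n`, and increase along the filtration. -/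
inductive Sorted (I : Set ℤ) : ℤ → ℕ → DGMod 𝒜 → Prop
  | zero {n : ℤ} {M : DGMod 𝒜} (h : Subsingleton M.carrier) : Sorted I n 0 M
  | ext {n n' : ℤ} {l : ℕ} {K E Q : DGMod 𝒜} (hn : n ≤ n') (hI : n' ∈ I) (hK : IsHat n' K)
      (s : SplitExt K E Q) (hQ : Sorted I n' l Q) : Sorted I n (l + 1) E

theorem Sorted.mono {I : Set ℤ} {n n' : ℤ} {l : ℕ} {M : DGMod 𝒜} (h : Sorted I n l M)
    (hn : n' ≤ n) : Sorted I n' l M := by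
  cases h with
  | zero h => exact .zero h
  | ext h1 hI hK s hQ => exact .ext (hn.trans h1) hI hK s hQ

theorem Sorted.gr_eq_bot (hpos : ∀ i : ℤ, i < 0 → 𝒜.gr i = ⊥) {I : Set ℤ} {n : ℤ} {l : ℕ}
    {M : DGMod 𝒜} (h : Sorted I n l M) {i : ℤ} (hi : i < n) : M.gr i = ⊥ := by
  rw [eq_bot_iff]
  intro x hx
  induction h with
  | zero h => exact Subsingleton.elim _ _
  | ext hn hI hK s hQ ih =>
    have h1 := ih (hi.trans_le hn) (Hom.map_mem s.q hx)
    have h2 := s.ρ_mem hx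
    rw [gr_eq_bot_of_gen hpos hK.gen (hi.trans_le hn)] at h2
    rw [AddSubgroup.mem_bot] at h1 h2
    have := s.sum x
    rw [h1, h2, map_zero, map_zero, add_zero] at this
    exact this.symm

/-- Quotients of sorted modules by submodules freely generated by a simple `A^0`-submodule of
the lowest graded piece are sorted. -/
theorem Sorted.exists_splitExt (hpos : ∀ i : ℤ, i < 0 → 𝒜.gr i = ⊥) {I : Set ℤ} {n : ℤ} {l : ℕ}
    {M K : DGMod 𝒜} (hM : Sorted I n l M) (hK : IsHat n K) (κ : K ⟶ M)
    (hκ : Function.Injective (Hom.deg κ n)) :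
    ∃ (l' : ℕ) (Q : DGMod 𝒜) (s : SplitExt K M Q), l = l' + 1 ∧ s.i = κ ∧ Sorted I n l' Q := by
  obtain ⟨x, hx, hx0⟩ := hK.exists_ne_zero
  have hκx : ∀ {N : DGMod 𝒜} (f : K ⟶ N), Function.Injective (Hom.deg f n) →
      Hom.toLin f x ≠ 0 := fun f hf h =>
    hx0 (congrArg Subtype.val (@hf ⟨x, hx⟩ 0 (Subtype.ext (h.trans (map_zero (Hom.toLin f)).symm))))
  induction hM with
  | zero h => exact (hκx κ hκ (Subsingleton.elim _ _)).elim
  | @ext m n' l K₁ M Q₁ hn hI hK₁ s₁ hQ₁ ih =>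
    -- The image of a generator of `K` is a nonzero element of degree `m`, while the module vanishes
    -- below `n'`.
    have hn' : m = n' := by
      refine le_antisymm hn (not_lt.1 fun h => hκx κ hκ ?_)
      have h1 := (Sorted.ext le_rfl hI hK₁ s₁ hQ₁).gr_eq_bot hpos h
      have h2 := Hom.map_mem κ hx
      rwa [h1, AddSubgroup.mem_bot] at h2
    subst hn'
    -- Either `K` still embeds on generators in the quotient `Q₁`, where induction applies, or `κ`
    -- factors through the bottom layer `K₁` and identifies `K` with it.
    rcases hK.injective_or_eq_zero (κ ≫ s₁.q) with h | h
    · obtain ⟨l', Q₂, s₂, rfl, hs₂, hQ₂⟩ := ih hK (κ ≫ s₁.q) h hx hκx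
      have hs₂' : ∀ x, Hom.toLin s₂.i x = Hom.toLin s₁.q (Hom.toLin κ x) := fun x => by
        rw [hs₂]; rfl
      have e1 : ∀ x, s₂.ρ (Hom.toLin s₁.q (Hom.toLin κ x)) = x := fun x => by
        rw [← hs₂', s₂.ρ_i]
      let s₃ := SplitExt.ofRetraction κ (s₂.ρ.comp (Hom.toLin s₁.q))
        (fun h => s₂.ρ_mem (Hom.map_mem s₁.q h)) e1
      have hs₃ : s₃.i = κ := rfl
      refine ⟨l' + 1, _, s₃, rfl, rfl, ?_⟩
      -- The retraction `s₁.ρ` onto `K₁` is corrected so as to vanish on `κ(K)`. On `K₁` the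
      -- correction is zero because `s₁.q` kills `K₁`, so `ρ₀` descends to a graded retraction of
      -- `K₁` in `M / κ(K)`, whose quotient by `K₁` is `Q₂`.
      let ρ₀ : M.carrier →ₗ[𝒜.carrierᵐᵒᵖ] K₁.carrier :=
        s₁.ρ - s₁.ρ.comp ((Hom.toLin κ).comp (s₂.ρ.comp (Hom.toLin s₁.q)))
      have hρ₀ : ∀ x, ρ₀ x = s₁.ρ x - s₁.ρ (Hom.toLin κ (s₂.ρ (Hom.toLin s₁.q x))) :=
        fun _ => rfl
      have hρκ : ∀ x, ρ₀ (Hom.toLin κ x) = 0 := fun x => by rw [hρ₀, e1, sub_self]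
      have hσ : ∀ x, ρ₀ (s₃.σ (Hom.toLin s₃.q x)) = ρ₀ x := fun x => by
        conv_rhs => rw [← s₃.sum x, map_add, hs₃, hρκ, zero_add]
      have hqq : s₃.i ≫ s₁.q ≫ s₂.q = 0 := by
        rw [hs₃, ← Category.assoc, ← hs₂, s₂.i_comp_q]
      have hdesc : ∀ x, Hom.toLin (s₃.desc (s₁.q ≫ s₂.q) hqq) (Hom.toLin s₃.q x) =
          Hom.toLin s₂.q (Hom.toLin s₁.q x) := fun x => by
        rw [← toLin_comp_apply, s₃.q_desc]; rfl
      refine .ext le_rfl hI hK₁ (SplitExt.ofExact (s₁.i ≫ s₃.q)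
        (s₃.desc (s₁.q ≫ s₂.q) hqq) (ρ₀.comp s₃.σ) (fun h => ?_) (fun x => ?_) (fun x => ?_) ?_ ?_)
        hQ₂
      · exact sub_mem (s₁.ρ_mem (s₃.σ_mem h))
          (s₁.ρ_mem (Hom.map_mem κ (s₂.ρ_mem (Hom.map_mem s₁.q (s₃.σ_mem h)))))
      · rw [toLin_comp_apply, LinearMap.comp_apply, hσ, hρ₀, s₁.ρ_i, s₁.q_i]
        simp
      · rw [toLin_comp_apply, hdesc, s₁.q_i, map_zero]
      · intro y
        obtain ⟨z, rfl⟩ := s₂.q_surj y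
        obtain ⟨z, rfl⟩ := s₁.q_surj z
        exact ⟨_, hdesc z⟩
      · intro y hy
        obtain ⟨y, rfl⟩ := s₃.q_surj y
        rw [hdesc] at hy
        have h1 := s₂.i_ρ_of_q_eq_zero hy
        rw [hs₂', ← sub_eq_zero, ← map_sub] at h1
        have h2 := s₁.i_ρ_of_q_eq_zero h1
        refine ⟨-s₁.ρ (Hom.toLin κ (s₂.ρ (Hom.toLin s₁.q y)) - y), ?_⟩
        rw [toLin_comp_apply, map_neg, h2, neg_sub, map_sub]
        exact sub_eq_self.2 (s₃.q_i _)
    · have h3 := s₁.lift_i κ h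
      rcases hK.isIso_or_eq_zero hK₁ (s₁.lift κ h) with h4 | h4
      · have e1 : ∀ x, Hom.toLin (inv (s₁.lift κ h)) (Hom.toLin (s₁.lift κ h) x) = x :=
          fun x => by rw [← toLin_comp_apply, IsIso.hom_inv_id]; rfl
        have e2 : ∀ x, Hom.toLin (s₁.lift κ h) (Hom.toLin (inv (s₁.lift κ h)) x) = x :=
          fun x => by rw [← toLin_comp_apply, IsIso.inv_hom_id]; rfl
        have e3 : ∀ x, Hom.toLin κ x = Hom.toLin s₁.i (Hom.toLin (s₁.lift κ h) x) :=
          fun x => by rw [← toLin_comp_apply, h3]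
        refine ⟨l, Q₁, SplitExt.ofExact κ s₁.q ((Hom.toLin (inv (s₁.lift κ h))).comp s₁.ρ)
          (fun h => Hom.map_mem _ (s₁.ρ_mem h)) (fun x => ?_) (fun x => ?_) s₁.q_surj
          (fun x hx => ⟨Hom.toLin (inv (s₁.lift κ h)) (s₁.ρ x), ?_⟩), rfl, rfl, hQ₁⟩
        · rw [LinearMap.comp_apply, e3, s₁.ρ_i, e1]
        · rw [e3, s₁.q_i]
        · rw [e3, e2, s₁.i_ρ_of_q_eq_zero hx]
      · rw [h4, zero_comp] at h3
        refine (hκx κ hκ ?_).elim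
        rw [← h3]
        rfl

/-- Direct summands of sorted modules are sorted. -/
theorem Sorted.retract (hpos : ∀ i : ℤ, i < 0 → 𝒜.gr i = ⊥) {I : Set ℤ} {l : ℕ} :
    ∀ {n : ℤ} {M M' : DGMod 𝒜} (_ : Sorted I n l M) (i : M' ⟶ M) (r : M ⟶ M')
      (_ : i ≫ r = 𝟙 M'), ∃ l', Sorted I n l' M' := by
  induction l with
  | zero =>
    intro n M M' hM i r hir
    cases hM with
    | zero h =>
      refine ⟨0, .zero ⟨fun x y => ?_⟩⟩
      have h1 : ∀ x, Hom.toLin r (Hom.toLin i x) = x := fun x => by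
        rw [← toLin_comp_apply, hir]; rfl
      rw [← h1 x, ← h1 y, Subsingleton.elim (Hom.toLin i x)]
  | succ l ih =>
    intro n M M' hM i r hir
    have h1 : ∀ x, Hom.toLin r (Hom.toLin i x) = x := fun x => by
      rw [← toLin_comp_apply, hir]; rfl
    cases hM with
    | @ext _ n' _ K _ Q hn hI hK s hQ =>
      -- If the bottom layer `K` survives in `M'`, its image under the idempotent `r ≫ i` can
      -- replace it as bottom layer of `M`, and `M' / K` is a retract of the new quotient `Q₂`. If
      -- `r` kills `K`, then `M'` is already a retract of `Q`. In both cases the length drops.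
      rcases hK.injective_or_eq_zero (s.i ≫ r) with h | h
      · obtain ⟨l', Q₂, s₂, hl, hs₂, hQ₂⟩ := (Sorted.ext le_rfl hI hK s hQ).exists_splitExt hpos hK
          (s.i ≫ r ≫ i) (by
            intro x y hxy
            apply h
            have := congrArg (fun z => Hom.toLin r (Subtype.val z)) hxy
            exact Subtype.ext (by simpa [h1] using this))
        obtain rfl : l = l' := by omega
        have hs₂' : ∀ x, Hom.toLin s₂.i x = Hom.toLin i (Hom.toLin r (Hom.toLin s.i x)) :=
          fun x => by rw [hs₂]; rfl
        let s₃ := SplitExt.ofRetraction (s.i ≫ r) (s₂.ρ.comp (Hom.toLin i))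
          (fun h => s₂.ρ_mem (Hom.map_mem i h)) fun x => by
            rw [LinearMap.comp_apply, toLin_comp_apply, ← hs₂', s₂.ρ_i]
        have hs₃ : s₃.i = s.i ≫ r := rfl
        have e1 : s₃.i ≫ i ≫ s₂.q = 0 := by
          rw [hs₃, Category.assoc, ← Category.assoc r, ← Category.assoc, ← hs₂, s₂.i_comp_q]
        have e2 : s₂.i ≫ r ≫ s₃.q = 0 := by
          rw [hs₂, Category.assoc, Category.assoc, reassoc_of% hir, ← Category.assoc]
          exact s₃.i_comp_q
        obtain ⟨l'', h''⟩ := ih hQ₂ (s₃.desc _ e1) (s₂.desc _ e2) (by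
          have : Epi s₃.q := ⟨fun f g hfg => hom_ext' fun x => by
            obtain ⟨x, rfl⟩ := s₃.q_surj x
            rw [← toLin_comp_apply, hfg]; rfl⟩
          rw [← cancel_epi s₃.q, ← Category.assoc, s₃.q_desc, Category.assoc, s₂.q_desc,
            reassoc_of% hir, Category.comp_id])
        exact ⟨l'' + 1, .ext hn hI hK s₃ h''⟩
      · obtain ⟨l', h'⟩ := ih hQ (i ≫ s.q) (s.desc r h) (by rw [Category.assoc, s.q_desc, hir])
        exact ⟨l', h'.mono hn⟩

/-! ### Homotopy equivalences -/

/-- Two dg modules are homotopy equivalent if they are isomorphic in `dgHot`. -/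
def HotEquiv (M N : DGMod 𝒜) : Prop := Nonempty ((toHot 𝒜).obj M ≅ (toHot 𝒜).obj N)

theorem toHot_map_eq_iff {M N : DGMod 𝒜} {f g : M ⟶ N} :
    (toHot 𝒜).map f = (toHot 𝒜).map g ↔ Homotopic f g :=
  Quotient.functor_map_eq_iff _ f g

theorem HotEquiv.refl (M : DGMod 𝒜) : HotEquiv M M := ⟨Iso.refl _⟩

theorem HotEquiv.symm {M N : DGMod 𝒜} : HotEquiv M N → HotEquiv N M := fun ⟨e⟩ => ⟨e.symm⟩

theorem HotEquiv.trans {M N P : DGMod 𝒜} : HotEquiv M N → HotEquiv N P → HotEquiv M P :=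
  fun ⟨e⟩ ⟨e'⟩ => ⟨e ≪≫ e'⟩

theorem HotEquiv.of_iso {M N : DGMod 𝒜} (e : M ≅ N) : HotEquiv M N := ⟨(toHot 𝒜).mapIso e⟩

theorem HotEquiv.exists_homs {M N : DGMod 𝒜} : HotEquiv M N →
    ∃ (f : M ⟶ N) (g : N ⟶ M), Homotopic (𝟙 M) (f ≫ g) ∧ Homotopic (𝟙 N) (g ≫ f) := by
  rintro ⟨e⟩
  obtain ⟨f, hf⟩ := (toHot 𝒜).map_surjective e.hom
  obtain ⟨g, hg⟩ := (toHot 𝒜).map_surjective e.inv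
  refine ⟨f, g, toHot_map_eq_iff.1 ?_, toHot_map_eq_iff.1 ?_⟩
  · rw [Functor.map_comp, hf, hg, e.hom_inv_id, CategoryTheory.Functor.map_id]
  · rw [Functor.map_comp, hf, hg, e.inv_hom_id, CategoryTheory.Functor.map_id]

/-- An error `ν` of square zero in one of the two composites is harmless: `𝟙 - ν` is invertible, so
`β` acquires a left inverse besides its right inverse. For cones this removes the need to choose the
two homotopies compatibly. -/
theorem HotEquiv.of_unipotent {M N : DGMod 𝒜} (α : M ⟶ N) (β : N ⟶ M) (ν : N ⟶ N)
    (hν : ν ≫ ν = 0) (h₁ : Homotopic (𝟙 M) (α ≫ β)) (h₂ : Homotopic (𝟙 N - ν) (β ≫ α)) :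
    HotEquiv M N := by
  have e₁ := toHot_map_eq_iff.2 h₁
  have e₂ := toHot_map_eq_iff.2 h₂
  have e₃ : (𝟙 N + ν) ≫ (𝟙 N - ν) = 𝟙 N := by
    simp [Preadditive.add_comp, Preadditive.comp_sub, hν]
  have e₄ := congrArg (toHot 𝒜).map e₃
  simp only [Functor.map_comp, CategoryTheory.Functor.map_id] at e₁ e₂ e₄
  have h₅ : ((toHot 𝒜).map (𝟙 N + ν) ≫ (toHot 𝒜).map β) ≫ (toHot 𝒜).map α = 𝟙 _ := by
    rw [Category.assoc, ← e₂, e₄]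
  -- A map with inverses on both sides has them equal: `(𝟙 + ν) ≫ β` and `β` are both inverse to
  -- `α`.
  have h₆ : (toHot 𝒜).map (𝟙 N + ν) ≫ (toHot 𝒜).map β = (toHot 𝒜).map β := by
    have := congrArg (· ≫ (toHot 𝒜).map β) h₅
    simpa only [Category.assoc, ← e₁, Category.comp_id, Category.id_comp] using this
  exact ⟨⟨(toHot 𝒜).map α, (toHot 𝒜).map β, e₁.symm, by rw [← h₆, h₅]⟩⟩

theorem HotEquiv.of_homs {M N : DGMod 𝒜} (α : M ⟶ N) (β : N ⟶ M)
    (h₁ : Homotopic (𝟙 M) (α ≫ β)) (h₂ : Homotopic (𝟙 N) (β ≫ α)) : HotEquiv M N :=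
  .of_unipotent α β 0 (by simp) h₁ (by simpa using h₂)

/-- The shift of a morphism. -/
def shiftMap (n : ℤ) {M N : DGMod 𝒜} (f : M ⟶ N) : M.shift n ⟶ N.shift n where
  toLin := (Hom.toLin (show M ⟶ N from f) : M.carrier →ₗ[𝒜.carrierᵐᵒᵖ] N.carrier)
  map_mem h := Hom.map_mem (show M ⟶ N from f) h
  comm m := by
    change Hom.toLin f (n.negOnePow • M.d m) = n.negOnePow • N.d (Hom.toLin f m)
    refine Eq.trans ?_ (congrArg (n.negOnePow • ·) (Hom.comm f m))
    exact map_zsmul (Hom.toLin f) (n.negOnePow : ℤ) (M.d m)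

theorem Homotopic.shift (n : ℤ) {M N : DGMod 𝒜} {f g : M ⟶ N} (h : Homotopic f g) :
    Homotopic (shiftMap n f) (shiftMap n g) := by
  obtain ⟨h, h1, h2⟩ := h
  refine ⟨(n.negOnePow : ℤ) • h, fun i m hm => ?_, fun m => ?_⟩
  · have := h1 _ m hm
    rw [show i + n - 1 = i - 1 + n by ring] at this
    exact zsmul_mem this _
  · change Hom.toLin f m - Hom.toLin g m = n.negOnePow • N.d ((n.negOnePow : ℤ) • h m) +
      (n.negOnePow : ℤ) • h (n.negOnePow • M.d m)
    rw [h2 m, Units.smul_def, Units.smul_def, map_zsmul, map_zsmul, smul_smul, smul_smul, ← Units.val_mul,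
      Int.units_mul_self]
    simp

theorem HotEquiv.shift {M N : DGMod 𝒜} (h : HotEquiv M N) (n : ℤ) :
    HotEquiv (M.shift n) (N.shift n) := by
  obtain ⟨f, g, h₁, h₂⟩ := h.exists_homs
  exact .of_homs (shiftMap n f) (shiftMap n g) (h₁.shift n) (h₂.shift n)

/-! ### Mapping cones -/

section Cone

variable {M N : DGMod 𝒜} (f : M ⟶ N)

/-- The inclusion of the target into the cone, as a graded linear map. -/
def coneInl : N.carrier →ₗ[𝒜.carrierᵐᵒᵖ] (cone f).carrier := LinearMap.inl _ N.carrier M.carrier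

/-- The inclusion of the source into the cone, as a graded linear map. -/
def coneInr : M.carrier →ₗ[𝒜.carrierᵐᵒᵖ] (cone f).carrier := LinearMap.inr _ N.carrier M.carrier

/-- The projection of the cone onto the target, as a graded linear map. -/
def coneFst : (cone f).carrier →ₗ[𝒜.carrierᵐᵒᵖ] N.carrier := LinearMap.fst _ N.carrier M.carrier

/-- The projection of the cone onto the source, as a graded linear map. -/
def coneSnd : (cone f).carrier →ₗ[𝒜.carrierᵐᵒᵖ] M.carrier := LinearMap.snd _ N.carrier M.carrier

variable {f}

theorem cone_ext {x y : (cone f).carrier} (h₁ : coneFst f x = coneFst f y)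
    (h₂ : coneSnd f x = coneSnd f y) : x = y := Prod.ext h₁ h₂

variable (f)

@[simp] theorem coneFst_inl (x) : coneFst f (coneInl f x) = x := rfl
@[simp] theorem coneSnd_inl (x) : coneSnd f (coneInl f x) = 0 := rfl
@[simp] theorem coneFst_inr (x) : coneFst f (coneInr f x) = 0 := rfl
@[simp] theorem coneSnd_inr (x) : coneSnd f (coneInr f x) = x := rfl

@[simp] theorem coneFst_d (x) :
    coneFst f ((cone f).d x) = N.d (coneFst f x) + Hom.toLin f (coneSnd f x) := rfl

@[simp] theorem coneSnd_d (x) : coneSnd f ((cone f).d x) = -M.d (coneSnd f x) := rfl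

theorem cone_sum (x) : coneInl f (coneFst f x) + coneInr f (coneSnd f x) = x :=
  cone_ext (by simp) (by simp)

theorem mem_cone_gr {i : ℤ} {x : (cone f).carrier} :
    x ∈ (cone f).gr i ↔ coneFst f x ∈ N.gr i ∧ coneSnd f x ∈ M.gr (i + 1) := Iff.rfl

variable {f}

/-- The morphism of cones given on `N ⊕ M` by the matrix with entries `a`, `c` and `0`, `b`. -/
def coneMap {M' N' : DGMod 𝒜} {f' : M' ⟶ N'} (a : N ⟶ N') (b : M ⟶ M')
    (c : M.carrier →ₗ[𝒜.carrierᵐᵒᵖ] N'.carrier)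
    (hc : ∀ (i : ℤ) (m : M.carrier), m ∈ M.gr i → c m ∈ N'.gr (i - 1))
    (h : ∀ m, Hom.toLin a (Hom.toLin f m) - Hom.toLin f' (Hom.toLin b m) =
      N'.d (c m) + c (M.d m)) : cone f ⟶ cone f' where
  toLin := (coneInl f').comp ((Hom.toLin a).comp (coneFst f) + c.comp (coneSnd f)) +
    (coneInr f').comp ((Hom.toLin b).comp (coneSnd f))
  map_mem {i m} hm := by
    rw [mem_cone_gr] at hm ⊢
    have := hc _ _ hm.2
    rw [add_sub_cancel_right] at this
    simpa using ⟨add_mem (Hom.map_mem a hm.1) this, Hom.map_mem b hm.2⟩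
  comm x := by
    apply cone_ext
    · have := h (coneSnd f x)
      rw [sub_eq_iff_eq_add] at this
      simp [this, Hom.comm a]
      abel
    · simp [Hom.comm b]

section

variable {M' N' : DGMod 𝒜} {f' : M' ⟶ N'} (a : N ⟶ N') (b : M ⟶ M')
    (c : M.carrier →ₗ[𝒜.carrierᵐᵒᵖ] N'.carrier) (hc h)

@[simp] theorem coneFst_coneMap (x) : coneFst f' (Hom.toLin (coneMap a b c hc h) x) =
    Hom.toLin a (coneFst f x) + c (coneSnd f x) := by simp [coneMap]

@[simp] theorem coneSnd_coneMap (x) : coneSnd f' (Hom.toLin (coneMap a b c hc h) x) =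
    Hom.toLin b (coneSnd f x) := by simp [coneMap]

end

/-- The homotopies considered are diagonal in `N ⊕ M`. The two equations are the components of `d H
+ H d` for such an `H`, with the signs of the shifted summand. -/
theorem Homotopic.cone {M' N' : DGMod 𝒜} {f' : M' ⟶ N'} {α β : cone f ⟶ cone f'}
    (a : N.carrier →ₗ[𝒜.carrierᵐᵒᵖ] N'.carrier) (b : M.carrier →ₗ[𝒜.carrierᵐᵒᵖ] M'.carrier)
    (ha : ∀ (i : ℤ) (m : N.carrier), m ∈ N.gr i → a m ∈ N'.gr (i - 1))
    (hb : ∀ (i : ℤ) (m : M.carrier), m ∈ M.gr i → b m ∈ M'.gr (i - 1))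
    (h₁ : ∀ x, coneFst f' (Hom.toLin α x) - coneFst f' (Hom.toLin β x) =
      N'.d (a (coneFst f x)) + Hom.toLin f' (b (coneSnd f x)) +
        a (N.d (coneFst f x) + Hom.toLin f (coneSnd f x)))
    (h₂ : ∀ x, coneSnd f' (Hom.toLin α x) - coneSnd f' (Hom.toLin β x) =
      -M'.d (b (coneSnd f x)) - b (M.d (coneSnd f x))) : Homotopic α β := by
  refine ⟨(coneInl f').comp (a.comp (coneFst f)) + (coneInr f').comp (b.comp (coneSnd f)),
    fun i m hm => ?_, fun m => ?_⟩
  · rw [mem_cone_gr] at hm ⊢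
    have := hb _ _ hm.2
    rw [add_sub_cancel_right] at this
    simpa using ⟨ha _ _ hm.1, this⟩
  · apply cone_ext
    · rw [map_sub, h₁]
      simp
    · rw [map_sub, h₂]
      simp [sub_eq_add_neg]

/-- The inverse direction needs the correction `-h ∘ f`, since `v ∘ u` is the identity only up to
`h`. One composite is then homotopic to the identity; the other misses it by the strictly triangular
term `c`, which compares `u ∘ h` with `h' ∘ u` and has square zero as an endomorphism of the cone.
-/
theorem HotEquiv.cone_comp {N' : DGMod 𝒜} (f : M ⟶ N) (u : N ⟶ N') (v : N' ⟶ N)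
    (h₁ : Homotopic (𝟙 N) (u ≫ v)) (h₂ : Homotopic (𝟙 N') (v ≫ u)) :
    HotEquiv (cone f) (cone (f ≫ u)) := by
  obtain ⟨h, h1, h2⟩ := h₁
  obtain ⟨h', h1', h2'⟩ := h₂
  simp only [toLin_id, toLin_comp, LinearMap.id_apply, LinearMap.comp_apply] at h2 h2'
  let c := ((Hom.toLin u).comp h - h'.comp (Hom.toLin u)).comp (Hom.toLin f)
  have hc : ∀ m, c m = Hom.toLin u (h (Hom.toLin f m)) - h' (Hom.toLin u (Hom.toLin f m)) :=
    fun _ => rfl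
  have e2 : ∀ m, N.d (h m) = m - Hom.toLin v (Hom.toLin u m) - h (N.d m) := fun m => by
    rw [h2]; abel
  have e2' : ∀ m, N'.d (h' m) = m - Hom.toLin u (Hom.toLin v m) - h' (N'.d m) := fun m => by
    rw [h2']; abel
  refine .of_unipotent (coneMap u (𝟙 M) 0 (fun _ _ _ => zero_mem _) fun m => by simp)
    (coneMap v (𝟙 M) (-h.comp (Hom.toLin f))
      (fun i m hm => neg_mem (h1 i _ (Hom.map_mem f hm))) fun m => ?_)
    (coneMap 0 0 c (fun i m hm => sub_mem (Hom.map_mem u (h1 i _ (Hom.map_mem f hm)))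
      (h1' i _ (Hom.map_mem u (Hom.map_mem f hm)))) fun m => ?_) ?_
    (.cone h 0 h1 (fun _ _ _ => zero_mem _) (fun x => ?_) fun x => ?_)
    (.cone h' 0 h1' (fun _ _ _ => zero_mem _) (fun x => ?_) fun x => ?_)
  · simp only [toLin_comp_apply, toLin_id, LinearMap.id_apply, LinearMap.neg_apply,
      LinearMap.comp_apply, map_neg, e2, Hom.comm]
    abel
  · simp only [hc, map_sub, ← Hom.comm, e2, e2']
    simp
  · refine hom_ext' fun x => cone_ext ?_ ?_ <;> simp
  · simp [e2]
    abel
  · simp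
  · simp [e2', hc]
    abel
  · simp

/-- The mirror image of the previous argument: the correction is now `f ∘ h`, and the diagonal
homotopies act on the source summand with a minus sign because of the shift. -/
theorem HotEquiv.comp_cone {M' : DGMod 𝒜} (f : M ⟶ N) (u : M' ⟶ M) (v : M ⟶ M')
    (h₁ : Homotopic (𝟙 M') (u ≫ v)) (h₂ : Homotopic (𝟙 M) (v ≫ u)) :
    HotEquiv (cone f) (cone (u ≫ f)) := by
  obtain ⟨h', h1', h2'⟩ := h₁
  obtain ⟨h, h1, h2⟩ := h₂
  simp only [toLin_id, toLin_comp, LinearMap.id_apply, LinearMap.comp_apply] at h2 h2'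
  let c := (Hom.toLin f).comp ((Hom.toLin u).comp h' - h.comp (Hom.toLin u))
  have hc : ∀ m, c m = Hom.toLin f (Hom.toLin u (h' m)) - Hom.toLin f (h (Hom.toLin u m)) :=
    fun _ => map_sub (Hom.toLin f) _ _
  have e2 : ∀ m, M.d (h m) = m - Hom.toLin u (Hom.toLin v m) - h (M.d m) := fun m => by
    rw [h2]; abel
  have e2' : ∀ m, M'.d (h' m) = m - Hom.toLin v (Hom.toLin u m) - h' (M'.d m) := fun m => by
    rw [h2']; abel
  refine (HotEquiv.of_unipotent
    (coneMap (𝟙 N) v ((Hom.toLin f).comp h)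
      (fun i m hm => Hom.map_mem f (h1 i m hm)) fun m => ?_)
    (coneMap (𝟙 N) u 0 (fun _ _ _ => zero_mem _) fun m => by simp)
    (coneMap 0 0 c (fun i m hm => Hom.map_mem f (sub_mem (Hom.map_mem u (h1' i _ hm))
      (h1 i _ (Hom.map_mem u hm)))) fun m => ?_) ?_
    (.cone 0 (-h) (fun _ _ _ => zero_mem _) (fun i m hm => neg_mem (h1 i m hm))
      (fun x => ?_) fun x => ?_)
    (.cone 0 (-h') (fun _ _ _ => zero_mem _) (fun i m hm => neg_mem (h1' i m hm))
      (fun x => ?_) fun x => ?_))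
  · simp only [toLin_comp_apply, toLin_id, LinearMap.id_apply, LinearMap.comp_apply, ← Hom.comm,
      e2, map_sub]
    abel
  · simp only [hc, map_sub, ← Hom.comm, e2, e2']
    simp
  · refine hom_ext' fun x => cone_ext ?_ ?_ <;> simp
  · simp
  · simp [e2]
  · simp [hc]
    abel
  · simp [e2']

/-- The cone of an isomorphism is contractible. -/
theorem contractible_cone (f : M ⟶ N) [IsIso f] : Homotopic (𝟙 (cone f)) 0 := by
  have e1 : ∀ x, Hom.toLin (inv f) (Hom.toLin f x) = x :=
    fun x => by rw [← toLin_comp_apply, IsIso.hom_inv_id]; rfl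
  have e2 : ∀ x, Hom.toLin f (Hom.toLin (inv f) x) = x :=
    fun x => by rw [← toLin_comp_apply, IsIso.inv_hom_id]; rfl
  refine ⟨(coneInr f).comp ((Hom.toLin (inv f)).comp (coneFst f)), fun i m hm => ?_, fun m => ?_⟩
  · rw [mem_cone_gr] at hm ⊢
    simpa using Hom.map_mem (inv f) hm.1
  · apply cone_ext <;> simp [e1, e2, Hom.comm (inv f)]

variable (f)

/-- The cone of `f : M ⟶ N` is an extension of `M.shift 1` by `N`. -/
def coneExt : SplitExt N (cone f) (M.shift 1) where
  i := { toLin := coneInl f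
         map_mem := fun h => ⟨h, zero_mem _⟩
         comm := fun m => by apply cone_ext <;> simp }
  q := { toLin := coneSnd f
         map_mem := fun h => h.2
         comm := fun m => by
          change coneSnd f ((cone f).d m) = (1 : ℤ).negOnePow • M.d (coneSnd f m)
          rw [coneSnd_d]
          simp }
  ρ := coneFst f
  σ := coneInr f
  ρ_mem h := h.1
  σ_mem h := ⟨zero_mem _, h⟩
  ρ_i _ := rfl
  q_σ _ := rfl
  sum x := cone_sum f x

end Cone

/-- The cone of `f : Q.shift (-1) ⟶ K` is an extension of `Q` by `K`. -/
def coneExt' {K Q : DGMod 𝒜} (f : Q.shift (-1) ⟶ K) : SplitExt K (cone f) Q where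
  i := { toLin := coneInl f
         map_mem := fun h => ⟨h, zero_mem _⟩
         comm := fun m => by apply cone_ext <;> simp }
  q := { toLin := coneSnd f
         map_mem := fun {i m} h => by
          have : coneSnd f m ∈ Q.gr (i + 1 + -1) := h.2
          rwa [add_neg_cancel_right] at this
         comm := fun m => by
          change -((-1 : ℤ).negOnePow • Q.d (coneSnd f m)) = Q.d (coneSnd f m)
          simp }
  ρ := coneFst f
  σ := coneInr f
  ρ_mem h := h.1
  σ_mem {i x} h := ⟨zero_mem _, by
    change x ∈ Q.gr (i + 1 + -1)
    rwa [add_neg_cancel_right]⟩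
  ρ_i _ := rfl
  q_σ _ := rfl
  sum x := cone_sum f x

/-! ### Split extensions as mapping cones -/

namespace SplitExt

variable {K E Q : DGMod 𝒜} (s : SplitExt K E Q)

/-- In the graded decomposition `E = K ⊕ Q` the differential is triangular. The entry `ρ d σ` from
`Q` to `K` is the only datum beyond the differentials of `K` and `Q`. -/
theorem d_σ (x : Q.carrier) : E.d (s.σ x) = Hom.toLin s.i (s.ρ (E.d (s.σ x))) + s.σ (Q.d x) := by
  conv_lhs => rw [← s.sum (E.d (s.σ x)), Hom.comm, s.q_σ]

theorem ρ_d (x : E.carrier) :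
    s.ρ (E.d x) = K.d (s.ρ x) + s.ρ (E.d (s.σ (Hom.toLin s.q x))) := by
  conv_lhs => rw [← s.sum x, map_add, map_add, ← Hom.comm, s.ρ_i]

/-- The graded linear map `ρ d σ` of degree one attached to a split extension. -/
def connectingLin : Q.carrier →ₗ[𝒜.carrierᵐᵒᵖ] K.carrier where
  toFun := fun x => s.ρ (E.d (s.σ x))
  map_add' := fun x y => by simp only [map_add]
  map_smul' := fun r x => by
    change s.ρ (E.d (s.σ (r • x))) = r • s.ρ (E.d (s.σ x))
    let φ : Q.carrier →+ K.carrier :=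
      s.ρ.toAddMonoidHom.comp (E.d.comp s.σ.toAddMonoidHom)
    refine addHom_ext_of_isInternal Q.isInternal
      (φ.comp (DistribSMul.toAddMonoidHom _ r))
      ((DistribSMul.toAddMonoidHom _ r).comp φ) (fun i y hy => ?_) x
    change s.ρ (E.d (s.σ (r • y))) = r • s.ρ (E.d (s.σ y))
    -- The Leibniz rule leaves an error term `± σ(y) · da`. It lies in the image of `σ`, hence is
    -- killed by `ρ`.
    have := E.leibniz r.unop (s.σ_mem hy)
    rw [MulOpposite.op_unop] at this
    rw [map_smul, this, map_add, Units.smul_def, map_zsmul, map_smul, map_smul, s.ρ_σ]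
    simp

theorem connectingLin_apply (x : Q.carrier) : s.connectingLin x = s.ρ (E.d (s.σ x)) := rfl

/-- The connecting morphism of a split extension. -/
def connecting : Q.shift (-1) ⟶ K where
  toLin := s.connectingLin
  map_mem {i x} hx := by
    have := s.ρ_mem (E.d_mem (s.σ_mem hx))
    rwa [neg_add_cancel_right] at this
  comm x := by
    change s.ρ (E.d (s.σ ((-1 : ℤ).negOnePow • Q.d x))) = K.d (s.ρ (E.d (s.σ x)))
    -- Applying `ρ d` to the formula for `d σ` and using `d² = 0` shows that `ρ d σ` anticommutes
    -- with the differentials. The sign is absorbed by the shift by `-1`.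
    have h := congrArg (fun y => s.ρ (E.d y)) (s.d_σ x)
    simp only [E.d_d, map_zero, map_add, ← Hom.comm, s.ρ_i] at h
    rw [eq_comm, ← eq_neg_iff_add_eq_zero] at h
    simp [h]

/-- The graded isomorphism from a split extension to the cone of its connecting morphism. -/
def toCone : E.carrier →ₗ[𝒜.carrierᵐᵒᵖ] (cone s.connecting).carrier :=
  LinearMap.prod (M₃ := Q.carrier) s.ρ (Hom.toLin s.q)

theorem coneFst_toCone (x : E.carrier) : coneFst s.connecting (s.toCone x) = s.ρ x := rfl

theorem coneSnd_toCone (x : E.carrier) : coneSnd s.connecting (s.toCone x) = Hom.toLin s.q x := rfl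

/-- A split extension is the cone of its connecting morphism. -/
def isoCone : E ≅ cone s.connecting :=
  isoOfBijective
    { toLin := s.toCone
      map_mem := fun {i x} hx => by
        refine ⟨s.ρ_mem hx, ?_⟩
        change Hom.toLin s.q x ∈ Q.gr (i + 1 + -1)
        rw [add_neg_cancel_right]
        exact Hom.map_mem s.q hx
      comm := fun x => by
        apply cone_ext
        · rw [coneFst_d]
          exact s.ρ_d x
        · rw [coneSnd_d, coneSnd_toCone, Hom.comm]
          change _ = -((-1 : ℤ).negOnePow • Q.d (Hom.toLin s.q x))
          simp } (by
    refine Function.bijective_iff_has_inverse.2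
      ⟨fun y => Hom.toLin s.i (coneFst s.connecting y) + s.σ (coneSnd s.connecting y), s.sum, fun y => ?_⟩
    apply cone_ext
    · rw [coneFst_toCone, map_add, s.ρ_i]
      exact add_eq_left.2 (s.ρ_σ _)
    · rw [coneSnd_toCone, map_add, s.q_i, zero_add]
      exact s.q_σ _)

/-- The quotient of a split extension can be replaced by a homotopy equivalent dg module. -/
theorem replace_right (s : SplitExt K E Q) {Q' : DGMod 𝒜} (h : HotEquiv Q Q') :
    ∃ E', HotEquiv E E' ∧ Nonempty (SplitExt K E' Q') := by
  obtain ⟨u, v, h₁, h₂⟩ := (h.symm.shift (-1)).exists_homs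
  exact ⟨_, (HotEquiv.of_iso s.isoCone).trans (.comp_cone s.connecting u v h₁ h₂), ⟨coneExt' _⟩⟩

/-- The quotient by a contractible submodule is homotopy equivalent to the whole module. -/
theorem hotEquiv_of_contractible (s : SplitExt K E Q) (hK : Homotopic (𝟙 K) 0) : HotEquiv E Q := by
  obtain ⟨h, h1, h2⟩ := hK
  simp only [toLin_id, toLin_zero, LinearMap.id_apply, LinearMap.zero_apply, sub_zero] at h2
  have e2 : ∀ m, K.d (h m) = m - h (K.d m) := fun m => eq_sub_of_add_eq (h2 m).symm
  let δ : Q.carrier →ₗ[𝒜.carrierᵐᵒᵖ] K.carrier := s.connectingLin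
  have hdσ : ∀ x, E.d (s.σ x) = Hom.toLin s.i (δ x) + s.σ (Q.d x) := s.d_σ
  have hρd : ∀ x, s.ρ (E.d x) = K.d (s.ρ x) + δ (Hom.toLin s.q x) := s.ρ_d
  have hdδ : ∀ x, K.d (δ x) = -δ (Q.d x) := fun x => by
    have : δ ((-1 : ℤ).negOnePow • Q.d x) = K.d (δ x) := Hom.comm s.connecting x
    rw [← this]
    simp
  -- The graded section is corrected by the contraction: `d h δ = δ - h d δ = δ + h δ d`, so
  -- subtracting `i h δ` cancels the term `i δ` in `d σ` and makes the section a morphism of dg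
  -- modules.
  let S : Q ⟶ E :=
    { toLin := s.σ - (Hom.toLin s.i).comp (h.comp δ)
      map_mem := fun {i x} hx => by
        refine sub_mem (s.σ_mem hx) (Hom.map_mem s.i ?_)
        have := h1 _ _ (s.ρ_mem (E.d_mem (s.σ_mem hx)))
        rwa [add_sub_cancel_right] at this
      comm := fun x => by
        simp only [LinearMap.sub_apply, LinearMap.comp_apply, map_sub, ← Hom.comm, e2, hdσ, hdδ,
          map_neg]
        abel }
  have hS : ∀ x, Hom.toLin S x = s.σ x - Hom.toLin s.i (h (δ x)) := fun _ => rfl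
  refine .of_homs s.q S ⟨(Hom.toLin s.i).comp (h.comp s.ρ), fun i m hm =>
    Hom.map_mem s.i (h1 _ _ (s.ρ_mem hm)), fun m => ?_⟩ ⟨0, fun _ _ _ => zero_mem _, fun m => ?_⟩
  · have := s.sum m
    simp only [toLin_id, LinearMap.id_apply, toLin_comp_apply, hS, LinearMap.comp_apply,
      ← Hom.comm, e2, hρd, map_sub, map_add]
    rw [← eq_sub_iff_add_eq] at this
    rw [this]
    abel
  · simp [hS, s.q_i, s.q_σ]

end SplitExt

/-! ### Iterated split extensions -/

namespace SplitExt

theorem map_σ_q {K E Q : DGMod 𝒜} (s : SplitExt K E Q) {X : Type*} [AddCommGroup X]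
    [Module 𝒜.carrierᵐᵒᵖ X] (f : E.carrier →ₗ[𝒜.carrierᵐᵒᵖ] X)
    (hf : ∀ x, f (Hom.toLin s.i x) = 0) (e : E.carrier) :
    f (s.σ (Hom.toLin s.q e)) = f e := by
  conv_rhs => rw [← s.sum e, map_add, hf, zero_add]

theorem desc_q {K E Q N : DGMod 𝒜} (s : SplitExt K E Q) (f : E ⟶ N) (hf : s.i ≫ f = 0)
    (e : E.carrier) : Hom.toLin (s.desc f hf) (Hom.toLin s.q e) = Hom.toLin f e := by
  rw [← toLin_comp_apply, s.q_desc]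

/-- Once `K₁`, the bottom layer of the quotient `M`, lifts to a dg submodule of `E`, the layers `K`
and `K₁` trade places. The condition `ρ ∘ t = 0` lets `ρ` descend to a retraction onto `K` on `E /
t(K₁)`. -/
theorem exists_swap {K K₁ E M Q : DGMod 𝒜} (s : SplitExt K E M) (s₁ : SplitExt K₁ M Q)
    (t : K₁ ⟶ E) (ht : ∀ x, Hom.toLin s.q (Hom.toLin t x) = Hom.toLin s₁.i x)
    (ht' : ∀ x, s.ρ (Hom.toLin t x) = 0) :
    ∃ Q', Nonempty (SplitExt K₁ E Q') ∧ Nonempty (SplitExt K Q' Q) := by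
  let s₂ := ofRetraction t (s₁.ρ.comp (Hom.toLin s.q))
    (fun h => s₁.ρ_mem (Hom.map_mem s.q h)) fun x => by rw [LinearMap.comp_apply, ht, s₁.ρ_i]
  have hs₂ : ∀ x, Hom.toLin s₂.i x = Hom.toLin t x := fun _ => rfl
  have h0 : s₂.i ≫ s.q ≫ s₁.q = 0 := hom_ext' fun x => by
    rw [toLin_comp_apply, toLin_comp_apply, hs₂, ht, s₁.q_i]; rfl
  refine ⟨_, ⟨s₂⟩, ⟨ofExact (s.i ≫ s₂.q) (s₂.desc (s.q ≫ s₁.q) h0) (s.ρ.comp s₂.σ)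
    (fun h => s.ρ_mem (s₂.σ_mem h)) (fun x => ?_) (fun x => ?_) ?_ ?_⟩⟩
  · rw [LinearMap.comp_apply, toLin_comp_apply, s₂.map_σ_q s.ρ ht', s.ρ_i]
  · rw [toLin_comp_apply, desc_q, toLin_comp_apply, s.q_i, map_zero]
  · intro y
    obtain ⟨y, rfl⟩ := s₁.q_surj y
    obtain ⟨y, rfl⟩ := s.q_surj y
    exact ⟨_, desc_q _ _ _ _⟩
  · intro y hy
    obtain ⟨e, rfl⟩ := s₂.q_surj y
    rw [desc_q, toLin_comp_apply] at hy
    have h1 := s₁.i_ρ_of_q_eq_zero hy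
    rw [← ht, eq_comm, ← sub_eq_zero, ← map_sub] at h1
    refine ⟨s.ρ (e - Hom.toLin t (s₁.ρ (Hom.toLin s.q e))), ?_⟩
    rw [toLin_comp_apply, s.i_ρ_of_q_eq_zero h1, map_sub]
    exact sub_eq_self.2 (s₂.q_i _)

/-- The third isomorphism theorem, with the graded splittings carried along: `E₁ = E / K` is an
extension of `Q` by `N / K`. -/
theorem exists_quotient {K N N₁ E Q : DGMod 𝒜} (s : SplitExt N E Q) (s₁ : SplitExt K N N₁) :
    ∃ E₁, Nonempty (SplitExt K E E₁) ∧ Nonempty (SplitExt N₁ E₁ Q) := by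
  let s₂ := ofRetraction (s₁.i ≫ s.i) (s₁.ρ.comp s.ρ)
    (fun h => s₁.ρ_mem (s.ρ_mem h)) fun x => by
      rw [LinearMap.comp_apply, toLin_comp_apply, s.ρ_i, s₁.ρ_i]
  have hs₂ : ∀ x, Hom.toLin s₂.i x = Hom.toLin s.i (Hom.toLin s₁.i x) := fun _ => rfl
  have h0 : s₂.i ≫ s.q = 0 := hom_ext' fun x => by
    rw [toLin_comp_apply, hs₂, s.q_i]; rfl
  have h1 : s₁.i ≫ s.i ≫ s₂.q = 0 := hom_ext' fun x => s₂.q_i x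
  refine ⟨_, ⟨s₂⟩, ⟨ofExact (s₁.desc (s.i ≫ s₂.q) h1) (s₂.desc s.q h0)
    (((Hom.toLin s₁.q).comp s.ρ).comp s₂.σ)
    (fun h => Hom.map_mem s₁.q (s.ρ_mem (s₂.σ_mem h))) (fun x => ?_) (fun x => ?_) ?_ ?_⟩⟩
  · obtain ⟨x, rfl⟩ := s₁.q_surj x
    rw [desc_q, LinearMap.comp_apply, toLin_comp_apply, s₂.map_σ_q]
    · rw [LinearMap.comp_apply, s.ρ_i]
    · intro y
      rw [LinearMap.comp_apply, hs₂, s.ρ_i, s₁.q_i]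
  · obtain ⟨x, rfl⟩ := s₁.q_surj x
    rw [desc_q, toLin_comp_apply, desc_q, s.q_i]
  · intro y
    obtain ⟨y, rfl⟩ := s.q_surj y
    exact ⟨_, desc_q _ _ _ _⟩
  · intro y hy
    obtain ⟨e, rfl⟩ := s₂.q_surj y
    rw [desc_q] at hy
    exact ⟨Hom.toLin s₁.q (s.ρ e), by
      rw [desc_q, toLin_comp_apply, s.i_ρ_of_q_eq_zero hy]⟩

/-- The graded lift of `K₁` to `E` fails to commute with `d` by the restriction to `K₁` of the
connecting map. This restriction is the only obstruction to exchanging the two layers. -/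
theorem lift_comm {K K₁ E M Q : DGMod 𝒜} (s : SplitExt K E M) (s₁ : SplitExt K₁ M Q)
    (x : K₁.carrier) : E.d (s.σ (Hom.toLin s₁.i x)) =
      Hom.toLin s.i (s.connectingLin (Hom.toLin s₁.i x)) + s.σ (Hom.toLin s₁.i (K₁.d x)) := by
  rw [s.d_σ, ← Hom.comm, connectingLin_apply]

/-- The preimage of a sub in an extension, as the cone of the restricted connecting morphism. -/
def assoc {K K₁ E M Q : DGMod 𝒜} (s : SplitExt K E M) (s₁ : SplitExt K₁ M Q) :
    SplitExt (cone (shiftMap (-1) s₁.i ≫ s.connecting)) E Q :=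
  let g := shiftMap (-1) s₁.i ≫ s.connecting
  let b : (cone g).carrier →ₗ[𝒜.carrierᵐᵒᵖ] K₁.carrier := coneSnd g
  let L : (cone g).carrier →ₗ[𝒜.carrierᵐᵒᵖ] E.carrier := (Hom.toLin s.i).comp (coneFst g) +
    s.σ.comp ((Hom.toLin s₁.i).comp b)
  have hL : ∀ x, L x = Hom.toLin s.i (coneFst g x) + s.σ (Hom.toLin s₁.i (b x)) := fun _ => rfl
  have hbd : ∀ x, b ((cone g).d x) = K₁.d (b x) := fun x => by
    change -((-1 : ℤ).negOnePow • K₁.d (b x)) = K₁.d (b x)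
    simp
  have had : ∀ x, coneFst g ((cone g).d x) =
      K.d (coneFst g x) + s.connectingLin (Hom.toLin s₁.i (b x)) := fun _ => rfl
  ofExact
    { toLin := L
      map_mem := fun {i x} hx => by
        refine add_mem (Hom.map_mem s.i hx.1) (s.σ_mem (Hom.map_mem s₁.i ?_))
        have : b x ∈ K₁.gr (i + 1 + -1) := hx.2
        rwa [add_neg_cancel_right] at this
      comm := fun x => by
        rw [hL, hL, map_add, s.lift_comm, hbd, had, map_add, ← Hom.comm, add_assoc] }
    (s.q ≫ s₁.q)
    (LinearMap.prod (M₃ := K₁.carrier) s.ρ (s₁.ρ.comp (Hom.toLin s.q)))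
    (fun {i x} hx => ⟨s.ρ_mem hx, by
      change s₁.ρ (Hom.toLin s.q x) ∈ K₁.gr (i + 1 + -1)
      rw [add_neg_cancel_right]
      exact s₁.ρ_mem (Hom.map_mem s.q hx)⟩)
    (fun x => by
      refine Prod.ext ?_ ?_
      · change s.ρ (L x) = coneFst g x
        rw [hL, map_add, s.ρ_i, s.ρ_σ, add_zero]
      · change s₁.ρ (Hom.toLin s.q (L x)) = b x
        rw [hL, map_add, s.q_i, s.q_σ, zero_add, s₁.ρ_i])
    (fun x => by
      change Hom.toLin s₁.q (Hom.toLin s.q (L x)) = 0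
      rw [hL, map_add, s.q_i, s.q_σ, zero_add, s₁.q_i])
    (fun y => by
      obtain ⟨y, rfl⟩ := s₁.q_surj y
      obtain ⟨y, rfl⟩ := s.q_surj y
      exact ⟨y, rfl⟩)
    (fun x hx => by
      have h1 := s₁.i_ρ_of_q_eq_zero (x := Hom.toLin s.q x) hx
      have h2 := s.sum x
      rw [← h1] at h2
      exact ⟨(s.ρ x, s₁.ρ (Hom.toLin s.q x)), h2⟩)

/-- The shift of a split extension. -/
def shift {K E Q : DGMod 𝒜} (s : SplitExt K E Q) (n : ℤ) :
    SplitExt (K.shift n) (E.shift n) (Q.shift n) where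
  i := shiftMap n s.i
  q := shiftMap n s.q
  ρ := (s.ρ : E.carrier →ₗ[𝒜.carrierᵐᵒᵖ] K.carrier)
  σ := (s.σ : Q.carrier →ₗ[𝒜.carrierᵐᵒᵖ] E.carrier)
  ρ_mem h := s.ρ_mem h
  σ_mem h := s.σ_mem h
  ρ_i := s.ρ_i
  q_σ := s.q_σ
  sum := s.sum

/-- If the sub of an extension vanishes, the extension is isomorphic to the quotient. -/
def isoOfSubsingleton {K E Q : DGMod 𝒜} (s : SplitExt K E Q) (h : Subsingleton K.carrier) :
    E ≅ Q :=
  isoOfBijective s.q ⟨(injective_iff_map_eq_zero _).2 fun x hx => by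
    rw [← s.i_ρ_of_q_eq_zero hx, Subsingleton.elim (s.ρ x) 0, map_zero], s.q_surj⟩

end SplitExt

/-! ### Extensions of sorted modules -/

theorem Sorted.shift {n : ℤ} {l : ℕ} {M : DGMod 𝒜} (h : Sorted Set.univ n l M) (j : ℤ) :
    Sorted Set.univ (n - j) l (M.shift j) := by
  induction h with
  | zero h => exact .zero h
  | ext hn hI hK s hQ ih =>
    exact .ext (sub_le_sub_right hn j) trivial (hK.shift _ j (by ring)) (s.shift j) ih

/-- One step of an insertion sort. The new bottom layer `K` moves up past layers of smaller
generating degree. Against such a layer `K₁` the connecting map goes from a module generated in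
degree `n' + 1 ≤ n` to one generated in degree `n`, so it is zero or an isomorphism: the layers are
exchanged in the first case and cancel in the second. -/
theorem Sorted.exists_hotEquiv_of_isHat (hpos : ∀ i : ℤ, i < 0 → 𝒜.gr i = ⊥) {I : Set ℤ}
    {n m : ℤ} {l : ℕ} {K E M : DGMod 𝒜} (hI : n ∈ I) (hK : IsHat n K) (s : SplitExt K E M)
    (hM : Sorted I m l M) :
    ∃ l' G, Sorted I (min n m) l' G ∧ HotEquiv E G := by
  induction hM generalizing E with
  | zero h => exact ⟨_, E, .ext (min_le_left _ _) hI hK s (.zero h), .refl E⟩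
  | @ext m n' l K₁ M Q hn hI' hK₁ s₁ hQ ih =>
    rcases le_or_gt n n' with h | h
    · exact ⟨_, E, .ext (min_le_left _ _) hI hK s (.ext h hI' hK₁ s₁ hQ), .refl E⟩
    have hK₂ : IsHat (n' + 1) (K₁.shift (-1)) := hK₁.shift (n' + 1) (-1) (by ring)
    have key : IsIso (shiftMap (-1) s₁.i ≫ s.connecting) ∨
        shiftMap (-1) s₁.i ≫ s.connecting = 0 := by
      -- For `n' + 1 = n` Schur's lemma decides. For `n' + 1 < n` the generators are sent to degree
      -- `n' + 1`, where `K` vanishes.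
      rcases (show n' + 1 ≤ n by omega).eq_or_lt with h' | h'
      · subst h'
        exact hK₂.isIso_or_eq_zero hK _
      · refine .inr (hK₂.hom_ext fun x hx => ?_)
        have := Hom.map_mem (shiftMap (-1) s₁.i ≫ s.connecting) hx
        rwa [gr_eq_bot_of_gen hpos hK.gen h', AddSubgroup.mem_bot] at this
    rcases key with h' | h'
    -- The preimage of `K₁` in `E` is the cone of an isomorphism, hence contractible, and may be
    -- divided out.
    · exact ⟨l, Q, hQ.mono ((min_le_right _ _).trans hn),
        (s.assoc s₁).hotEquiv_of_contractible (contractible_cone _)⟩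
    · have h0 : ∀ x, s.connectingLin (Hom.toLin s₁.i x) = 0 := fun x =>
        LinearMap.congr_fun (congrArg Hom.toLin h') x
      let t : K₁ ⟶ E :=
        { toLin := s.σ.comp (Hom.toLin s₁.i)
          map_mem := fun h => s.σ_mem (Hom.map_mem s₁.i h)
          comm := fun x => by
            change s.σ (Hom.toLin s₁.i (K₁.d x)) = E.d (s.σ (Hom.toLin s₁.i x))
            rw [s.lift_comm, h0, map_zero, zero_add] }
      obtain ⟨Q', ⟨s₂⟩, ⟨s₃⟩⟩ := s.exists_swap s₁ t (fun x => s.q_σ _) fun x => s.ρ_σ _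
      obtain ⟨l', G, hG, hQG⟩ := ih s₃
      obtain ⟨E', hE, ⟨s₄⟩⟩ := s₂.replace_right hQG
      -- As `n' < n`, the sorted model of the remaining quotient starts in degree at least `n'`, so
      -- `K₁` may be put back below it.
      rw [min_eq_right h.le] at hG
      exact ⟨_, E', .ext ((min_le_right _ _).trans hn) hI' hK₁ s₄ hG, hE⟩

/-- The layers of `N` are inserted one at a time into a sorted model of what lies above them, the
topmost layer of `N` first. -/
theorem Sorted.exists_hotEquiv_of_splitExt (hpos : ∀ i : ℤ, i < 0 → 𝒜.gr i = ⊥) {I : Set ℤ}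
    {n m : ℤ} {l l' : ℕ} {N E Q : DGMod 𝒜} (s : SplitExt N E Q) (hN : Sorted I n l N)
    (hQ : Sorted I m l' Q) : ∃ j l'' G, Sorted I j l'' G ∧ HotEquiv E G := by
  induction hN generalizing E with
  | zero h => exact ⟨m, l', Q, hQ, .of_iso (s.isoOfSubsingleton h)⟩
  | ext hn hI hK s₁ hN ih =>
    obtain ⟨E₁, ⟨s₂⟩, ⟨s₃⟩⟩ := s.exists_quotient s₁
    obtain ⟨j, l'', G, hG, hE₁⟩ := ih s₃
    obtain ⟨E', hE, ⟨s₄⟩⟩ := s₂.replace_right hE₁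
    obtain ⟨l₃, G', hG', hE'⟩ := Sorted.exists_hotEquiv_of_isHat hpos hI hK s₄ hG
    exact ⟨_, l₃, G', hG', hE.trans hE'⟩

/-- With a single generating degree nothing has to be reordered or cancelled, so `E` itself is
sorted and no homotopy equivalence is needed. -/
theorem Sorted.of_splitExt (hpos : ∀ i : ℤ, i < 0 → 𝒜.gr i = ⊥) {n : ℤ} {l l' : ℕ}
    {N E Q : DGMod 𝒜} (s : SplitExt N E Q) (hN : Sorted {n} n l N) (hQ : Sorted {n} n l' Q) :
    ∃ l'', Sorted {n} n l'' E := by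
  induction l generalizing N E with
  | zero =>
    cases hN with
    | zero h => exact hQ.retract hpos _ _ (s.isoOfSubsingleton h).hom_inv_id
  | succ l ih =>
    cases hN with
    | @ext _ n' _ K _ N₁ hn hI hK s₁ hN =>
      obtain rfl : n' = n := hI
      obtain ⟨E₁, ⟨s₂⟩, ⟨s₃⟩⟩ := s.exists_quotient s₁
      obtain ⟨l'', h⟩ := ih s₃ hN
      exact ⟨_, .ext le_rfl rfl hK s₂ h⟩

/-- `M` is homotopy equivalent to a sorted module. -/
def IsHotSorted (M : DGMod 𝒜) : Prop :=
  ∃ (n : ℤ) (l : ℕ) (G : DGMod 𝒜), Sorted Set.univ n l G ∧ HotEquiv M G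

/-- The cone is an extension of `M.shift 1` by `N`. Both ends are replaced by sorted models, the
target through `cone_comp` and the shifted source through `replace_right`, and the resulting
extension is sorted. -/
theorem IsHotSorted.cone (hpos : ∀ i : ℤ, i < 0 → 𝒜.gr i = ⊥) {M N : DGMod 𝒜} (f : M ⟶ N)
    (hM : IsHotSorted M) (hN : IsHotSorted N) : IsHotSorted (cone f) := by
  obtain ⟨n, l, G, hG, hMG⟩ := hM
  obtain ⟨n', l', G', hG', hNG'⟩ := hN
  obtain ⟨u, v, h₁, h₂⟩ := hNG'.exists_homs
  obtain ⟨E', hE, ⟨s⟩⟩ := (coneExt (f ≫ u)).replace_right (hMG.shift 1)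
  obtain ⟨j, l'', G'', hG'', hE'⟩ := Sorted.exists_hotEquiv_of_splitExt hpos s hG' (hG.shift 1)
  exact ⟨j, l'', G'', hG'', (HotEquiv.cone_comp f u v h₁ h₂).trans (hE.trans hE')⟩

instance : (toHot 𝒜).Additive where
  map_add := rfl

/-! ### Minimality of sorted modules -/

theorem map_plus {M N : DGMod 𝒜} (f : M.carrier →ₗ[𝒜.carrierᵐᵒᵖ] N.carrier) (j : ℤ)
    (hf : ∀ (i : ℤ) (m : M.carrier), m ∈ M.gr i → f m ∈ N.gr (i + j)) {x : M.carrier}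
    (hx : x ∈ M.plus.toSubmodule) : f x ∈ N.plus.toSubmodule := by
  have : M.plus.toSubmodule ≤ N.plus.toSubmodule.comap f := by
    refine Submodule.span_le.2 ?_
    rintro _ ⟨i, i', m, a, hm, ha, hi', rfl⟩
    exact Submodule.subset_span ⟨i + j, i', f m, a, hf i m hm, ha, hi', map_smul _ _ _⟩
  exact this hx

theorem mem_plus_of_gen {M : DGMod 𝒜} {n i : ℤ}
    (h : Submodule.span 𝒜.carrierᵐᵒᵖ (M.gr n : Set M.carrier) = ⊤) (hi : n < i) {x : M.carrier}
    (hx : x ∈ M.gr i) : x ∈ M.plus.toSubmodule := by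
  have : M.gr i ≤ M.plus.toSubmodule.toAddSubgroup := by
    refine (gr_le_of_gen h i).trans ((AddSubgroup.closure_le _).2 ?_)
    rintro _ ⟨m, hm, a, ha, rfl⟩
    exact Submodule.subset_span ⟨n, i - n, m, a, hm, ha, by omega, rfl⟩
  exact this hx

/-- Minimality, the reason for ordering the layers. An element of `E` has degree at least `n'`, so
its differential has degree greater than `n'`; there the bottom layer, being generated in degree
`n'`, lies in `K A⁺`. The component in `Q` is handled by induction. -/
theorem Sorted.d_mem_plus (hpos : ∀ i : ℤ, i < 0 → 𝒜.gr i = ⊥) {I : Set ℤ} {n : ℤ} {l : ℕ}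
    {M : DGMod 𝒜} (h : Sorted I n l M) (m : M.carrier) : M.d m ∈ M.plus.toSubmodule := by
  induction h with
  | zero h => rw [Subsingleton.elim (DGMod.d _ m) 0]; exact zero_mem _
  | @ext n n' l K E Q hn hI hK s hQ ih =>
    refine mem_of_gradeProj_mem E.isInternal (E.plus.toSubmodule.toAddSubgroup.comap E.d) m
      fun i => ?_
    have hm := gradeProj_mem E.isInternal i m
    generalize gradeProj E.gr E.isInternal i m = x at hm
    change E.d x ∈ E.plus.toSubmodule
    rcases lt_or_ge i n' with h | h
    · rw [(Sorted.ext le_rfl hI hK s hQ).gr_eq_bot hpos h, AddSubgroup.mem_bot] at hm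
      rw [hm, map_zero]
      exact zero_mem _
    · rw [← s.sum (E.d x), Hom.comm s.q]
      refine add_mem ?_ ?_
      · refine map_plus (Hom.toLin s.i) 0
          (fun i m hm => by rw [add_zero]; exact Hom.map_mem s.i hm) ?_
        exact mem_plus_of_gen hK.gen (by omega) (s.ρ_mem (E.d_mem hm))
      · exact map_plus s.σ 0 (fun i m hm => by rw [add_zero]; exact s.σ_mem hm) (ih _)

/-! ### Fitting decompositions -/

/-- An element of `M A⁺` of degree `i` is a combination of elements of degree less than `i`. As `M`
is bounded below and the elements killed by a power of `f` form a submodule, induction on the degree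
applies. The exponent may depend on `m`. -/
theorem exists_pow_apply_eq_zero (hpos : ∀ i : ℤ, i < 0 → 𝒜.gr i = ⊥) {M : DGMod 𝒜} {n : ℤ}
    (hM : ∀ i < n, M.gr i = ⊥) (f : Module.End 𝒜.carrierᵐᵒᵖ M.carrier)
    (hf : ∀ i, ∀ m ∈ M.gr i, f m ∈ M.gr i)
    (hf' : ∀ m, f m ∈ M.plus.toSubmodule) (m : M.carrier) : ∃ j, (f ^ j) m = 0 := by
  have mono : ∀ {j j' : ℕ} (_ : j ≤ j') {m : M.carrier}, (f ^ j) m = 0 → (f ^ j') m = 0 := by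
    intro j j' hj m hm
    obtain ⟨c, rfl⟩ := Nat.exists_eq_add_of_le' hj
    rw [pow_add, Module.End.mul_apply, hm, map_zero]
  let S : Submodule 𝒜.carrierᵐᵒᵖ M.carrier :=
    { carrier := {m | ∃ j, (f ^ j) m = 0}
      zero_mem' := ⟨0, map_zero _⟩
      add_mem' := by
        rintro x y ⟨j, hx⟩ ⟨j', hy⟩
        exact ⟨max j j', by
          rw [map_add, mono (le_max_left _ _) hx, mono (le_max_right _ _) hy, add_zero]⟩
      smul_mem' := by
        rintro r x ⟨j, hx⟩
        exact ⟨j, by rw [map_smul, hx, smul_zero]⟩ }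
  have key : ∀ (c : ℕ) (i : ℤ), i < n + c → ∀ m ∈ M.gr i, m ∈ S := by
    intro c
    induction c with
    | zero =>
      intro i hi m hm
      rw [hM i (by simpa using hi), AddSubgroup.mem_bot] at hm
      rw [hm]
      exact zero_mem S
    | succ c ih =>
      intro i hi m hm
      have h1 : ∀ x ∈ M.plus.toSubmodule, gradeProj M.gr M.isInternal i x ∈ S := by
        intro x hx
        change x ∈ Submodule.span _ _ at hx
        induction hx using Submodule.closure_induction with
        | zero => rw [map_zero]; exact zero_mem _
        | add x y _ _ hx hy => rw [map_add]; exact add_mem hx hy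
        | smul_mem r x hx =>
          obtain ⟨i', j, y, a, hy, ha, hj, rfl⟩ := hx
          have h2 := gradeProj_smul M (M.smul_mem hy ha) (i - (i' + j)) r.unop
          rw [add_sub_cancel, MulOpposite.op_unop] at h2
          rw [h2]
          have h3 := gradeProj_mem 𝒜.isInternal (i - (i' + j)) r.unop
          -- A coefficient of negative degree vanishes. Otherwise `i' ≤ i - j < i`, and the
          -- induction hypothesis covers `y`.
          rcases lt_or_ge (i - (i' + j)) 0 with h | h
          · have h4 : 𝒜.addGr (i - (i' + j)) = ⊥ := by
              rw [DGAlgebra.addGr, hpos _ h]; rfl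
            rw [h4, AddSubgroup.mem_bot] at h3
            rw [h3, MulOpposite.op_zero, zero_smul]
            exact zero_mem S
          · exact S.smul_mem _ (S.smul_mem _ (ih i' (by push_cast at hi; omega) y hy))
      have h2 := h1 _ (hf' m)
      rw [gradeProj_same _ (hf i m hm)] at h2
      obtain ⟨j, hj⟩ := h2
      exact ⟨j + 1, by rw [pow_succ, Module.End.mul_apply, hj]⟩
  refine mem_of_gradeProj_mem M.isInternal S.toAddSubgroup m fun i => ?_
  -- This bound makes `i < n + c`; for `i < n` the truncation gives `c = 0`, which is still
  -- sufficient.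
  exact key (i - n + 1).toNat i (by omega) _ (gradeProj_mem _ _ _)

/-- A morphism with values in a dg submodule, as a morphism into it. -/
def Sub.lift {N M : DGMod 𝒜} (V : Sub M) (f : N ⟶ M)
    (hf : ∀ x, Hom.toLin f x ∈ V.toSubmodule) : N ⟶ V.toDGMod where
  toLin := (Hom.toLin f).codRestrict V.toSubmodule hf
  map_mem h := Hom.map_mem f h
  comm m := Subtype.ext (Hom.comm f m)

/-- The projection onto a dg submodule along a complementary dg submodule. -/
def Sub.projection {M : DGMod 𝒜} (U V : Sub M) (h : IsCompl U.toSubmodule V.toSubmodule) :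
    M ⟶ U.toDGMod :=
  have key : ∀ (m : M.carrier) (f : M.carrier →+ M.carrier),
      (∀ x ∈ U.toSubmodule, f x ∈ U.toSubmodule) → (∀ x ∈ V.toSubmodule, f x ∈ V.toSubmodule) →
      (U.toSubmodule.projectionOnto V.toSubmodule h (f m) : M.carrier) =
        f (U.toSubmodule.projectionOnto V.toSubmodule h m) := fun m f hU hV => by
    obtain ⟨x, y, rfl⟩ : ∃ (x : U.toSubmodule) (y : V.toSubmodule), (x : M.carrier) + y = m := by
      have : m ∈ U.toSubmodule ⊔ V.toSubmodule := h.sup_eq_top ▸ trivial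
      obtain ⟨x, hx, y, hy, rfl⟩ := Submodule.mem_sup.1 this
      exact ⟨⟨x, hx⟩, ⟨y, hy⟩, rfl⟩
    have h1 := Submodule.projectionOnto_apply_left h ⟨f x, hU _ x.2⟩
    have h2 := Submodule.projectionOnto_apply_right h ⟨f y, hV _ y.2⟩
    simp only at h1 h2
    simp [h1, h2]
  { toLin := U.toSubmodule.projectionOnto V.toSubmodule h
    map_mem := fun {i m} hm => by
      have := key m (gradeProj M.gr M.isInternal i) (fun x hx => U.homogeneous x hx i)
        fun x hx => V.homogeneous x hx i
      rw [gradeProj_same _ hm] at this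
      change (U.toSubmodule.projectionOnto V.toSubmodule h m : M.carrier) ∈ M.gr i
      rw [this]
      exact gradeProj_mem _ _ _
    comm := fun m => Subtype.ext (key m M.d U.d_mem V.d_mem) }

@[simp] theorem Sub.incl_projection {M : DGMod 𝒜} (U V : Sub M) (h) :
    U.incl ≫ U.projection V h = 𝟙 _ :=
  hom_ext' fun x => Submodule.projectionOnto_apply_left h x

@[simp] theorem Sub.incl_projection_right {M : DGMod 𝒜} (U V : Sub M) (h) :
    V.incl ≫ U.projection V h = 0 :=
  hom_ext' fun x => Submodule.projectionOnto_apply_right h x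

theorem Sub.hom_ext_of_isCompl {M N : DGMod 𝒜} {U V : Sub M}
    (h : IsCompl U.toSubmodule V.toSubmodule) {f g : M ⟶ N} (hU : U.incl ≫ f = U.incl ≫ g)
    (hV : V.incl ≫ f = V.incl ≫ g) : f = g := hom_ext' fun m => by
  have hm : m ∈ U.toSubmodule ⊔ V.toSubmodule := h.sup_eq_top ▸ trivial
  obtain ⟨x, hx, y, hy, rfl⟩ := Submodule.mem_sup.1 hm
  rw [map_add, map_add]
  exact congrArg₂ (· + ·) (LinearMap.congr_fun (congrArg Hom.toLin hU) ⟨x, hx⟩)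
    (LinearMap.congr_fun (congrArg Hom.toLin hV) ⟨y, hy⟩)

/-- An endomorphism, as an element of the endomorphism ring of the underlying `A`-module. -/
abbrev Hom.toEnd {M : DGMod 𝒜} (g : M ⟶ M) : Module.End 𝒜.carrierᵐᵒᵖ M.carrier := Hom.toLin g

/-- The dg submodule of all elements annihilated by a power of an endomorphism. -/
def Sub.nilpotentPart {M : DGMod 𝒜} (g : M ⟶ M) : Sub M :=
  have hp : ∀ (f : M.carrier →+ M.carrier) (_ : ∀ m, f (Hom.toLin g m) = Hom.toLin g (f m)) (j : ℕ)
      (m : M.carrier), (Hom.toEnd g ^ j) (f m) =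
        f ((Hom.toEnd g ^ j) m) := fun f hf j => by
    induction j with
    | zero => intro m; rfl
    | succ j ih => intro m; rw [pow_succ, Module.End.mul_apply, Module.End.mul_apply, ← hf, ih]
  { toSubmodule :=
    { carrier := {m | ∃ j, (Hom.toEnd g ^ j) m = 0}
      zero_mem' := ⟨0, map_zero _⟩
      add_mem' := by
        rintro x y ⟨j, hx⟩ ⟨j', hy⟩
        refine ⟨j + j', ?_⟩
        rw [map_add, pow_add, Module.End.mul_apply _ _ y, hy, map_zero, add_zero, ← pow_add, add_comm,
          pow_add, Module.End.mul_apply, hx, map_zero]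
      smul_mem' := by
        rintro r x ⟨j, hx⟩
        exact ⟨j, by rw [map_smul, hx, smul_zero]⟩ }
    homogeneous := by
      rintro m ⟨j, hm⟩ i
      refine ⟨j, ?_⟩
      rw [hp _ (fun m => (Hom.map_gradeProj g i m).symm), hm, map_zero]
    d_mem := by
      rintro m ⟨j, hm⟩
      refine ⟨j, ?_⟩
      rw [hp _ (fun m => (Hom.comm g m).symm), hm, map_zero] }

theorem Sub.pow_apply_mem_nilpotentPart {M : DGMod 𝒜} {g : M ⟶ M} {m : M.carrier}
    (hm : m ∈ (Sub.nilpotentPart g).toSubmodule) (i : ℕ) :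
    (Hom.toEnd g ^ i) m ∈ (Sub.nilpotentPart g).toSubmodule := by
  obtain ⟨j, hj⟩ := hm
  refine ⟨j, ?_⟩
  rw [← Module.End.mul_apply, ← pow_add, add_comm, pow_add, Module.End.mul_apply, hj, map_zero]

/-- `1 - g` is invertible on the elements annihilated by a power of `g`. -/
theorem Sub.exists_isIso_nilpotentPart {M : DGMod 𝒜} (g : M ⟶ M) :
    ∃ a : (Sub.nilpotentPart g).toDGMod ⟶ (Sub.nilpotentPart g).toDGMod, IsIso a ∧
      a ≫ (Sub.nilpotentPart g).incl = (Sub.nilpotentPart g).incl ≫ (𝟙 M - g) := by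
  refine ⟨(Sub.nilpotentPart g).lift ((Sub.nilpotentPart g).incl ≫ (𝟙 M - g)) fun m => ?_,
    (isoOfBijective _ ⟨(injective_iff_map_eq_zero _).2 ?_, ?_⟩).isIso_hom, hom_ext' fun _ => rfl⟩
  · have := Sub.pow_apply_mem_nilpotentPart m.2 1
    rw [pow_one] at this
    exact sub_mem m.2 this
  · rintro ⟨x, j, hx⟩ h
    have h1 : x - Hom.toLin g x = 0 := congrArg Subtype.val h
    -- An element killed by `1 - g` is fixed by every power of `g`, one of which kills it.
    have h2 : ∀ i, (Hom.toEnd g ^ i) x = x := by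
      intro i
      induction i with
      | zero => rfl
      | succ i ih => rw [pow_succ, Module.End.mul_apply, ← sub_eq_zero.1 h1, ih]
    exact Subtype.ext ((h2 j).symm.trans hx)
  · rintro ⟨y, j, hy⟩
    -- The geometric series is finite on each element and provides the preimage under `1 - g`.
    have h1 := LinearMap.congr_fun (mul_neg_geom_sum (Hom.toEnd g) j) y
    refine ⟨⟨(∑ i ∈ Finset.range j, Hom.toEnd g ^ i) y, ?_⟩,
      Subtype.ext (h1.trans ?_)⟩
    · rw [LinearMap.sum_apply]
      exact sum_mem fun i _ => Sub.pow_apply_mem_nilpotentPart ⟨j, hy⟩ i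
    · rw [LinearMap.sub_apply, hy, sub_zero]
      rfl

/-- Fitting's lemma for a locally nilpotent `e (1 - e)`. Powers of `X` and `1 - X` are coprime, and
a Bézout identity evaluated at `e` splits every element into a part killed by a power of `1 - e` and
one killed by a power of `e`. -/
theorem isCompl_nilpotentPart {M : DGMod 𝒜} (e : M ⟶ M)
    (he : ∀ m, ∃ j, ((Hom.toEnd e * (1 - Hom.toEnd e)) ^ j : Module.End _ M.carrier) m = 0) :
    IsCompl (Sub.nilpotentPart (𝟙 M - e)).toSubmodule (Sub.nilpotentPart e).toSubmodule := by
  set E := Hom.toEnd e with hE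
  have hE' : Hom.toEnd (𝟙 M - e) = 1 - E := rfl
  have hcop : ∀ i j : ℕ, ∃ P Q : Module.End 𝒜.carrierᵐᵒᵖ M.carrier,
      Commute P E ∧ Commute Q E ∧ P * E ^ i + Q * (1 - E) ^ j = 1 := by
    intro i j
    have h : IsCoprime (Polynomial.X : Polynomial ℤ) (1 - Polynomial.X) := ⟨1, 1, by ring⟩
    obtain ⟨P, Q, hPQ⟩ := h.pow (m := i) (n := j)
    refine ⟨Polynomial.aeval E P, Polynomial.aeval E Q, ?_, ?_, ?_⟩
    · simpa using (Commute.all P Polynomial.X).map (Polynomial.aeval E)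
    · simpa using (Commute.all Q Polynomial.X).map (Polynomial.aeval E)
    · simpa using congrArg (Polynomial.aeval E) hPQ
  have hcomm : Commute E (1 - E) := (Commute.one_right E).sub_right (Commute.refl E)
  refine IsCompl.of_eq ?_ ?_
  · rw [eq_bot_iff]
    rintro x ⟨⟨j, hj⟩, ⟨i, hi⟩⟩
    obtain ⟨P, Q, -, -, h⟩ := hcop i j
    rw [hE'] at hj
    have := congrArg (fun f => f x) h
    simp only [LinearMap.add_apply, Module.End.mul_apply, hj, Module.End.one_apply] at this
    rw [hE, hi] at this
    simpa using this.symm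
  · rw [eq_top_iff]
    intro x _
    obtain ⟨j, hj⟩ := he x
    rw [hcomm.mul_pow] at hj
    obtain ⟨P, Q, hP, hQ, h⟩ := hcop j j
    have := congrArg (fun f => f x) h
    rw [Module.End.one_apply] at this
    rw [← this]
    refine Submodule.add_mem_sup ⟨j, ?_⟩ ⟨j, ?_⟩
    · rw [hE', ← Module.End.mul_apply]
      have hP' : Commute P ((1 - E) ^ j) := ((Commute.one_right P).sub_right hP).pow_right j
      rw [← mul_assoc, ← hP'.eq, mul_assoc, ← (hcomm.pow_pow j j).eq, Module.End.mul_apply, hj,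
        map_zero]
    · rw [← hE, ← Module.End.mul_apply, ← mul_assoc, ← (hQ.pow_right j).eq, mul_assoc,
        Module.End.mul_apply, hj, map_zero]

/-- Retracts in `dgHot` of sorted modules are homotopy equivalent to sorted modules. -/
theorem Sorted.exists_hotEquiv_of_retract (hpos : ∀ i : ℤ, i < 0 → 𝒜.gr i = ⊥) {I : Set ℤ} {n : ℤ}
    {l : ℕ} {M X : DGMod 𝒜} (hM : Sorted I n l M) (s : X ⟶ M) (t : M ⟶ X)
    (hst : Homotopic (s ≫ t) (𝟙 X)) : ∃ l' M', Sorted I n l' M' ∧ HotEquiv X M' := by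
  have hst' := toHot_map_eq_iff.2 hst
  rw [CategoryTheory.Functor.map_comp, CategoryTheory.Functor.map_id] at hst'
  set e := t ≫ s with he
  have hee : Homotopic (e ≫ e) e := toHot_map_eq_iff.1 (by
    simp only [he, CategoryTheory.Functor.map_comp, Category.assoc, reassoc_of% hst'])
  -- The difference `e - e²` is, up to sign, of the form `d h + h d`. Both terms land in `M A⁺` by
  -- minimality, so `e (1 - e)` is locally nilpotent although `e` is idempotent only up to homotopy.
  have hc := isCompl_nilpotentPart e (exists_pow_apply_eq_zero hpos
    (fun i hi => hM.gr_eq_bot hpos hi) (Hom.toEnd e * (1 - Hom.toEnd e))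
    (fun i m hm => Hom.map_mem e (sub_mem hm (Hom.map_mem e hm))) fun m => by
      obtain ⟨h, h1, h2⟩ := hee
      have h3 : Hom.toLin e (m - Hom.toLin e m) = -(M.d (h m) + h (M.d m)) := by
        rw [← h2, map_sub, toLin_comp_apply e, neg_sub]
      change Hom.toLin e (m - Hom.toLin e m) ∈ M.plus.toSubmodule
      rw [h3]
      exact neg_mem (add_mem (hM.d_mem_plus hpos _)
        (map_plus h (-1) (fun i m hm => h1 i m hm) (hM.d_mem_plus hpos _))))
  obtain ⟨a, hai, ha⟩ := Sub.exists_isIso_nilpotentPart (𝟙 M - e)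
  obtain ⟨b, hbi, hb⟩ := Sub.exists_isIso_nilpotentPart e
  rw [sub_sub_cancel] at ha
  generalize Sub.nilpotentPart (𝟙 M - e) = U at a hai ha hc
  generalize Sub.nilpotentPart e = V at b hbi hb hc
  obtain ⟨l', hU⟩ := hM.retract hpos U.incl (U.projection V hc) (U.incl_projection V hc)
  refine ⟨l', _, hU, ?_⟩
  have e1 := U.incl_projection V hc
  have e2 := U.incl_projection_right V hc
  have e3 := V.incl_projection U hc.symm
  have e4 := V.incl_projection_right U hc.symm
  have ha' : (U.incl ≫ t) ≫ (s ≫ U.projection V hc) = a := by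
    have : (U.incl ≫ t) ≫ (s ≫ U.projection V hc) = (U.incl ≫ e) ≫ U.projection V hc := by
      simp only [he, Category.assoc]
    rw [this, ← ha, Category.assoc, U.incl_projection, Category.comp_id]
  have hb' : (𝟙 M - e) ≫ V.projection U hc.symm = V.projection U hc.symm ≫ b := by
    refine Sub.hom_ext_of_isCompl hc ?_ ?_
    · rw [Preadditive.sub_comp, Preadditive.comp_sub, Category.id_comp, ← reassoc_of% ha]
      simp [reassoc_of% e4]
    · rw [← reassoc_of% hb, e3, reassoc_of% e3, Category.comp_id]
  -- Since `1 - e` is invertible on `V`, the projector onto `V` factors through `1 - e`, which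
  -- becomes zero in `dgHot` after precomposition with `s`.
  have hb'' : 𝟙 M - U.projection V hc ≫ U.incl =
      (𝟙 M - e) ≫ V.projection U hc.symm ≫ inv b ≫ V.incl := by
    rw [reassoc_of% hb', IsIso.hom_inv_id_assoc]
    refine Sub.hom_ext_of_isCompl hc ?_ ?_ <;>
      simp [Preadditive.comp_sub, reassoc_of% e1, reassoc_of% e2, reassoc_of% e3, reassoc_of% e4]
  -- Hence discarding `V` does not change the composite `s ≫ t`, which is the identity of `X` in
  -- `dgHot`.
  have h1 : (toHot 𝒜).map (s ≫ U.projection V hc) ≫ (toHot 𝒜).map (U.incl ≫ t) = 𝟙 _ := by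
    have h2 := congrArg (fun f => (toHot 𝒜).map s ≫ (toHot 𝒜).map f ≫ (toHot 𝒜).map t) hb''
    simp only [CategoryTheory.Functor.map_sub, CategoryTheory.Functor.map_comp,
      CategoryTheory.Functor.map_id, Preadditive.sub_comp, Preadditive.comp_sub, he, hst',
      Category.assoc, Category.id_comp, reassoc_of% hst', sub_self] at h2
    simp only [CategoryTheory.Functor.map_comp, Category.assoc]
    exact (sub_eq_zero.1 h2).symm
  have h2 := congrArg (toHot 𝒜).map ha'
  rw [CategoryTheory.Functor.map_comp] at h2
  refine ⟨⟨(toHot 𝒜).map (s ≫ U.projection V hc), (toHot 𝒜).map (U.incl ≫ t), h1, ?_⟩⟩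
  -- The other composite is the class of `a`: it is idempotent by `h1` and invertible, hence the
  -- identity.
  rw [← cancel_mono ((toHot 𝒜).map a), Category.id_comp]
  rw [← h2]
  rw [Category.assoc, reassoc_of% h1]

end DGMod

/-! ### The modules `L̂` and `𝒜` are free -/

section HatFree

variable {L : Type u} [AddCommGroup L] [Module 𝒜.zeroPartᵐᵒᵖ L]

/-- Balanced biadditive maps on `A × L` induce additive maps on `L ⊗_{A^0} A`. -/
def hatLift {X : Type*} [AddCommGroup X] (f : 𝒜.carrier →+ L →+ X)
    (hf : ∀ (b : 𝒜.zeroPart) (a : 𝒜.carrier) (l : L), f ((b : 𝒜.carrier) * a) l = f a (l <• b)) :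
    HatCarrier 𝒜 L →+ X :=
  quotLift (hatRel 𝒜 L) (TensorProduct.liftAddHom f fun n a l => by
    rw [map_zsmul, map_zsmul, AddMonoidHom.zsmul_apply]) <| by
      intro x hx
      induction hx using Submodule.closure_induction with
      | zero => rw [map_zero]
      | add x y _ _ hx hy => rw [map_add, hx, hy, add_zero]
      | smul_mem r x hx =>
        obtain ⟨b, a, l, rfl⟩ := hx
        have h1 : r • (((b : 𝒜.carrier) * a) ⊗ₜ[ℤ] l - a ⊗ₜ[ℤ] (l <• b)) =
            ((b : 𝒜.carrier) * (a * r.unop)) ⊗ₜ[ℤ] l - (a * r.unop) ⊗ₜ[ℤ] (l <• b) := by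
          rw [smul_sub, TensorProduct.smul_tmul', TensorProduct.smul_tmul', ← mul_assoc]
          rfl
        rw [h1, map_sub, TensorProduct.liftAddHom_tmul, TensorProduct.liftAddHom_tmul, hf, sub_self]

theorem hatMk_smul_left (l : L) (b : 𝒜.zeroPart) (a : 𝒜.carrier) :
    hatMk (l <• b) a = hatMk l ((b : 𝒜.carrier) * a) := by
  have h : ((b : 𝒜.carrier) * a) ⊗ₜ[ℤ] l - a ⊗ₜ[ℤ] (l <• b) ∈ hatRel 𝒜 L :=
    Submodule.subset_span ⟨b, a, l, rfl⟩
  exact ((Submodule.Quotient.eq _).2 h).symm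

theorem hatMk_add_left (l l' : L) (a : 𝒜.carrier) :
    hatMk (l + l') a = hatMk l a + hatMk l' a :=
  congrArg (hatRel 𝒜 L).mkQ (TensorProduct.tmul_add a l l')

/-- The projection of `A` onto `A^0`. -/
def zeroProj (𝒜 : DGAlgebra.{u} k) : 𝒜.carrier →+ 𝒜.zeroPart where
  toFun a := ⟨gradeProj 𝒜.addGr 𝒜.isInternal 0 a, gradeProj_mem 𝒜.isInternal 0 a⟩
  map_zero' := Subtype.ext (map_zero _)
  map_add' _ _ := Subtype.ext (map_add _ _ _)

theorem zeroProj_coe (b : 𝒜.zeroPart) : zeroProj 𝒜 (b : 𝒜.carrier) = b :=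
  Subtype.ext (gradeProj_same 𝒜.isInternal b.2)

theorem zeroProj_mul (b : 𝒜.zeroPart) (a : 𝒜.carrier) :
    zeroProj 𝒜 ((b : 𝒜.carrier) * a) = b * zeroProj 𝒜 a :=
  Subtype.ext (selfProj_mul 0 (b : 𝒜.carrier) b.2 a)

/-- The map `L̂ → L` sending `l ⊗ a` to `l a_0`. -/
def hatToBase : HatCarrier 𝒜 L →+ L :=
  hatLift
    { toFun := fun a => DistribSMul.toAddMonoidHom L (MulOpposite.op (zeroProj 𝒜 a))
      map_zero' := by
        ext l
        rw [map_zero]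
        exact zero_smul 𝒜.zeroPartᵐᵒᵖ l
      map_add' := fun a b => by ext l; simp [add_smul] }
    fun b a l => by
      simp [zeroProj_mul, mul_smul]

@[simp] theorem hatToBase_mk (l : L) (a : 𝒜.carrier) :
    hatToBase (hatMk l a) = l <• zeroProj 𝒜 a := rfl

theorem hatMk_hatToBase {x : HatCarrier 𝒜 L} (hx : x ∈ AddSubgroup.closure
    {x : HatCarrier 𝒜 L | ∃ (l : L) (a : 𝒜.carrier), a ∈ 𝒜.gr 0 ∧ x = hatMk l a}) :
    hatMk (hatToBase x) 1 = x := by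
  induction hx using AddSubgroup.closure_induction with
  | mem x hx =>
    obtain ⟨l, a, ha, rfl⟩ := hx
    rw [hatToBase_mk, hatMk_smul_left, mul_one]
    exact congrArg (fun b : 𝒜.zeroPart => hatMk l (b : 𝒜.carrier)) (zeroProj_coe ⟨a, ha⟩)
  | zero => rw [map_zero]; exact congrArg (hatRel 𝒜 L).mkQ (TensorProduct.tmul_zero _ _)
  | add x y _ _ hx hy => rw [map_add, hatMk_add_left, hx, hy]
  | neg x _ hx =>
    rw [map_neg]
    nth_rw 2 [← hx]
    exact congrArg (hatRel 𝒜 L).mkQ (TensorProduct.tmul_neg _ _)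

variable (L) (hd : ∀ a ∈ 𝒜.gr 0, 𝒜.d a = 0)

theorem hatMk_mem (l : L) {i : ℤ} {a : 𝒜.carrier} (ha : a ∈ 𝒜.gr i) :
    (hatMk l a : (hat L hd).carrier) ∈ (hat L hd).gr i :=
  AddSubgroup.subset_closure ⟨l, a, ha, rfl⟩

theorem one_mem_gr_zero : (1 : 𝒜.carrier) ∈ 𝒜.gr 0 := SetLike.GradedOne.one_mem

/-- The degree zero part of `L̂` is `L`. -/
def hatZeroEquiv : L ≃ₗ[𝒜.zeroPartᵐᵒᵖ] (hat L hd).gr 0 where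
  toFun l := ⟨hatMk l 1, hatMk_mem L hd l one_mem_gr_zero⟩
  map_add' l l' := Subtype.ext (hatMk_add_left l l' 1)
  map_smul' r l := Subtype.ext (by
    refine (hatMk_smul_left l r.unop 1).trans ?_
    rw [mul_one, coe_gr_smul]
    refine Eq.trans ?_ (hatMk_smul l 1 _).symm
    rw [one_mul]
    rfl)
  invFun x := hatToBase x.1
  left_inv l := by
    change hatToBase (hatMk l (1 : 𝒜.carrier)) = l
    have : zeroProj 𝒜 1 = 1 := zeroProj_coe 1
    rw [hatToBase_mk, this, MulOpposite.op_one, one_smul]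
  right_inv x := Subtype.ext (hatMk_hatToBase x.2)

namespace DGMod

/-- The universal property is the adjunction between extension and restriction of scalars along `A^0
→ A`. The generators `l ⊗ 1` are cocycles because `d` vanishes on `A^0`. -/
theorem freeOn_hat : FreeOn 0 (hat L hd) where
  gen := by
    rw [eq_top_iff]
    rintro (x : HatCarrier 𝒜 L) -
    induction x using hat_induction with
    | h0 => exact zero_mem _
    | hadd x y hx hy => exact add_mem hx hy
    | hmk l a =>
      have h0 : (hatMk l 1 : (hat L hd).carrier) ∈ ((hat L hd).gr 0 : Set (hat L hd).carrier) :=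
        hatMk_mem L hd l one_mem_gr_zero
      have h1 := Submodule.smul_mem (Submodule.span 𝒜.carrierᵐᵒᵖ _)
        (MulOpposite.op a) (Submodule.subset_span h0)
      have h2 : (hatMk l (1 : 𝒜.carrier)) <• a = hatMk l a := by rw [hatMk_smul, one_mul]
      rw [← h2]
      exact h1
  d_zero m hm := by
    change m ∈ AddSubgroup.closure _ at hm
    induction hm using AddSubgroup.closure_induction with
    | mem x hx =>
      obtain ⟨l, a, ha, rfl⟩ := hx
      change hatMk l (𝒜.d a) = 0
      rw [hd a ha]
      exact map_zero (hatMkHom l)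
    | zero => rw [map_zero]
    | add x y _ _ hx hy => rw [map_add, hx, hy, add_zero]
    | neg x _ hx => exact (map_neg (hat L hd).d x).trans ((congrArg _ hx).trans neg_zero)
  lift X _ _ φ hφ := by
    let e := hatZeroEquiv L hd
    let F : HatCarrier 𝒜 L →+ X := hatLift
      { toFun := fun a => (DistribSMul.toAddMonoidHom X (MulOpposite.op a)).comp
          (φ.comp e.toLinearMap.toAddMonoidHom)
        map_zero' := by ext l; simp
        map_add' := fun a b => by ext l; simp [add_smul] }
      fun b a l => by
        change φ (e l) <• ((b : 𝒜.carrier) * a) = φ (e (l <• b)) <• a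
        rw [map_smul, hφ, MulOpposite.op_mul, mul_smul]
    have hF : ∀ l a, F (hatMk l a) = φ (e l) <• a := fun _ _ => rfl
    refine ⟨({ F with
      map_smul' := fun r x => ?_ } : HatCarrier 𝒜 L →ₗ[𝒜.carrierᵐᵒᵖ] X), fun m => ?_⟩
    · change F (r • x) = r • F x
      induction x using hat_induction with
      | h0 => simp
      | hadd x y hx hy => rw [smul_add, map_add, hx, hy, map_add, smul_add]
      | hmk l a =>
        have h1 : r • (hatMk l a : HatCarrier 𝒜 L) = hatMk l (a * r.unop) := hatMk_smul l a r.unop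
        rw [h1, hF, hF, MulOpposite.op_mul, mul_smul, MulOpposite.op_unop]
    · obtain ⟨l, rfl⟩ := e.surjective m
      change F (hatMk l 1) = φ (e l)
      rw [hF, MulOpposite.op_one, one_smul]

theorem isHat_hat [IsSimpleModule 𝒜.zeroPartᵐᵒᵖ L] : IsHat 0 (hat L hd) :=
  ⟨freeOn_hat L hd, IsSimpleModule.congr (hatZeroEquiv L hd).symm⟩

theorem FreeOn.nonempty_iso {n : ℤ} {K N : DGMod 𝒜} (hK : FreeOn n K) (hN : FreeOn n N)
    (e : K.gr n ≃ₗ[𝒜.zeroPartᵐᵒᵖ] N.gr n) : Nonempty (K ≅ N) := by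
  obtain ⟨f, hf⟩ := hK.exists_hom e.toLinearMap fun m => hN.d_zero _ (e m).2
  have : Hom.deg f n = e.toLinearMap := LinearMap.ext fun m => Subtype.ext (hf m)
  have := hK.isIso hN f (by rw [this]; exact e.bijective)
  exact ⟨asIso f⟩

theorem FreeOn.nonempty_iso_hat {K : DGMod 𝒜} (hK : FreeOn 0 K)
    (e : K.gr 0 ≃ₗ[𝒜.zeroPartᵐᵒᵖ] L) : Nonempty (K ≅ hat L hd) :=
  hK.nonempty_iso (freeOn_hat L hd) (e.trans (hatZeroEquiv L hd))

theorem freeOn_self (hd : ∀ a ∈ 𝒜.gr 0, 𝒜.d a = 0) : FreeOn 0 (self 𝒜) where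
  gen := by
    rw [eq_top_iff]
    rintro (x : 𝒜.carrier) -
    have h1 := Submodule.smul_mem
      (Submodule.span 𝒜.carrierᵐᵒᵖ ((self 𝒜).gr 0 : Set (self 𝒜).carrier))
      (MulOpposite.op x) (Submodule.subset_span (one_mem_gr_zero (𝒜 := 𝒜)))
    have h2 : (1 : 𝒜.carrier) <• x = x := one_mul x
    rw [← h2]
    exact h1
  d_zero := hd
  lift X _ _ φ hφ := by
    let o : (self 𝒜).gr 0 := ⟨(1 : 𝒜.carrier), one_mem_gr_zero⟩
    refine ⟨({ toFun := fun a => φ o <• a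
               map_add' := fun a b => by rw [MulOpposite.op_add, add_smul]
               map_smul' := fun r a => by
                change φ o <• (a * r.unop) = r • (φ o <• a)
                rw [MulOpposite.op_mul, mul_smul, MulOpposite.op_unop] } :
      𝒜.carrier →ₗ[𝒜.carrierᵐᵒᵖ] X), fun m => ?_⟩
    have h1 := hφ ⟨m.1, m.2⟩ o
    exact h1.symm.trans (congrArg φ (Subtype.ext (one_mul (M := 𝒜.carrier) m.1)))

/-! ### Free modules are sorted -/

/-- A split short exact sequence of `A^0`-modules extends to free dg modules. -/
theorem FreeOn.nonempty_splitExt {n : ℤ} {K E Q : DGMod 𝒜} (hK : FreeOn n K) (hE : FreeOn n E)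
    (hQ : FreeOn n Q) (i : K.gr n →ₗ[𝒜.zeroPartᵐᵒᵖ] E.gr n) (q : E.gr n →ₗ[𝒜.zeroPartᵐᵒᵖ] Q.gr n)
    (ρ : E.gr n →ₗ[𝒜.zeroPartᵐᵒᵖ] K.gr n) (σ : Q.gr n →ₗ[𝒜.zeroPartᵐᵒᵖ] E.gr n)
    (h₁ : ∀ x, ρ (i x) = x) (h₂ : ∀ x, q (σ x) = x) (h₃ : ∀ x, i (ρ x) + σ (q x) = x) :
    Nonempty (SplitExt K E Q) := by
  obtain ⟨i', hi⟩ := hK.exists_hom i fun m => hE.d_zero _ (i m).2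
  obtain ⟨q', hq⟩ := hE.exists_hom q fun m => hQ.d_zero _ (q m).2
  obtain ⟨ρ', hρ⟩ := hE.exists_hom ρ fun m => hK.d_zero _ (ρ m).2
  obtain ⟨σ', hσ⟩ := hQ.exists_hom σ fun m => hE.d_zero _ (σ m).2
  have e₁ : i' ≫ ρ' = 𝟙 K := hK.hom_ext fun m hm => by
    rw [toLin_comp_apply, hi ⟨m, hm⟩, hρ, h₁]; rfl
  have e₂ : σ' ≫ q' = 𝟙 Q := hQ.hom_ext fun m hm => by
    rw [toLin_comp_apply, hσ ⟨m, hm⟩, hq, h₂]; rfl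
  have e₃ : ρ' ≫ i' + q' ≫ σ' = 𝟙 E := hE.hom_ext fun m hm => by
    rw [toLin_add, LinearMap.add_apply, toLin_comp_apply, toLin_comp_apply, hρ ⟨m, hm⟩,
      hq ⟨m, hm⟩, hi, hσ]
    exact congrArg Subtype.val (h₃ ⟨m, hm⟩)
  exact ⟨{
    i := i'
    q := q'
    ρ := Hom.toLin ρ'
    σ := Hom.toLin σ'
    ρ_mem := Hom.map_mem ρ'
    σ_mem := Hom.map_mem σ'
    ρ_i := fun x => LinearMap.congr_fun (congrArg Hom.toLin e₁) x
    q_σ := fun x => LinearMap.congr_fun (congrArg Hom.toLin e₂) x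
    sum := fun x => LinearMap.congr_fun (congrArg Hom.toLin e₃) x }⟩

/-- A composition series of the generating `A^0`-module induces the filtration. The induction runs
over an abstract copy `V` of `K^0`, so that `K` can vary with it. -/
theorem FreeOn.exists_sorted (hss : IsSemisimpleRing 𝒜.zeroPart)
    (hd : ∀ a ∈ 𝒜.gr 0, 𝒜.d a = 0) {V : Type u} [AddCommGroup V] [Module 𝒜.zeroPartᵐᵒᵖ V]
    (hV : IsFiniteLength 𝒜.zeroPartᵐᵒᵖ V) {K : DGMod 𝒜} (hK : FreeOn 0 K)
    (e : K.gr 0 ≃ₗ[𝒜.zeroPartᵐᵒᵖ] V) : ∃ l, Sorted {0} 0 l K := by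
  induction hV generalizing K with
  | of_subsingleton =>
    have := e.toEquiv.subsingleton
    have h1 : LinearMap.id (R := 𝒜.carrierᵐᵒᵖ) (M := K.carrier) = 0 :=
      linearMap_ext_of_gen hK.gen fun m hm =>
        congrArg Subtype.val (Subsingleton.elim (⟨m, hm⟩ : K.gr 0) 0)
    exact ⟨0, .zero ⟨fun x y => (LinearMap.congr_fun h1 x).trans (LinearMap.congr_fun h1 y).symm⟩⟩
  | @of_simple_quotient V _ _ N _ _ ih =>
    -- The series provides a simple quotient `V / N`, whereas a sorted module peels off a simple
    -- sub. Semisimplicity allows a complement `C ≅ V / N` to serve as the bottom layer, with `N` as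
    -- quotient.
    obtain ⟨C, hC⟩ := exists_isCompl N
    have : IsSimpleModule 𝒜.zeroPartᵐᵒᵖ C :=
      IsSimpleModule.congr (Submodule.quotientEquivOfIsCompl N C hC).symm
    obtain ⟨l, hl⟩ := ih (freeOn_hat N hd) (hatZeroEquiv N hd).symm
    let eC := hatZeroEquiv C hd
    let eN := hatZeroEquiv N hd
    obtain ⟨s⟩ := (freeOn_hat C hd).nonempty_splitExt hK (freeOn_hat N hd)
      (e.symm.toLinearMap.comp (C.subtype.comp eC.symm.toLinearMap))
      (eN.toLinearMap.comp ((N.projectionOnto C hC).comp e.toLinearMap))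
      (eC.toLinearMap.comp ((C.projectionOnto N hC.symm).comp e.toLinearMap))
      (e.symm.toLinearMap.comp (N.subtype.comp eN.symm.toLinearMap))
      (fun x => by simp) (fun x => by simp) (fun x => by
        apply e.injective
        simp only [LinearMap.comp_apply, LinearEquiv.coe_coe, map_add, e.apply_symm_apply,
          LinearEquiv.symm_apply_apply]
        obtain ⟨y, hy, z, hz, h⟩ := Submodule.mem_sup.1
          (show e x ∈ N ⊔ C from hC.sup_eq_top ▸ trivial)
        rw [← h]
        have h1 := Submodule.projectionOnto_apply_left hC ⟨y, hy⟩
        have h2 := Submodule.projectionOnto_apply_right hC ⟨z, hz⟩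
        have h3 := Submodule.projectionOnto_apply_right hC.symm ⟨y, hy⟩
        have h4 := Submodule.projectionOnto_apply_left hC.symm ⟨z, hz⟩
        simp only at h1 h2 h3 h4
        simp [h1, h2, h3, h4, add_comm])
    exact ⟨_, .ext le_rfl rfl (isHat_hat C hd) s hl⟩

theorem exists_sorted_self (hss : IsSemisimpleRing 𝒜.zeroPart)
    (hd : ∀ a ∈ 𝒜.gr 0, 𝒜.d a = 0) : ∃ l, Sorted {0} 0 l (self 𝒜) := by
  let f : 𝒜.zeroPartᵐᵒᵖ →ₗ[𝒜.zeroPartᵐᵒᵖ] (self 𝒜).gr 0 :=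
    LinearMap.toSpanSingleton _ _ ⟨(1 : 𝒜.carrier), one_mem_gr_zero⟩
  have hf : Function.Surjective f := fun x =>
    ⟨MulOpposite.op ⟨x.1, x.2⟩, Subtype.ext (one_mul (M := 𝒜.carrier) x.1)⟩
  have h1 : IsFiniteLength 𝒜.zeroPartᵐᵒᵖ 𝒜.zeroPartᵐᵒᵖ :=
    (IsSemisimpleModule.finite_tfae.out 0 3).1
      (inferInstance : Module.Finite 𝒜.zeroPartᵐᵒᵖ 𝒜.zeroPartᵐᵒᵖ)
  exact (freeOn_self hd).exists_sorted hss hd (h1.of_surjective hf) (LinearEquiv.refl _ _)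

end DGMod

end HatFree

namespace DGMod

/-! ### Perfect modules are homotopy equivalent to sorted modules -/

theorem Sorted.of_subset {I J : Set ℤ} (hIJ : I ⊆ J) {n : ℤ} {l : ℕ} {M : DGMod 𝒜}
    (h : Sorted I n l M) : Sorted J n l M := by
  induction h with
  | zero h => exact .zero h
  | ext hn hI hK s hQ ih => exact .ext hn (hIJ hI) hK s ih

variable (𝒜) in
/-- The property of being homotopy equivalent to a sorted module. -/
def hotSorted : ObjectProperty (DGHot 𝒜) := fun X => IsHotSorted X.as

/-- As `dgPer` is the smallest such subcategory, this gives every perfect module a sorted model. -/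
theorem isThickContainingSelf_hotSorted (hpos : ∀ i : ℤ, i < 0 → 𝒜.gr i = ⊥)
    (hss : IsSemisimpleRing 𝒜.zeroPart) (hd : ∀ a ∈ 𝒜.gr 0, 𝒜.d a = 0) :
    IsThickContainingSelf 𝒜 (hotSorted 𝒜) where
  iso := ⟨by
    rintro X Y e ⟨n, l, G, hG, h⟩
    exact ⟨n, l, G, hG, HotEquiv.trans (M := Y.as) (N := X.as) ⟨e.symm⟩ h⟩⟩
  shift := by
    rintro n M ⟨m, l, G, hG, h⟩
    exact ⟨m - n, l, G.shift n, hG.shift n, h.shift n⟩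
  cone f hM hN := IsHotSorted.cone hpos f hM hN
  summand := ⟨by
    rintro X Y r ⟨n, l, G, hG, ⟨e⟩⟩
    obtain ⟨s, hs⟩ := (toHot 𝒜).map_surjective (X := X.as) (Y := G) (r.i ≫ e.hom)
    obtain ⟨t, ht⟩ := (toHot 𝒜).map_surjective (X := G) (Y := X.as) (e.inv ≫ r.r)
    obtain ⟨l', M', hM', h⟩ := hG.exists_hotEquiv_of_retract hpos s t (toHot_map_eq_iff.1 (by
      rw [Functor.map_comp, hs, ht, Category.assoc, e.hom_inv_id_assoc, r.retract]
      exact ((toHot 𝒜).map_id X.as).symm))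
    exact ⟨n, l', M', hM', h⟩⟩
  self := by
    obtain ⟨l, h⟩ := exists_sorted_self hss hd
    exact ⟨0, l, _, h.of_subset (Set.subset_univ _), .refl _⟩

/-! ### Sorted modules concentrated in degree zero are perfect -/

theorem dgPer_of_hotEquiv {M N : DGMod 𝒜} (h : HotEquiv M N) (hN : dgPer 𝒜 ((toHot 𝒜).obj N)) :
    dgPer 𝒜 ((toHot 𝒜).obj M) := fun P hP => by
  obtain ⟨e⟩ := h
  exact hP.iso.of_iso e.symm (hN P hP)

theorem dgPer_of_retract {M N : DGMod 𝒜} (i : M ⟶ N) (r : N ⟶ M) (h : i ≫ r = 𝟙 M)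
    (hN : dgPer 𝒜 ((toHot 𝒜).obj N)) : dgPer 𝒜 ((toHot 𝒜).obj M) := fun P hP =>
  hP.summand.of_retract ((⟨i, r, h⟩ : Retract M N).map (toHot 𝒜)) (hN P hP)

theorem dgPer_self : dgPer 𝒜 ((toHot 𝒜).obj (self 𝒜)) := fun _ hP => hP.self

theorem SplitExt.dgPer {K E Q : DGMod 𝒜} (s : SplitExt K E Q)
    (hK : dgPer 𝒜 ((toHot 𝒜).obj K)) (hQ : dgPer 𝒜 ((toHot 𝒜).obj Q)) :
    dgPer 𝒜 ((toHot 𝒜).obj E) :=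
  dgPer_of_hotEquiv (.of_iso s.isoCone) fun P hP =>
    hP.cone _ (hP.shift _ _ (hQ P hP)) (hK P hP)

/-- A simple module over the semisimple ring `A^0` is projective and cyclic, hence a summand of
`A^0`. By freeness the splitting extends to `A`, so `K` is a retract of `𝒜` already in `dgMod`. -/
theorem IsHat.dgPer (hss : IsSemisimpleRing 𝒜.zeroPart) (hd : ∀ a ∈ 𝒜.gr 0, 𝒜.d a = 0)
    {K : DGMod 𝒜} (hK : IsHat 0 K) : dgPer 𝒜 ((toHot 𝒜).obj K) := by
  obtain ⟨x, hx, hx0⟩ := hK.exists_ne_zero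
  have := hK.simple
  let φ : (self 𝒜).gr 0 →ₗ[𝒜.zeroPartᵐᵒᵖ] K.gr 0 :=
    { toFun := fun a => ⟨x <• (show 𝒜.carrier from a.1), smul_mem_gr K hx ⟨a.1, a.2⟩⟩
      map_add' := fun a b => Subtype.ext
        ((congrArg (· • x) (MulOpposite.op_add (α := 𝒜.carrier) a.1 b.1)).trans (add_smul _ _ _))
      map_smul' := fun r a => Subtype.ext
        ((congrArg (· • x) (MulOpposite.op_mul (α := 𝒜.carrier) a.1 r.unop.1)).trans
          (mul_smul _ _ _)) }
  have hφ : Function.Surjective φ := by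
    refine LinearMap.surjective_of_ne_zero fun h => hx0 ?_
    have h1 := congrArg Subtype.val (LinearMap.congr_fun h ⟨(1 : 𝒜.carrier), one_mem_gr_zero⟩)
    exact (one_smul 𝒜.carrierᵐᵒᵖ x).symm.trans h1
  have : Module.Projective 𝒜.zeroPartᵐᵒᵖ (K.gr 0) := Module.projective_of_isSemisimpleRing _ _
  obtain ⟨ψ, hψ⟩ := Module.projective_lifting_property φ LinearMap.id hφ
  obtain ⟨f, hf⟩ := (freeOn_self hd).exists_hom φ fun m => hK.d_zero _ (φ m).2
  obtain ⟨g, hg⟩ := hK.exists_hom ψ fun m => (freeOn_self hd).d_zero _ (ψ m).2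
  refine dgPer_of_retract g f (hK.hom_ext fun m hm => ?_) dgPer_self
  rw [toLin_comp_apply, hg ⟨m, hm⟩, hf]
  exact congrArg Subtype.val (LinearMap.congr_fun hψ ⟨m, hm⟩)

theorem Sorted.dgPer (hss : IsSemisimpleRing 𝒜.zeroPart) (hd : ∀ a ∈ 𝒜.gr 0, 𝒜.d a = 0)
    {n : ℤ} {l : ℕ} {M : DGMod 𝒜} (h : Sorted {0} n l M) : dgPer 𝒜 ((toHot 𝒜).obj M) := by
  induction h with
  | zero h => exact dgPer_of_retract 0 0 (hom_ext' fun _ => Subsingleton.elim _ _) dgPer_self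
  | ext hn hI hK s hQ ih =>
    obtain rfl : _ = (0 : ℤ) := hI
    exact s.dgPer (hK.dgPer hss hd) ih

/-! ### Cohomology of the reduction -/

theorem mem_cohomologySupport {M : DGMod 𝒜} {i : ℤ} : i ∈ M.cohomologySupport ↔
    ∃ z ∈ M.gr i, M.d z = 0 ∧ ∀ y ∈ M.gr (i - 1), M.d y ≠ z := by
  change Nontrivial (_ ⧸ _) ↔ _
  rw [QuotientAddGroup.nontrivial_iff]
  constructor
  · intro h
    obtain ⟨z, hz⟩ := not_forall.1 (mt (AddSubgroup.eq_top_iff' _).2 h)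
    exact ⟨z, z.2.1, z.2.2, fun y hy hyz => hz ⟨y, hy, hyz⟩⟩
  · rintro ⟨z, hz, hdz, hy⟩ h
    obtain ⟨y, hy', hyz⟩ := (AddSubgroup.eq_top_iff' _).1 h ⟨z, hz, hdz⟩
    exact hy y hy' hyz

/-- A one-sided inverse up to homotopy suffices: if `f z = d y` for a cocycle `z`, then `z = d (g y
+ h z)`. -/
theorem cohomologySupport_subset {M N : DGMod 𝒜} (f : M ⟶ N) (g : N ⟶ M)
    (h : Homotopic (𝟙 M) (f ≫ g)) : M.cohomologySupport ⊆ N.cohomologySupport := by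
  obtain ⟨h, h1, h2⟩ := h
  intro i hi
  obtain ⟨z, hz, hdz, hy⟩ := mem_cohomologySupport.1 hi
  refine mem_cohomologySupport.2 ⟨Hom.toLin f z, Hom.map_mem f hz, ?_, fun y hy' hyz => ?_⟩
  · rw [← Hom.comm, hdz, map_zero]
  · refine hy (Hom.toLin g y + h z) (add_mem (Hom.map_mem g hy') (h1 i z hz)) ?_
    have h3 := h2 z
    rw [hdz, map_zero, add_zero, toLin_comp_apply, ← hyz, Hom.comm g] at h3
    rw [map_add, ← h3]
    exact add_sub_cancel _ _

/-- The morphism induced on reductions. -/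
def barMap {M N : DGMod 𝒜} (f : M ⟶ N) : M.bar ⟶ N.bar :=
  M.plus.desc (f ≫ N.plus.proj) fun _ hx => (Sub.proj_eq_zero _).2
    (map_plus (Hom.toLin f) 0 (fun i _ hm => (add_zero i).symm ▸ Hom.map_mem f hm) hx)

theorem barMap_id (M : DGMod 𝒜) : barMap (𝟙 M) = 𝟙 M.bar := hom_ext' fun x => by
  obtain ⟨x, rfl⟩ := M.plus.proj_surjective x
  rfl

theorem barMap_comp {M N P : DGMod 𝒜} (f : M ⟶ N) (g : N ⟶ P) :
    barMap (f ≫ g) = barMap f ≫ barMap g := hom_ext' fun x => by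
  obtain ⟨x, rfl⟩ := M.plus.proj_surjective x
  rfl

theorem Homotopic.bar {M N : DGMod 𝒜} {f g : M ⟶ N} (h : Homotopic f g) :
    Homotopic (barMap f) (barMap g) := by
  obtain ⟨h, h1, h2⟩ := h
  refine ⟨M.plus.toSubmodule.mapQ N.plus.toSubmodule h
    fun x hx => map_plus h (-1) h1 hx, ?_, fun x => ?_⟩
  · rintro i _ ⟨m, hm, rfl⟩
    exact ⟨h m, h1 i m hm, rfl⟩
  · obtain ⟨x, rfl⟩ := M.plus.proj_surjective x
    exact congrArg (Hom.toLin N.plus.proj) (h2 x)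

theorem HotEquiv.cohomologySupport_bar_subset {M N : DGMod 𝒜} (h : HotEquiv M N) :
    M.bar.cohomologySupport ⊆ N.bar.cohomologySupport := by
  obtain ⟨f, g, h₁, -⟩ := h.exists_homs
  have := h₁.bar
  rw [barMap_id, barMap_comp] at this
  exact cohomologySupport_subset _ _ this

/-- If `M` starts in degree `n`, then `M A⁺` starts in degree `n + 1`: generators of lowest degree
cannot die in the reduction. -/
theorem gradeProj_eq_zero_of_mem_plus (hpos : ∀ i : ℤ, i < 0 → 𝒜.gr i = ⊥) {M : DGMod 𝒜} {n : ℤ}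
    (hM : ∀ i < n, M.gr i = ⊥) {x : M.carrier} (hx : x ∈ M.plus.toSubmodule) :
    gradeProj M.gr M.isInternal n x = 0 := by
  change x ∈ Submodule.span _ _ at hx
  induction hx using Submodule.closure_induction with
  | zero => rw [map_zero]
  | add x y _ _ hx hy => rw [map_add, hx, hy, add_zero]
  | smul_mem r x hx =>
    obtain ⟨i, j, m, a, hm, ha, hj, rfl⟩ := hx
    rcases lt_or_ge i n with hi | hi
    · rw [hM i hi, AddSubgroup.mem_bot] at hm
      simp [hm]
    · have h1 := gradeProj_smul M (M.smul_mem hm ha) (n - (i + j)) r.unop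
      rw [add_sub_cancel] at h1
      have h2 : gradeProj 𝒜.addGr 𝒜.isInternal (n - (i + j)) r.unop ∈ 𝒜.gr (n - (i + j)) :=
        gradeProj_mem 𝒜.isInternal _ _
      rw [hpos _ (by omega), Submodule.mem_bot] at h2
      rw [h2, MulOpposite.op_zero, zero_smul] at h1
      exact h1

/-- Each layer contributes to `M / M A⁺` in its generating degree. A generator `x` of the bottom
layer is not in `M A⁺`, for otherwise the retraction `ρ` would put it in `K A⁺`, which has no
component in degree `n'`. The hypothesis passes to the quotient through the graded section. -/
theorem Sorted.sorted_zero (hpos : ∀ i : ℤ, i < 0 → 𝒜.gr i = ⊥) {I : Set ℤ} {n : ℤ} {l : ℕ}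
    {M : DGMod 𝒜} (h : Sorted I n l M)
    (hM : ∀ i, ∀ x ∈ M.gr i, x ∉ M.plus.toSubmodule → i = 0) : Sorted {0} 0 l M := by
  induction h with
  | zero h => exact .zero h
  | @ext n n' l K E Q hn hI hK s hQ ih =>
    obtain ⟨x, hx, hx0⟩ := hK.exists_ne_zero
    obtain rfl : n' = 0 := hM n' _ (Hom.map_mem s.i hx) fun h => by
      have h1 := gradeProj_eq_zero_of_mem_plus hpos (fun i hi => gr_eq_bot_of_gen hpos hK.gen hi)
        (map_plus s.ρ 0 (fun i _ hm => (add_zero i).symm ▸ s.ρ_mem hm) h)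
      rw [s.ρ_i, gradeProj_same _ hx] at h1
      exact hx0 h1
    refine .ext le_rfl rfl hK s (ih fun i y hy hyp => hM i (s.σ y) (s.σ_mem hy) fun h => hyp ?_)
    have h1 := map_plus (Hom.toLin s.q) 0
      (fun i _ hm => (add_zero i).symm ▸ Hom.map_mem s.q hm) h
    rwa [s.q_σ] at h1

/-- By minimality the reduction has zero differential, so each of its nonzero homogeneous elements
is a nonzero cohomology class. -/
theorem Sorted.sorted_zero_of_cohomologySupport (hpos : ∀ i : ℤ, i < 0 → 𝒜.gr i = ⊥) {I : Set ℤ}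
    {n : ℤ} {l : ℕ} {M : DGMod 𝒜} (h : Sorted I n l M)
    (hM : M.bar.cohomologySupport ⊆ {0}) : Sorted {0} 0 l M := by
  refine h.sorted_zero hpos fun i x hx hxp => hM (mem_cohomologySupport.2
    ⟨Hom.toLin M.plus.proj x, Hom.map_mem M.plus.proj hx, ?_, fun y _ hyx => ?_⟩)
  · exact (Hom.comm M.plus.proj x).symm.trans ((Sub.proj_eq_zero _).2 (h.d_mem_plus hpos x))
  · obtain ⟨y, rfl⟩ := M.plus.proj_surjective y
    refine hxp ((Sub.proj_eq_zero _).1 (hyx.symm.trans ?_))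
    exact (Hom.comm M.plus.proj y).symm.trans ((Sub.proj_eq_zero _).2 (h.d_mem_plus hpos y))

theorem Sorted.gen {n m : ℤ} {l : ℕ} {M : DGMod 𝒜} (h : Sorted {n} m l M) :
    Submodule.span 𝒜.carrierᵐᵒᵖ (M.gr n : Set M.carrier) = ⊤ := by
  induction h with
  | zero h => exact Subsingleton.elim _ _
  | @ext _ n' l K E Q hn hI hK s hQ ih =>
    obtain rfl : n' = n := hI
    have key : ∀ {N : DGMod 𝒜} (f : N.carrier →ₗ[𝒜.carrierᵐᵒᵖ] E.carrier)
        (_ : ∀ x ∈ N.gr n', f x ∈ E.gr n')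
        (_ : Submodule.span 𝒜.carrierᵐᵒᵖ (N.gr n' : Set N.carrier) = ⊤) (x : N.carrier),
        f x ∈ Submodule.span 𝒜.carrierᵐᵒᵖ (E.gr n' : Set E.carrier) := by
      intro N f hf hN x
      have h1 : Submodule.span 𝒜.carrierᵐᵒᵖ (N.gr n' : Set N.carrier) ≤
          (Submodule.span 𝒜.carrierᵐᵒᵖ (E.gr n' : Set E.carrier)).comap f :=
        Submodule.span_le.2 fun y hy => Submodule.subset_span (hf y hy)
      exact h1 (hN ▸ trivial)
    rw [eq_top_iff]
    intro x _
    rw [← s.sum x]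
    exact add_mem (key (Hom.toLin s.i) (fun _ h => Hom.map_mem s.i h) hK.gen _)
      (key s.σ (fun _ h => s.σ_mem h) ih _)

/-- The reduction itself is concentrated in degree `n`: below `n` the module is zero, and above `n`
it is contained in `M A⁺`. -/
theorem cohomologySupport_bar_subset_of_gen (hpos : ∀ i : ℤ, i < 0 → 𝒜.gr i = ⊥) {M : DGMod 𝒜}
    {n : ℤ} (h : Submodule.span 𝒜.carrierᵐᵒᵖ (M.gr n : Set M.carrier) = ⊤) :
    M.bar.cohomologySupport ⊆ {n} := by
  intro i hi
  obtain ⟨_, ⟨m, hm, rfl⟩, -, hy⟩ := mem_cohomologySupport.1 hi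
  rcases lt_trichotomy i n with hin | hin | hin
  · refine (hy 0 (zero_mem _) ?_).elim
    rw [gr_eq_bot_of_gen hpos h hin] at hm
    rw [(AddSubgroup.mem_bot).1 hm, map_zero]
    exact (map_zero _).symm
  · exact hin
  · refine (hy 0 (zero_mem _) ?_).elim
    rw [map_zero]
    exact ((Sub.proj_eq_zero _).2 (mem_plus_of_gen h hin hm)).symm

/-- The objects of the heart are, up to homotopy equivalence, the sorted modules generated in
degree zero. -/
theorem heart_iff (hpos : ∀ i : ℤ, i < 0 → 𝒜.gr i = ⊥) (hss : IsSemisimpleRing 𝒜.zeroPart)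
    (hd : ∀ a ∈ 𝒜.gr 0, 𝒜.d a = 0) {M : DGMod 𝒜} :
    heart 𝒜 ((toHot 𝒜).obj M) ↔ ∃ l G, Sorted {0} 0 l G ∧ HotEquiv M G := by
  constructor
  · rintro ⟨⟨h1, h2⟩, -, h3⟩
    obtain ⟨n, l, G, hG, h⟩ := h1 _ (isThickContainingSelf_hotSorted hpos hss hd)
    exact ⟨l, G, hG.sorted_zero_of_cohomologySupport hpos fun i hi => le_antisymm
      (h2 (h.symm.cohomologySupport_bar_subset hi)) (h3 (h.symm.cohomologySupport_bar_subset hi)), h⟩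
  · rintro ⟨l, G, hG, h⟩
    have h1 := dgPer_of_hotEquiv h (hG.dgPer hss hd)
    have h2 : M.bar.cohomologySupport ⊆ {0} :=
      h.cohomologySupport_bar_subset.trans (cohomologySupport_bar_subset_of_gen hpos hG.gen)
    exact ⟨⟨h1, fun i hi => (h2 hi).le⟩, h1, fun i hi => (h2 hi).ge⟩

/-! ### Split extensions with free quotient -/

/-- A short exact sequence with a graded section is a split extension. -/
def SplitExt.ofSection {K E Q : DGMod 𝒜} (i : K ⟶ E) (q : E ⟶ Q)
    (σ : Q.carrier →ₗ[𝒜.carrierᵐᵒᵖ] E.carrier)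
    (σ_mem : ∀ {n : ℤ} {x : Q.carrier}, x ∈ Q.gr n → σ x ∈ E.gr n)
    (q_σ : ∀ x, Hom.toLin q (σ x) = x) (hi : Function.Injective (Hom.toLin i))
    (q_i : ∀ x, Hom.toLin q (Hom.toLin i x) = 0)
    (hex : ∀ x, Hom.toLin q x = 0 → ∃ y, Hom.toLin i y = x) : SplitExt K E Q :=
  let p : E.carrier →ₗ[𝒜.carrierᵐᵒᵖ] LinearMap.range (Hom.toLin i) :=
    (LinearMap.id - σ.comp (Hom.toLin q)).codRestrict _ fun x =>
      hex _ (by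
        rw [LinearMap.sub_apply, map_sub, LinearMap.comp_apply, q_σ, LinearMap.id_apply, sub_self])
  let e := LinearEquiv.ofInjective (Hom.toLin i) hi
  have hp : ∀ x, Hom.toLin i (e.symm (p x)) = x - σ (Hom.toLin q x) := fun x => by
    have h := congrArg Subtype.val (e.apply_symm_apply (p x))
    rwa [LinearEquiv.ofInjective_apply] at h
  { i := i
    q := q
    ρ := e.symm.toLinearMap.comp p
    σ := σ
    ρ_mem := by
      intro n x hx
      change e.symm (p x) ∈ K.gr n
      have h1 : gradeProj K.gr K.isInternal n (e.symm (p x)) = e.symm (p x) := by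
        apply hi
        rw [Hom.map_gradeProj, hp, gradeProj_same]
        exact sub_mem hx (σ_mem (Hom.map_mem q hx))
      rw [← h1]
      exact gradeProj_mem _ _ _
    σ_mem := σ_mem
    ρ_i := fun x => by
      apply hi
      change Hom.toLin i (e.symm (p (Hom.toLin i x))) = _
      rw [hp, q_i, map_zero, sub_zero]
    q_σ := q_σ
    sum := fun x => by
      change Hom.toLin i (e.symm (p x)) + _ = x
      rw [hp, sub_add_cancel] }

/-- Short exact sequences whose quotient is free on an `A^0`-module split as graded modules. -/
theorem FreeOn.nonempty_splitExt_of_exact (hss : IsSemisimpleRing 𝒜.zeroPart) {n : ℤ}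
    {K E Q : DGMod 𝒜} (hQ : FreeOn n Q) (i : K ⟶ E) (q : E ⟶ Q)
    (hi : Function.Injective (Hom.toLin i)) (hq : Function.Surjective (Hom.toLin q))
    (q_i : ∀ x, Hom.toLin q (Hom.toLin i x) = 0)
    (hex : ∀ x, Hom.toLin q x = 0 → ∃ y, Hom.toLin i y = x) : Nonempty (SplitExt K E Q) := by
  have h1 : Function.Surjective (Hom.deg q n) := fun y => by
    obtain ⟨x, hx⟩ := hq y
    refine ⟨⟨gradeProj E.gr E.isInternal n x, gradeProj_mem _ _ _⟩, Subtype.ext ?_⟩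
    change Hom.toLin q (gradeProj E.gr E.isInternal n x) = y
    rw [Hom.map_gradeProj, hx, gradeProj_same _ y.2]
  -- A section over `A^0` exists on the generators and extends freely over `A`. It need not commute
  -- with `d`; only the graded splitting is required.
  have : Module.Projective 𝒜.zeroPartᵐᵒᵖ (Q.gr n) := Module.projective_of_isSemisimpleRing _ _
  obtain ⟨ψ, hψ⟩ := Module.projective_lifting_property (Hom.deg q n) LinearMap.id h1
  obtain ⟨σ, hσ⟩ := hQ.exists_linear ψ
  have h2 : (Hom.toLin q).comp σ = LinearMap.id := linearMap_ext_of_gen hQ.gen fun m hm => by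
    rw [LinearMap.comp_apply, hσ ⟨m, hm⟩]
    exact congrArg Subtype.val (LinearMap.congr_fun hψ ⟨m, hm⟩)
  refine ⟨SplitExt.ofSection i q σ (fun {j x} hx => ?_) (LinearMap.congr_fun h2) hi q_i hex⟩
  have h3 := map_mem_of_gen (N := E) (j := 0) hQ.gen σ
    (fun m hm => by rw [hσ ⟨m, hm⟩, add_zero]; exact (ψ ⟨m, hm⟩).2) hx
  rwa [add_zero] at h3

/-- Split extensions can be transported along isomorphisms of the middle term. -/
def SplitExt.ofIso {K E E' Q : DGMod 𝒜} (s : SplitExt K E Q) (e : E ≅ E') : SplitExt K E' Q where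
  i := s.i ≫ e.hom
  q := e.inv ≫ s.q
  ρ := s.ρ.comp (Hom.toLin e.inv)
  σ := (Hom.toLin e.hom).comp s.σ
  ρ_mem h := s.ρ_mem (Hom.map_mem e.inv h)
  σ_mem h := Hom.map_mem e.hom (s.σ_mem h)
  ρ_i x := by
    rw [toLin_comp_apply, LinearMap.comp_apply, ← toLin_comp_apply e.hom, e.hom_inv_id]
    exact s.ρ_i x
  q_σ x := by
    rw [toLin_comp_apply, LinearMap.comp_apply, ← toLin_comp_apply e.hom, e.hom_inv_id]
    exact s.q_σ x
  sum x := by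
    rw [toLin_comp_apply, toLin_comp_apply, LinearMap.comp_apply, LinearMap.comp_apply, ← map_add,
      s.sum, ← toLin_comp_apply, e.inv_hom_id]
    rfl

/-! ### Filtrations -/

theorem Sorted.of_isHat {n : ℤ} {K : DGMod 𝒜} (hK : IsHat n K) : Sorted {n} n 1 K := by
  refine .ext le_rfl rfl hK
    (SplitExt.ofRetraction (𝟙 K) LinearMap.id (fun h => h) fun x => rfl) (.zero ⟨fun x y => ?_⟩)
  have h1 : ∀ x, x = Hom.toLin (Sub.range (𝟙 K)).proj 0 := fun x => by
    obtain ⟨x, rfl⟩ := (Sub.range (𝟙 K)).proj_surjective x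
    rw [map_zero]
    exact (Sub.proj_eq_zero _).2 ⟨x, rfl⟩
  rw [h1 x, h1 y]

/-- `M` has a finite filtration, given from the top, by subquotients free on simple `A^0`-modules
in degree zero. -/
inductive TopFlag : DGMod 𝒜 → Prop
  | zero {M : DGMod 𝒜} (h : Subsingleton M.carrier) : TopFlag M
  | ext {M E K : DGMod 𝒜} (hM : TopFlag M) (s : SplitExt M E K) (hK : IsHat 0 K) : TopFlag E

theorem TopFlag.of_iso {M N : DGMod 𝒜} (e : M ≅ N) (h : TopFlag M) : TopFlag N := by
  cases h with
  | zero h => exact .zero ((bijective_of_iso e).2.subsingleton)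
  | ext hM s hK => exact .ext hM (s.ofIso e) hK

/-- Passing from flags peeled from the top to flags peeled from the bottom is possible because
extensions of modules sorted in one degree are again sorted. -/
theorem TopFlag.exists_sorted (hpos : ∀ i : ℤ, i < 0 → 𝒜.gr i = ⊥) {M : DGMod 𝒜}
    (h : TopFlag M) : ∃ l, Sorted {0} 0 l M := by
  induction h with
  | zero h => exact ⟨0, .zero h⟩
  | ext hM s hK ih =>
    obtain ⟨l, hl⟩ := ih
    exact Sorted.of_splitExt hpos s hl (.of_isHat hK)

variable (hd : ∀ a ∈ 𝒜.gr 0, 𝒜.d a = 0) {W : Type w} {L : W → ModuleCat.{u} 𝒜.zeroPartᵐᵒᵖ}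

/-- Each `F_j` is an extension of its subquotient `L̂_x` by `F_{j-1}`. The graded splitting comes
for free, since `L̂_x` is free on a projective `A^0`-module. -/
theorem TopFlag.of_dgFlag (hss : IsSemisimpleRing 𝒜.zeroPart) (hL : IsSimpleSystem 𝒜 L)
    {M : DGMod 𝒜} (h : dgFlag 𝒜 hd L M) : TopFlag M := by
  obtain ⟨n, F, h0, hn, hF⟩ := h
  have key : ∀ j : Fin (n + 1), TopFlag (F j).toDGMod := by
    intro j
    induction j using Fin.induction with
    | zero => exact .zero ((Submodule.subsingleton_iff_eq_bot).2 h0)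
    | succ j ih =>
      obtain ⟨hle, x, ⟨e⟩⟩ := hF j
      have := hL.simple x
      have hK := (isHat_hat (L x) hd).of_iso e.symm
      obtain ⟨s⟩ := hK.toFreeOn.nonempty_splitExt_of_exact hss
        ((F j.succ).lift (F j.castSucc).incl fun x => hle x.2)
        (((F j.castSucc).restrict (F j.succ)).proj)
        (fun x y h => Subtype.ext (congrArg (Hom.toLin (F j.succ).incl) h)) (Sub.proj_surjective _)
        (fun x => (Sub.proj_eq_zero _).2 x.2)
        (fun x hx => ⟨⟨x.1, (Sub.proj_eq_zero ((F j.castSucc).restrict (F j.succ))).1 hx⟩, rfl⟩)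
      exact .ext ih s hK
  refine (key (Fin.last n)).of_iso (isoOfBijective (F (Fin.last n)).incl
    ⟨Subtype.val_injective, fun x => ⟨⟨x, hn ▸ trivial⟩, rfl⟩⟩)

/-- A surjective morphism with kernel `U ∩ V` identifies the subquotient `V / (U ∩ V)`. -/
theorem Sub.nonempty_subquotient_iso {M N : DGMod 𝒜} (U V : Sub M) (f : V.toDGMod ⟶ N)
    (hf : Function.Surjective (Hom.toLin f))
    (hU : ∀ x, Hom.toLin f x = 0 ↔ Hom.toLin V.incl x ∈ U.toSubmodule) :
    Nonempty (Sub.subquotient U V ≅ N) := by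
  let g : Sub.subquotient U V ⟶ N := (U.restrict V).desc f fun x hx => (hU x).2 hx
  have hg : ∀ x, Hom.toLin g (Hom.toLin (U.restrict V).proj x) = Hom.toLin f x := fun _ => rfl
  refine ⟨isoOfBijective g ⟨(injective_iff_map_eq_zero _).2 fun x hx => ?_, fun y => ?_⟩⟩
  · obtain ⟨x, rfl⟩ := (U.restrict V).proj_surjective x
    exact (Sub.proj_eq_zero _).2 ((hU x).1 hx)
  · obtain ⟨x, rfl⟩ := hf y
    exact ⟨_, hg x⟩

/-- The preimage of a dg submodule. -/
def Sub.comap {M N : DGMod 𝒜} (f : M ⟶ N) (V : Sub N) : Sub M where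
  toSubmodule := V.toSubmodule.comap (Hom.toLin f)
  homogeneous m hm i := by
    change Hom.toLin f _ ∈ V.toSubmodule
    rw [Hom.map_gradeProj]
    exact V.homogeneous _ hm i
  d_mem m hm := by
    change Hom.toLin f (M.d m) ∈ V.toSubmodule
    rw [Hom.comm]
    exact V.d_mem _ hm

/-- The zero dg submodule. -/
def Sub.bot (M : DGMod 𝒜) : Sub M where
  toSubmodule := ⊥
  homogeneous m hm i := by
    rw [(Submodule.mem_bot _).1 hm, map_zero]
    exact zero_mem _
  d_mem m hm := by
    rw [(Submodule.mem_bot _).1 hm, map_zero]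
    exact zero_mem _

theorem IsHat.exists_iso_hat (hL : IsSimpleSystem 𝒜 L) {K : DGMod 𝒜} (hK : IsHat 0 K) :
    ∃ x, Nonempty (K ≅ hat (L x) hd) := by
  obtain ⟨x, ⟨e⟩⟩ := hL.exists_iso (ModuleCat.of _ (K.gr 0)) hK.simple
  exact ⟨x, hK.toFreeOn.nonempty_iso_hat _ hd e.toLinearEquiv⟩

/-- The filtration of `Q` is pulled back along `s.q`, and `0` is added at the bottom. The first new
subquotient is the kernel `K` of `s.q`; the others are those of `Q`. -/
theorem Sorted.dgFlag (hL : IsSimpleSystem 𝒜 L) {n : ℤ} {l : ℕ} {M : DGMod 𝒜}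
    (h : Sorted {0} n l M) : dgFlag 𝒜 hd L M := by
  induction h with
  | @zero n M h =>
    exact ⟨0, fun _ => Sub.bot M, rfl, Subsingleton.elim _ _, fun i => i.elim0⟩
  | @ext _ n' l K E Q hn hI hK s hQ ih =>
    obtain rfl : n' = 0 := hI
    obtain ⟨m, F, h0, hm, hF⟩ := ih
    refine ⟨m + 1, Fin.cons (Sub.bot E) fun j => (F j).comap s.q, rfl, ?_, fun j => ?_⟩
    · change ((F (Fin.last m)).comap s.q).toSubmodule = ⊤
      change (F (Fin.last m)).toSubmodule.comap (Hom.toLin s.q) = ⊤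
      rw [hm, Submodule.comap_top]
    · induction j using Fin.cases with
      | zero =>
        refine ⟨bot_le, ?_⟩
        obtain ⟨x, ⟨e⟩⟩ := hK.exists_iso_hat hd hL
        let V := (F 0).comap s.q
        have hV : ∀ x : V.toDGMod.carrier, Hom.toLin s.q (Hom.toLin V.incl x) = 0 := fun x => by
          have h1 : Hom.toLin s.q (Hom.toLin V.incl x) ∈ (F 0).toSubmodule := x.2
          rwa [h0, Submodule.mem_bot] at h1
        have hV' : ∀ y : K.carrier, Hom.toLin s.i y ∈ V.toSubmodule := fun y => by
          change Hom.toLin s.q (Hom.toLin s.i y) ∈ (F 0).toSubmodule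
          rw [s.q_i]
          exact zero_mem _
        obtain ⟨e'⟩ := Sub.nonempty_subquotient_iso (Sub.bot E) V
          (s.lift V.incl (hom_ext' hV)) (fun y => ⟨⟨Hom.toLin s.i y, hV' y⟩, s.ρ_i y⟩) fun x => by
            change s.ρ (Hom.toLin V.incl x) = 0 ↔ Hom.toLin V.incl x ∈ (⊥ : Submodule _ _)
            rw [Submodule.mem_bot]
            refine ⟨fun h => ?_, fun h => by rw [h, map_zero]⟩
            rw [← s.i_ρ_of_q_eq_zero (hV x), h, map_zero]
        exact ⟨x, ⟨e' ≪≫ e⟩⟩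
      | succ j =>
        obtain ⟨hle, x, ⟨e⟩⟩ := hF j
        refine ⟨fun x hx => hle hx, x, ?_⟩
        let U := (F j.castSucc).comap s.q
        let V := (F j.succ).comap s.q
        obtain ⟨e'⟩ := Sub.nonempty_subquotient_iso U V
          ((F j.succ).lift (V.incl ≫ s.q) (fun x => x.2) ≫
            ((F j.castSucc).restrict (F j.succ)).proj)
          (fun y => by
            obtain ⟨⟨y, hy⟩, rfl⟩ := Sub.proj_surjective _ y
            obtain ⟨y, rfl⟩ := s.q_surj y
            exact ⟨⟨y, hy⟩, rfl⟩)
          fun x => Sub.proj_eq_zero _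
        exact ⟨e' ≪≫ e⟩

theorem dgFlag_iff (hpos : ∀ i : ℤ, i < 0 → 𝒜.gr i = ⊥) (hss : IsSemisimpleRing 𝒜.zeroPart)
    (hL : IsSimpleSystem 𝒜 L) {M : DGMod 𝒜} : DGPerf.dgFlag 𝒜 hd L M ↔ ∃ l, Sorted {0} 0 l M :=
  ⟨fun h => (TopFlag.of_dgFlag hd hss hL h).exists_sorted hpos, fun ⟨_, h⟩ => h.dgFlag hd hL⟩

/-- Morphisms from a module generated in degree `n` to a module vanishing in degree `n - 1` are
homotopic only if they are equal. -/
theorem Homotopic.eq_of_gen {M N : DGMod 𝒜} {n : ℤ}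
    (hM : Submodule.span 𝒜.carrierᵐᵒᵖ (M.gr n : Set M.carrier) = ⊤) (hN : N.gr (n - 1) = ⊥)
    {f g : M ⟶ N} (h : Homotopic f g) : f = g := by
  obtain ⟨h, h1, h2⟩ := h
  have h0 : h = 0 := linearMap_ext_of_gen hM fun m hm => by
    have := h1 n m hm
    rwa [hN, AddSubgroup.mem_bot] at this
  refine hom_ext' fun m => sub_eq_zero.1 ?_
  rw [h2, h0]
  simp

end DGMod

/-! ### Short exact sequences and finite length -/

/-- The category is only preadditive, so homology is exhibited by hand. As `f` is a kernel of `g`,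
the map from `X₁` to the cycles is the identity and its cokernel is the zero object `Z`; the
right-hand data are dual. -/
theorem shortExact_of_isLimit_of_isColimit {C : Type*} [Category* C] [Preadditive C]
    (S : ShortComplex C) {Z : C} (hZ : IsZero Z) (hf : IsLimit (KernelFork.ofι S.f S.zero))
    (hg : IsColimit (CokernelCofork.ofπ S.g S.zero)) : S.ShortExact := by
  have hm : Mono S.f := mono_of_isLimit_fork hf
  have he : Epi S.g := epi_of_isColimit_cofork hg
  have : Epi (0 : S.X₁ ⟶ Z) := ⟨fun _ _ _ => hZ.eq_of_src _ _⟩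
  have : Mono (0 : Z ⟶ S.X₃) := ⟨fun _ _ _ => hZ.eq_of_tgt _ _⟩
  let l : S.LeftHomologyData :=
    { K := S.X₁
      H := Z
      i := S.f
      π := 0
      wi := S.zero
      hi := hf
      wπ := comp_zero
      hπ := CokernelCofork.IsColimit.ofπ' _ _ fun {A} x hx => ⟨0, by
        have h1 : hf.lift (KernelFork.ofι S.f S.zero) = 𝟙 S.X₁ := by
          rw [← cancel_mono S.f]
          exact (hf.fac _ WalkingParallelPair.zero).trans (Category.id_comp _).symm
        have h2 : 𝟙 S.X₁ ≫ x = 0 := by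
          rw [← h1]
          exact hx
        rw [zero_comp, ← h2, Category.id_comp]⟩ }
  let r : S.RightHomologyData :=
    { Q := S.X₃
      H := Z
      p := S.g
      ι := 0
      wp := S.zero
      hp := hg
      wι := zero_comp
      hι := KernelFork.IsLimit.ofι' _ _ fun {A} x hx => ⟨0, by
        have h1 : hg.desc (CokernelCofork.ofπ S.g S.zero) = 𝟙 S.X₃ := by
          rw [← cancel_epi S.g]
          exact (hg.fac _ WalkingParallelPair.one).trans (Category.comp_id _).symm
        have h2 : x ≫ 𝟙 S.X₃ = 0 := by
          rw [← h1]
          exact hx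
        rw [comp_zero, ← h2, Category.comp_id]⟩ }
  exact
    { exact := ⟨⟨⟨l, r, Iso.refl Z, by simp [l, r]⟩, hZ⟩⟩
      mono_f := hm
      epi_g := he }

theorem HasFiniteLength.of_iso {C : Type*} [Category* C] [Preadditive C] {X Y : C} (e : X ≅ Y)
    (h : HasFiniteLength X) : HasFiniteLength Y := by
  cases h with
  | of_isZero _ hX => exact .of_isZero _ (hX.of_iso e.symm)
  | of_shortExact S hS h₁ h₃ =>
    let S' : ShortComplex C := ShortComplex.mk (S.f ≫ e.hom) (e.inv ≫ S.g) (by simp)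
    let e' : S ≅ S' := ShortComplex.isoMk (Iso.refl _) e (Iso.refl _) (by simp [S']) (by simp [S'])
    exact .of_shortExact S' (ShortComplex.shortExact_of_iso e' hS) h₁ h₃

theorem HasFiniteLength.map {C D : Type*} [Category* C] [Preadditive C] [Category* D]
    [Preadditive D] (F : C ⥤ D) [F.IsEquivalence] [F.PreservesZeroMorphisms] {X : C}
    (h : HasFiniteLength X) : HasFiniteLength (F.obj X) := by
  induction h with
  | of_isZero X hX => exact .of_isZero _ (F.map_isZero hX)
  | of_shortExact S hS h₁ h₃ ih =>
    exact .of_shortExact (S.map F) (hS.map_of_exact F) ih (simple_obj F S.X₃)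

namespace DGMod

/-! ### The category of modules with a flag -/

section Flag

variable (hd : ∀ a ∈ 𝒜.gr 0, 𝒜.d a = 0) {W : Type w} {L : W → ModuleCat.{u} 𝒜.zeroPartᵐᵒᵖ}

theorem isZero_of_subsingleton {P : ObjectProperty (DGMod 𝒜)} {X : P.FullSubcategory}
    (h : Subsingleton X.obj.carrier) : IsZero X :=
  (IsZero.iff_id_eq_zero X).2
    (ObjectProperty.hom_ext _ (hom_ext' fun _ => Subsingleton.elim _ _))

theorem mono_of_injective {P : ObjectProperty (DGMod 𝒜)} {X Y : P.FullSubcategory} (f : X ⟶ Y)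
    (hf : Function.Injective (Hom.toLin f.hom)) : Mono f where
  right_cancellation _ _ hgh := ObjectProperty.hom_ext _ (hom_ext' fun x => hf
    (LinearMap.congr_fun (congrArg (fun φ => Hom.toLin φ.hom) hgh) x))

/-- A split extension within a full subcategory containing a zero module is short exact. -/
theorem SplitExt.shortExact {P : ObjectProperty (DGMod 𝒜)} {X₁ X₂ X₃ Z : P.FullSubcategory}
    (hZ : IsZero Z) (s : SplitExt X₁.obj X₂.obj X₃.obj) :
    (ShortComplex.mk (P.homMk s.i) (P.homMk s.q)
      (ObjectProperty.hom_ext _ s.i_comp_q)).ShortExact := by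
  have : Mono (P.homMk s.i) := mono_of_injective _ s.i_inj
  have : Epi (P.homMk s.q) := ⟨fun _ _ hgh => ObjectProperty.hom_ext _ (hom_ext' fun x => by
    obtain ⟨x, rfl⟩ := s.q_surj x
    exact LinearMap.congr_fun (congrArg (fun φ => Hom.toLin φ.hom) hgh) x)⟩
  exact shortExact_of_isLimit_of_isColimit _ hZ
    (KernelFork.IsLimit.ofι' (P.homMk s.i) (ObjectProperty.hom_ext _ s.i_comp_q) fun {A} f hf =>
      have hf' : f.hom ≫ s.q = 0 := congrArg (fun φ => φ.hom) hf
      ⟨P.homMk (s.lift f.hom hf'), ObjectProperty.hom_ext _ (s.lift_i f.hom hf')⟩)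
    (CokernelCofork.IsColimit.ofπ' (P.homMk s.q) (ObjectProperty.hom_ext _ s.i_comp_q)
      fun {A} f hf =>
      have hf' : s.i ≫ f.hom = 0 := congrArg (fun φ => φ.hom) hf
      ⟨P.homMk (s.desc f.hom hf'), ObjectProperty.hom_ext _ (s.q_desc f.hom hf')⟩)

theorem exists_isZero_dgFlag (hL : IsSimpleSystem 𝒜 L) :
    ∃ Z : (dgFlag 𝒜 hd L).FullSubcategory, IsZero Z := by
  have h : Subsingleton (Sub.bot (self 𝒜)).toDGMod.carrier :=
    (Submodule.subsingleton_iff_eq_bot).2 rfl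
  exact ⟨⟨_, (Sorted.zero (n := 0) h).dgFlag hd hL⟩, isZero_of_subsingleton h⟩

/-- A nonzero module with a flag has a submodule isomorphic to some `L̂`. -/
theorem exists_mono_of_not_isZero (hpos : ∀ i : ℤ, i < 0 → 𝒜.gr i = ⊥)
    (hss : IsSemisimpleRing 𝒜.zeroPart) (hL : IsSimpleSystem 𝒜 L)
    {X : (dgFlag 𝒜 hd L).FullSubcategory} (hX : ¬ IsZero X) :
    ∃ (K : (dgFlag 𝒜 hd L).FullSubcategory) (i : K ⟶ X), IsHat 0 K.obj ∧ Mono i ∧ i ≠ 0 := by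
  obtain ⟨l, h⟩ := (dgFlag_iff hd hpos hss hL).1 X.property
  generalize hM : X.obj = M at h
  cases h with
  | zero h => exact (hX (isZero_of_subsingleton (hM ▸ h))).elim
  | @ext _ n' _ K _ Q hn hI hK s hQ =>
    obtain rfl : n' = 0 := hI
    subst hM
    let K' : (dgFlag 𝒜 hd L).FullSubcategory := ⟨K, (Sorted.of_isHat hK).dgFlag hd hL⟩
    let i : K' ⟶ X := ObjectProperty.homMk s.i
    refine ⟨K', i, hK, mono_of_injective i s.i_inj, fun h => ?_⟩
    obtain ⟨x, hx, hx0⟩ := hK.exists_ne_zero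
    have h1 : s.i = 0 := congrArg (fun φ => φ.hom) h
    refine hx0 (s.i_inj ?_)
    rw [h1, map_zero]
    rfl

/-- A nonzero subobject contains some `L̂`, whose composite to `X` is nonzero and hence an
isomorphism by Schur's lemma. This splits the inclusion of the subobject, which is therefore an
isomorphism. -/
theorem simple_of_isHat (hpos : ∀ i : ℤ, i < 0 → 𝒜.gr i = ⊥)
    (hss : IsSemisimpleRing 𝒜.zeroPart) (hL : IsSimpleSystem 𝒜 L)
    {X : (dgFlag 𝒜 hd L).FullSubcategory} (hX : IsHat 0 X.obj) : Simple X where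
  mono_isIso_iff_nonzero {Y} f _ := by
    constructor
    · rintro _ rfl
      obtain ⟨x, hx, hx0⟩ := hX.exists_ne_zero
      have h1 : 𝟙 X = 0 := by rw [← IsIso.inv_hom_id (0 : Y ⟶ X), comp_zero]
      exact hx0 (LinearMap.congr_fun (congrArg (fun φ => Hom.toLin φ.hom) h1) x)
    · intro hf
      obtain ⟨K, i, hK, _, hi⟩ := exists_mono_of_not_isZero hd hpos hss hL
        (X := Y) fun h => hf (h.eq_of_src _ _)
      have h1 : (i ≫ f).hom ≠ 0 := fun h => hi (by
        rw [← cancel_mono f, zero_comp]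
        exact ObjectProperty.hom_ext _ h)
      have h2 : IsIso (i ≫ f).hom := (hK.isIso_or_eq_zero hX (i ≫ f).hom).resolve_right h1
      have h3 : IsIso (i ≫ f) := (ObjectProperty.isIso_hom_iff _).1 h2
      have : IsSplitEpi f := ⟨⟨⟨inv (i ≫ f) ≫ i, by rw [Category.assoc, IsIso.inv_hom_id]⟩⟩⟩
      exact isIso_of_mono_of_isSplitEpi f

theorem exists_iso_of_simple (hpos : ∀ i : ℤ, i < 0 → 𝒜.gr i = ⊥)
    (hss : IsSemisimpleRing 𝒜.zeroPart) (hL : IsSimpleSystem 𝒜 L)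
    {X : (dgFlag 𝒜 hd L).FullSubcategory} (hX : Simple X) :
    ∃ x, Nonempty (X.obj ≅ hat (L x) hd) := by
  obtain ⟨K, i, hK, _, hi⟩ := exists_mono_of_not_isZero hd hpos hss hL
    fun h : IsZero X => id_nonzero X (h.eq_of_src _ _)
  have : IsIso i := isIso_of_mono_of_nonzero hi
  obtain ⟨x, ⟨e⟩⟩ := hK.exists_iso_hat hd hL
  exact ⟨x, ⟨(asIso i.hom).symm ≪≫ e⟩⟩

/-- Flags peeled from the top have the shape required by `HasFiniteLength`, where the simple object
is the quotient of the extension. -/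
theorem TopFlag.hasFiniteLength (hpos : ∀ i : ℤ, i < 0 → 𝒜.gr i = ⊥)
    (hss : IsSemisimpleRing 𝒜.zeroPart) (hL : IsSimpleSystem 𝒜 L)
    {M : DGMod 𝒜} (h : TopFlag M) (hM : dgFlag 𝒜 hd L M) :
    HasFiniteLength (⟨M, hM⟩ : (dgFlag 𝒜 hd L).FullSubcategory) := by
  induction h with
  | zero h => exact .of_isZero _ (isZero_of_subsingleton h)
  | @ext M E K hMt s hK ih =>
    have hM' : dgFlag 𝒜 hd L M := (dgFlag_iff hd hpos hss hL).2 (hMt.exists_sorted hpos)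
    have hK' : dgFlag 𝒜 hd L K := (Sorted.of_isHat hK).dgFlag hd hL
    obtain ⟨Z, hZ⟩ := exists_isZero_dgFlag hd hL
    exact .of_shortExact _
      (SplitExt.shortExact (X₁ := ⟨M, hM'⟩) (X₂ := ⟨E, _⟩) (X₃ := ⟨K, hK'⟩) hZ s) (ih hM')
      (simple_of_isHat hd hpos hss hL hK)

/-! ### The equivalence with the heart -/

theorem heart_of_dgFlag (hpos : ∀ i : ℤ, i < 0 → 𝒜.gr i = ⊥)
    (hss : IsSemisimpleRing 𝒜.zeroPart) (hL : IsSimpleSystem 𝒜 L)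
    {M : DGMod 𝒜} (hM : dgFlag 𝒜 hd L M) : heart 𝒜 ((toHot 𝒜).obj M) := by
  obtain ⟨l, h⟩ := (dgFlag_iff hd hpos hss hL).1 hM
  exact (heart_iff hpos hss hd).2 ⟨l, M, h, .refl M⟩

/-- A homotopy lowers degrees by one. The source is generated in degree zero and the target vanishes
in degree `-1`, so the only homotopy is zero. -/
theorem faithful_dgFlag (hpos : ∀ i : ℤ, i < 0 → 𝒜.gr i = ⊥)
    (hss : IsSemisimpleRing 𝒜.zeroPart) (hL : IsSimpleSystem 𝒜 L) :
    ((dgFlag 𝒜 hd L).ι ⋙ toHot 𝒜).Faithful where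
  map_injective {X Y} f g hfg := by
    obtain ⟨l, hX⟩ := (dgFlag_iff hd hpos hss hL).1 X.property
    obtain ⟨l', hY⟩ := (dgFlag_iff hd hpos hss hL).1 Y.property
    exact ObjectProperty.hom_ext _
      ((toHot_map_eq_iff.1 hfg).eq_of_gen hX.gen (hY.gr_eq_bot hpos (by omega)))

/-- Fullness is inherited from the quotient functor to `dgHot`, and essential surjectivity is the
existence of sorted models in the heart. -/
theorem isEquivalence_lift (hpos : ∀ i : ℤ, i < 0 → 𝒜.gr i = ⊥)
    (hss : IsSemisimpleRing 𝒜.zeroPart) (hL : IsSimpleSystem 𝒜 L)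
    (h : ∀ M : (dgFlag 𝒜 hd L).FullSubcategory,
      heart 𝒜 (((dgFlag 𝒜 hd L).ι ⋙ toHot 𝒜).obj M)) :
    ((heart 𝒜).lift ((dgFlag 𝒜 hd L).ι ⋙ toHot 𝒜) h).IsEquivalence := by
  have := faithful_dgFlag hd hpos hss hL
  exact
    { essSurj := ⟨fun X => by
        obtain ⟨l, G, hG, ⟨e⟩⟩ := (heart_iff (M := X.obj.as) hpos hss hd).1 X.property
        exact ⟨⟨G, hG.dgFlag hd hL⟩, ⟨ObjectProperty.isoMk _ e.symm⟩⟩⟩ }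

/-- The module `L` is recovered from `L̂` as its component of degree zero. -/
theorem eq_of_hat_iso (hL : IsSimpleSystem 𝒜 L) {x y : W} (e : hat (L x) hd ≅ hat (L y) hd) :
    x = y := by
  have h1 : ∀ m, Hom.toLin e.inv (Hom.toLin e.hom m) = m := fun m => by
    rw [← toLin_comp_apply, e.hom_inv_id]; rfl
  have h2 : ∀ m, Hom.toLin e.hom (Hom.toLin e.inv m) = m := fun m => by
    rw [← toLin_comp_apply, e.inv_hom_id]; rfl
  let E : (hat (L x) hd).gr 0 ≃ₗ[𝒜.zeroPartᵐᵒᵖ] (hat (L y) hd).gr 0 :=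
    LinearEquiv.ofLinearMap (Hom.deg e.hom 0) (Hom.deg e.inv 0)
      (LinearMap.ext fun m => Subtype.ext (h2 m)) (LinearMap.ext fun m => Subtype.ext (h1 m))
  exact hL.eq_of_iso x y
    ⟨(((hatZeroEquiv (L x) hd).trans E).trans (hatZeroEquiv (L y) hd).symm).toModuleIso⟩

end Flag

end DGMod

end DGPerf

end

/-! ### The main theorem -/

open DGPerf in
theorem proposition6p5 {k : Type v} [CommRing k] (𝒜 : DGAlgebra.{u} k)
    (hpos : ∀ i : ℤ, i < 0 → 𝒜.gr i = ⊥)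
    (hss : IsSemisimpleRing 𝒜.zeroPart)
    (hd : ∀ a ∈ 𝒜.gr 0, 𝒜.d a = 0)
    {W : Type w} (L : W → ModuleCat.{u} 𝒜.zeroPartᵐᵒᵖ) (hL : IsSimpleSystem 𝒜 L) :
    (∃ h : ∀ M : (dgFlag 𝒜 hd L).FullSubcategory,
        heart 𝒜 (((dgFlag 𝒜 hd L).ι ⋙ toHot 𝒜).obj M),
      ((heart 𝒜).lift ((dgFlag 𝒜 hd L).ι ⋙ toHot 𝒜) h).IsEquivalence) ∧
    (∀ X : Heart 𝒜, HasFiniteLength X) ∧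
    (∀ x : W, ∃ hx : heart 𝒜 ((toHot 𝒜).obj (hat (L x) hd)),
      Simple (⟨(toHot 𝒜).obj (hat (L x) hd), hx⟩ : Heart 𝒜)) ∧
    (∀ X : Heart 𝒜, Simple X → ∃ x : W, Nonempty (X.obj ≅ (toHot 𝒜).obj (hat (L x) hd))) ∧
    (∀ x y : W, Nonempty ((toHot 𝒜).obj (hat (L x) hd) ≅ (toHot 𝒜).obj (hat (L y) hd)) →
      x = y) := by
  have hflag : ∀ x, dgFlag 𝒜 hd L (hat (L x) hd) := fun x => by
    have := hL.simple x
    exact (DGMod.Sorted.of_isHat (DGMod.isHat_hat (L x) hd)).dgFlag hd hL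
  have h : ∀ M : (dgFlag 𝒜 hd L).FullSubcategory,
      heart 𝒜 (((dgFlag 𝒜 hd L).ι ⋙ toHot 𝒜).obj M) := fun M =>
    DGMod.heart_of_dgFlag hd hpos hss hL M.property
  have hF := DGMod.isEquivalence_lift hd hpos hss hL h
  set F := (heart 𝒜).lift ((dgFlag 𝒜 hd L).ι ⋙ toHot 𝒜) h with hF_def
  have hF₀ : F.PreservesZeroMorphisms := ⟨fun _ _ => rfl⟩
  refine ⟨⟨h, hF⟩, fun X => ?_, fun x => ⟨h ⟨_, hflag x⟩, ?_⟩, fun X hX => ?_, fun x y ⟨e⟩ => ?_⟩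
  -- Finite length and simplicity are invariant under equivalence, so they are transported from
  -- `dgFlag` along `F`.
  · exact .of_iso (F.objObjPreimageIso X) (.map F
      ((DGMod.TopFlag.of_dgFlag hd hss hL (F.objPreimage X).property).hasFiniteLength
        hd hpos hss hL _))
  · have := hL.simple x
    have := DGMod.simple_of_isHat hd hpos hss hL (X := ⟨_, hflag x⟩) (DGMod.isHat_hat (L x) hd)
    exact simple_obj F ⟨_, hflag x⟩
  · have := Simple.of_iso (F.objObjPreimageIso X)
    obtain ⟨x, ⟨e⟩⟩ := DGMod.exists_iso_of_simple hd hpos hss hL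
      ((simple_obj_iff F (F.objPreimage X)).1 this)
    exact ⟨x, ⟨(heart 𝒜).ι.mapIso (F.objObjPreimageIso X).symm ≪≫ (toHot 𝒜).mapIso e⟩⟩
  -- By full faithfulness an isomorphism in `dgHot` comes from one of dg modules, whose component of
  -- degree zero identifies the two simple modules.
  · have := DGMod.faithful_dgFlag hd hpos hss hL
    let X : (dgFlag 𝒜 hd L).FullSubcategory := ⟨_, hflag x⟩
    let Y : (dgFlag 𝒜 hd L).FullSubcategory := ⟨_, hflag y⟩
    let e' : X ≅ Y := ((dgFlag 𝒜 hd L).ι ⋙ toHot 𝒜).preimageIso e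
    exact DGMod.eq_of_hat_iso hd hL ((dgFlag 𝒜 hd L).ι.mapIso e')
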